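/- **Setting.** Let $G=(V,E)$ be a simple bipartite graph with $n$ vertices, $m$ edges and maximum degree $\Delta\ge 1$. A partial $\Delta$-edge coloring is a map $\chi:E\to[\Delta]\cup\{\bot\}$ such that no two distinct edges sharing an endpoint receive the same color of $[\Delta]$; edges with $\chi(e)=\bot$ are uncolored, and a color is missing at a vertex $u$ if no edge at $u$ has it. Two colors $\alpha,\beta\in[\Delta]$ (distinct if $\Delta\ge2$) are *two least common colors* of $\chi$ if for every $\gamma\in[\Delta]\setminus\{\alpha,\beta\}$ and $\gamma'\in\{\alpha,\beta\}$, $|\{e:\chi(e)=\gamma\}|\ge|\{e:\chi(e)=\gamma'\}|$. The machine is a word RAM with words of $w\ge\kappa\log_2 n$ bits ($\kappa$ a constant), unit-cost word operations, and unit-cost sampling of a uniform element of $\{0,\dots,t-1\}$. The memory holds the endpoints of all edges, the degrees of all vertices, and the standard data structure for $\chi$: the color of each edge; for each $u\in V$ and $c\in[\Delta]$ the edge at $u$ with color $c$, if any; and for each $u$ the set of those colors among the first $\deg(u)$ that are missing at $u$, stored so that membership, insertion, deletion and finding an element take $O(1)$ time. It also holds the edges of $U$ (below) as an array and, as the answer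 of an auxiliary data structure that detects them, some pair $\alpha,\beta$ of two least common colors of $\chi$. Memory not used for the input is initially zero. **Lemma 3.2.** There are a randomized algorithm (a single program) and constants $c>0$, $k$ and $\kappa$ such that for every $a>0$ there is a constant $C$ with the following property. Let $\chi$ be any partial $\Delta$-edge coloring of a bipartite graph $G$ as above, and let $U\subseteq E$ be any matching of $\lambda$ edges, all uncolored in $\chi$. Then, with probability at least $1-n^{-a}$, the algorithm halts within $C\,(\log n)^k\cdot m/\Delta$ steps (that is, in $\tilde O(m/\Delta)$ time), and when it halts the memory holds $G$ and the above data structure for a partial $\Delta$-edge coloring $\chi'$ of $G$ such that every edge colored in $\chi$ is colored in $\chi'$, and at least $c\,\lambda/\Delta$ edges of $U$ are colored in $\chi'$. -/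

import Mathlib

/-! ### A randomized word RAM with a step count

The memory consists of banks of words, each bank being addressed by words; a program names only
finitely many banks. All arithmetic is on `w`-bit words: every result is reduced modulo `2 ^ w`. -/

namespace WordRAM

/-- Memory contents: the word stored in bank `b` at address `i` is `σ b i`. -/
abbrev Mem : Type := ℕ → ℕ → ℕ

/-- Binary word operations. Comparisons return `1` for true and `0` for false. -/
inductive BinOp : Type
  | add | sub | mul | div | mod | lt | eq

/-- Result of a binary operation before reduction to a `w`-bit word. Subtraction is truncated at
`0`; division by `0` gives `0`. -/
def BinOp.apply : BinOp → ℕ → ℕ → ℕ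
  | .add, x, y => x + y
  | .sub, x, y => x - y
  | .mul, x, y => x * y
  | .div, x, y => x / y
  | .mod, x, y => x % y
  | .lt, x, y => if x < y then 1 else 0
  | .eq, x, y => if x = y then 1 else 0

/-- Word-valued terms: constants, memory reads, and binary operations. -/
inductive WTerm : Type
  | const (k : ℕ)
  | load (b : ℕ) (addr : WTerm)
  | bin (o : BinOp) (s t : WTerm)

/-- Number of elementary operations needed to evaluate a term. -/
def WTerm.size : WTerm → ℕ
  | .const _ => 1
  | .load _ t => t.size + 1
  | .bin _ s t => s.size + t.size + 1

/-- Value of a term on a machine with word length `w`. -/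
def WTerm.val (w : ℕ) (σ : Mem) : WTerm → ℕ
  | .const k => k % 2 ^ w
  | .load b t => σ b (t.val w σ)
  | .bin o s t => o.apply (s.val w σ) (t.val w σ) % 2 ^ w

/-- Programs. `store b a t` writes the value of `t` to bank `b` at address `a`; `rand b a t` writes
there an independent uniformly random element of `{0, …, t - 1}`; `cond t c d` runs `c` if `t` is
nonzero and `d` otherwise; `loop t c` repeats `c` as long as `t` is nonzero. -/
inductive Prog : Type
  | skip
  | store (b : ℕ) (a t : WTerm)
  | rand (b : ℕ) (a t : WTerm)
  | seq (c d : Prog)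
  | cond (t : WTerm) (c d : Prog)
  | loop (t : WTerm) (c : Prog)

/-- Overwrite one memory cell. -/
def Mem.set (σ : Mem) (b i x : ℕ) : Mem :=
  fun b' i' => if b' = b ∧ i' = i then x else σ b' i'

/-- The uniform distribution on `{0, …, k - 1}` (the point mass at `0` if `k = 0`). -/
noncomputable def uniformBelow : ℕ → PMF ℕ
  | 0 => PMF.pure 0
  | k + 1 => (PMF.uniformOfFintype (Fin (k + 1))).map Fin.val

/-- The outcome of a run with a budget of steps: `none` if the budget is exhausted before the
program halts, and `some (σ, r)` if it halts with memory `σ` and with `r` steps left. -/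
abbrev Outcome : Type := Option (Mem × ℕ)

/-- Spend `k` of the `B` available steps and continue; run out of budget if `B < k`. -/
noncomputable def spend (k B : ℕ) (next : ℕ → PMF Outcome) : PMF Outcome :=
  if k ≤ B then next (B - k) else PMF.pure none

/-- Continue with `next` unless the budget has already been exhausted. -/
noncomputable def andThen (p : PMF Outcome) (next : Mem → ℕ → PMF Outcome) : PMF Outcome :=
  p.bind fun r => match r with
    | none => PMF.pure none
    | some (σ, B) => next σ B

/-- At most `k` rounds of a loop with guard `t`; each evaluation of the guard is paid for. -/
noncomputable def runLoop (w : ℕ) (t : WTerm) (body : Mem → ℕ → PMF Outcome) :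
    ℕ → Mem → ℕ → PMF Outcome
  | 0, _, _ => PMF.pure none
  | k + 1, σ, B => spend t.size B fun B' =>
      if t.val w σ = 0 then PMF.pure (some (σ, B'))
      else andThen (body σ B') (runLoop w t body k)

/-- Distribution of the outcome of running a program with word length `w` from memory `σ` for at
most `B` steps. Every instruction costs one step plus the sizes of the terms it evaluates (a loop
guard costs its size). As each loop round costs at least one step, the bound `B + 1` on the number
of rounds is never what stops a loop. -/
noncomputable def run (w : ℕ) : Prog → Mem → ℕ → PMF Outcome
  | .skip, σ, B => spend 1 B fun B' => PMF.pure (some (σ, B'))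
  | .store b a t, σ, B => spend (1 + a.size + t.size) B fun B' =>
      PMF.pure (some (σ.set b (a.val w σ) (t.val w σ), B'))
  | .rand b a t, σ, B => spend (1 + a.size + t.size) B fun B' =>
      (uniformBelow (t.val w σ)).map fun x => some (σ.set b (a.val w σ) x, B')
  | .seq c d, σ, B => andThen (run w c σ B) (run w d)
  | .cond t c d, σ, B => spend (1 + t.size) B fun B' =>
      if t.val w σ = 0 then run w d σ B' else run w c σ B'
  | .loop t c, σ, B => runLoop w t (run w c) (B + 1) σ B

/-- Probability that the program halts within `T` steps with a final memory satisfying `Q`. -/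
noncomputable def haltProb (w : ℕ) (P : Prog) (σ : Mem) (T : ℕ) (Q : Mem → Prop) : ENNReal :=
  (run w P σ T).toOuterMeasure {r | ∃ σ' B, r = some (σ', B) ∧ Q σ'}

end WordRAM

/-! ### Partial edge colorings -/

namespace EdgeColor

variable {n m Δ : ℕ}

/-- A partial assignment of the colors `0, …, Δ - 1` to edges; `none` means uncolored. -/
abbrev PartialColoring (G : SimpleGraph (Fin n)) (Δ : ℕ) : Type := G.edgeSet → Option (Fin Δ)

/-- Distinct edges with a common endpoint do not receive the same color. -/
def IsProper {G : SimpleGraph (Fin n)} (χ : PartialColoring G Δ) : Prop :=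
  ∀ e f : G.edgeSet, e ≠ f → (∃ v, v ∈ (e : Sym2 (Fin n)) ∧ v ∈ (f : Sym2 (Fin n))) →
    ∀ c, ¬ (χ e = some c ∧ χ f = some c)

/-- The colors missing at the vertex `u`. -/
def miss {G : SimpleGraph (Fin n)} (χ : PartialColoring G Δ) (u : Fin n) : Set (Fin Δ) :=
  {c | ∀ e : G.edgeSet, u ∈ (e : Sym2 (Fin n)) → χ e ≠ some c}

/-- Edges in `U` are pairwise vertex-disjoint. -/
def IsEdgeMatching {G : SimpleGraph (Fin n)} (U : Finset G.edgeSet) : Prop :=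
  ∀ e ∈ U, ∀ f ∈ U, e ≠ f → ¬ ∃ v, v ∈ (e : Sym2 (Fin n)) ∧ v ∈ (f : Sym2 (Fin n))

/-- Number of edges with color `c`. -/
noncomputable def colorCount {G : SimpleGraph (Fin n)} (χ : PartialColoring G Δ) (c : Fin Δ) : ℕ :=
  {e | χ e = some c}.ncard

/-- `α, β` are two least common colors. They are distinct unless there is only one color. -/
def AreLeastCommon {G : SimpleGraph (Fin n)} (χ : PartialColoring G Δ) (α β : Fin Δ) : Prop :=
  (2 ≤ Δ → α ≠ β) ∧
  ∀ γ, γ ≠ α → γ ≠ β → colorCount χ α ≤ colorCount χ γ ∧ colorCount χ β ≤ colorCount χ γ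

/-- `χ'` arises from `χ` by changing colors, without creating new uncolored edges. -/
def KeepsColored {G : SimpleGraph (Fin n)} (χ χ' : PartialColoring G Δ) : Prop :=
  ∀ e, χ e ≠ none → χ' e ≠ none

/-- Word encoding a color or the absence of one. -/
def colorCode : Option (Fin Δ) → ℕ
  | none => 0
  | some c => (c : ℕ) + 1

/-! Memory banks used by the representation of the input. -/

/-- Parameters: `n`, `m`, `Δ`, `|U|`, and the two least common colors. -/
abbrev bPar : ℕ := 0
/-- First endpoint of each edge. -/
abbrev bFst : ℕ := 1
/-- Second endpoint of each edge. -/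
abbrev bSnd : ℕ := 2
/-- Color of each edge. -/
abbrev bCol : ℕ := 3
/-- For each vertex and color, the incident edge with that color. -/
abbrev bInc : ℕ := 4
/-- Sizes of the sets of missing colors. -/
abbrev bMissCnt : ℕ := 5
/-- Elements of the sets of missing colors. -/
abbrev bMissList : ℕ := 6
/-- Positions of the missing colors in their lists. -/
abbrev bMissPos : ℕ := 7
/-- The edges of `U`. -/
abbrev bU : ℕ := 8
/-- Degrees of the vertices. -/
abbrev bDeg : ℕ := 9

/-- The memory `σ` holds the graph, with edges numbered by `ν`, and the standard data structure for
the partial coloring `χ`: the color of every edge, a map that sends `(u, c)` to the edge at `u` with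
color `c` (`0` if there is none, else its number plus one), and, for every vertex `u`, the set of
those missing colors that are among the first `deg u` colors. This set is stored as a list without
repetitions together with the position of each of its elements, so that membership, insertion,
deletion and finding an element take constant time. -/
structure Represents (G : SimpleGraph (Fin n)) [DecidableRel G.Adj] (ν : Fin m ≃ G.edgeSet)
    (χ : PartialColoring G Δ) (σ : WordRAM.Mem) : Prop where
  num_vertices : σ bPar 0 = n
  num_edges : σ bPar 1 = m
  num_colors : σ bPar 2 = Δ
  endpoints : ∀ i : Fin m, ∃ x y : Fin n,
    (ν i : Sym2 (Fin n)) = s(x, y) ∧ σ bFst i = x ∧ σ bSnd i = y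
  degree : ∀ u : Fin n, σ bDeg u = G.degree u
  color : ∀ i : Fin m, σ bCol i = colorCode (χ (ν i))
  inc_some : ∀ (u : Fin n) (c : Fin Δ) (i : Fin m),
    u ∈ (ν i : Sym2 (Fin n)) → χ (ν i) = some c → σ bInc (u * Δ + c) = i + 1
  inc_none : ∀ (u : Fin n) (c : Fin Δ), c ∈ miss χ u → σ bInc (u * Δ + c) = 0
  miss_sound : ∀ (u : Fin n) (j : ℕ), j < σ bMissCnt u →
    ∃ c : Fin Δ, c ∈ miss χ u ∧ (c : ℕ) < G.degree u ∧
      σ bMissList (u * Δ + j) = c ∧ σ bMissPos (u * Δ + c) = j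
  miss_complete : ∀ (u : Fin n) (c : Fin Δ), c ∈ miss χ u → (c : ℕ) < G.degree u →
    ∃ j < σ bMissCnt u, σ bMissList (u * Δ + j) = c

/-- Initial memory: the representation of `G` and `χ`, the set `U` as an array of edge numbers,
the answer `α, β` to the query for the two least common colors, and zeros in all banks that are not
used for the input. -/
structure IsInput (G : SimpleGraph (Fin n)) [DecidableRel G.Adj] (ν : Fin m ≃ G.edgeSet)
    (χ : PartialColoring G Δ) (U : Finset G.edgeSet) (α β : Fin Δ) (σ : WordRAM.Mem) : Prop where
  rep : Represents G ν χ σ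
  card_U : σ bPar 3 = U.card
  first_color : σ bPar 4 = α
  second_color : σ bPar 5 = β
  list_U : ∃ f : Fin U.card → Fin m, Function.Injective f ∧
    (∀ j, ν (f j) ∈ U) ∧ ∀ j : Fin U.card, σ bU j = f j
  scratch : ∀ b, bDeg < b → ∀ i, σ b i = 0

end EdgeColor

/-! The colors α and β are carried by at most 2m/Δ edges each, hence by at most 4m/Δ vertices each,
so alternating walks that use one of them are short on average. The algorithm exploits this in two
loops, with every walk cut off at length 2q, where q is about m / max(λ, Δ).

The first loop collects an array of about λ/(24Δ) edges of U whose endpoints, as long as the edge is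
uncolored, miss α or β. It samples an edge uv of U and takes missing colors c_u and c_v of its
endpoints. If they agree, the edge is colored at once. Otherwise targets t_u and t_v, which are α
and β in some order, are chosen so that {t_u, c_u} and {t_v, c_v} are disjoint. Exchanging colors on
the maximal t_u/c_u walk from u and on the maximal t_v/c_v walk from v makes u miss t_u and v miss
t_v (`two_flips`). The round is abandoned if a walk is cut off, or if it ends in an endpoint of an
array edge that would thereby lose its missing target color.

The second loop samples an edge of the array. If it is uncolored, α and β are exchanged along the
walk from one endpoint and the edge is colored (`flip_color`). Bipartiteness enters here: by parity
the walk cannot spoil the missing color at the other endpoint. An exchange of α with β preserves the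
property of missing α or β at every vertex. Half of the array gets colored, that is, at least
λ/(48Δ) edges of U.

Every round succeeds with probability at least 1/4 (`card_goodSample`, `card_goodEdge`). The reason
is that walks with the same two colors, each starting where its second color is missing, never meet
at positions of equal parity unless they coincide (`meet`). So long walks use up many vertices that
have α or β (`card_longWalk_le`), and a walk ending badly is determined by its end and its second
color (`card_blocked_le`). A round adds at most 4 vertices to those having a given color, so the
initial 4m/Δ stays of the same order.

If r successes are needed, N rounds fail to provide them with probability at most 2^r (7/8)^N
(`failProb_runLoop`). Thus O(λ/Δ + a log n) rounds of O(m / max(λ, Δ)) steps suffice, and the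
product is O(a log n · m/Δ) up to constants and lower terms. The remaining work is a program logic
for the machine, the maintenance of the data structure, and the translation between graphs and the
number-coded `Net`. -/

namespace WordRAM

/-! ### Deterministic executions with a step count. -/

/-- With at least `k` steps available the program halts in memory `σ'` after exactly `k` steps. -/
def Runs (w : ℕ) (P : Prog) (σ : Mem) (k : ℕ) (σ' : Mem) : Prop :=
  ∀ B, k ≤ B → run w P σ B = PMF.pure (some (σ', B - k))

/-- The program deterministically halts within `k` steps in a memory satisfying `Q`. -/
def Ex (w : ℕ) (P : Prog) (σ : Mem) (k : ℕ) (Q : Mem → Prop) : Prop :=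
  ∃ σ' k', k' ≤ k ∧ Runs w P σ k' σ' ∧ Q σ'

theorem Ex.mono {w : ℕ} {P : Prog} {σ : Mem} {k k' : ℕ} {Q Q' : Mem → Prop}
    (h : Ex w P σ k Q) (hk : k ≤ k') (hQ : ∀ σ', Q σ' → Q' σ') : Ex w P σ k' Q' := by
  obtain ⟨σ', j, hj, hr, hq⟩ := h
  exact ⟨σ', j, hj.trans hk, hr, hQ _ hq⟩

theorem Runs.seq {w : ℕ} {c d : Prog} {σ σ₁ σ₂ : Mem} {k₁ k₂ : ℕ}
    (h₁ : Runs w c σ k₁ σ₁) (h₂ : Runs w d σ₁ k₂ σ₂) : Runs w (.seq c d) σ (k₁ + k₂) σ₂ := by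
  intro B hB
  simp only [run, andThen, h₁ B (by omega), PMF.pure_bind]
  rw [h₂ (B - k₁) (by omega), Nat.sub_sub]

theorem Ex.seq {w : ℕ} {c d : Prog} {σ : Mem} {k₁ k₂ : ℕ} {Q : Mem → Prop}
    (h : Ex w c σ k₁ fun σ' => Ex w d σ' k₂ Q) : Ex w (.seq c d) σ (k₁ + k₂) Q := by
  obtain ⟨σ₁, j₁, hj₁, hr₁, σ₂, j₂, hj₂, hr₂, hq⟩ := h
  exact ⟨σ₂, j₁ + j₂, by omega, hr₁.seq hr₂, hq⟩

theorem Ex.cond {w : ℕ} {t : WTerm} {c d : Prog} {σ : Mem} {k : ℕ} {Q : Mem → Prop}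
    (h₁ : t.val w σ ≠ 0 → Ex w c σ k Q) (h₀ : t.val w σ = 0 → Ex w d σ k Q) :
    Ex w (.cond t c d) σ (1 + t.size + k) Q := by
  by_cases ht : t.val w σ = 0
  · obtain ⟨σ', j, hj, hr, hq⟩ := h₀ ht
    refine ⟨σ', 1 + t.size + j, by omega, fun B hB => ?_, hq⟩
    simp only [run, spend, if_pos (show 1 + t.size ≤ B by omega), if_pos ht]
    rw [hr _ (by omega), Nat.sub_sub]
  · obtain ⟨σ', j, hj, hr, hq⟩ := h₁ ht
    refine ⟨σ', 1 + t.size + j, by omega, fun B hB => ?_, hq⟩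
    simp only [run, spend, if_pos (show 1 + t.size ≤ B by omega), if_neg ht]
    rw [hr _ (by omega), Nat.sub_sub]

theorem WTerm.size_pos (t : WTerm) : 0 < t.size := by
  cases t <;> simp [WTerm.size]

/-- Loops without random choices, with a bound on the number of remaining rounds. -/
theorem Ex.loop {w : ℕ} {t : WTerm} {c : Prog} {kb : ℕ} (I : ℕ → Mem → Prop)
    (h : ∀ r σ, I r σ → t.val w σ ≠ 0 → ∃ r' < r, Ex w c σ kb (I r')) {r : ℕ} {σ : Mem}
    (hI : I r σ) :
    Ex w (.loop t c) σ (r * (t.size + kb) + t.size) fun σ' =>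
      (∃ r', I r' σ') ∧ t.val w σ' = 0 := by
  -- The fuel `f` is generalized to any value above the budget. A round costs at least one step, so
  -- `B < f` survives every round and the fuel never runs out first.
  suffices H : ∀ r σ, I r σ → ∃ σ' k, k ≤ r * (t.size + kb) + t.size ∧
      (∀ f B, k ≤ B → B < f →
        runLoop w t (run w c) f σ B = PMF.pure (some (σ', B - k))) ∧
      (∃ r', I r' σ') ∧ t.val w σ' = 0 by
    obtain ⟨σ', k, hk, hr, hq⟩ := H r σ hI
    exact ⟨σ', k, hk, fun B hB => hr _ _ hB (Nat.lt_succ_self B), hq⟩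
  clear hI σ r
  intro r
  induction r using Nat.strong_induction_on with
  | _ r ih =>
    intro σ hI
    by_cases ht : t.val w σ = 0
    · refine ⟨σ, t.size, by omega, fun f B hB hf => ?_, ⟨r, hI⟩, ht⟩
      obtain ⟨f, rfl⟩ : ∃ f', f = f' + 1 := ⟨f - 1, by omega⟩
      simp [runLoop, spend, hB, ht]
    · obtain ⟨r', hr', σ₁, k₁, hk₁, hrun, hI₁⟩ := h r σ hI ht
      obtain ⟨σ', k, hk, hl, hq⟩ := ih r' hr' σ₁ hI₁
      refine ⟨σ', t.size + k₁ + k, ?_, fun f B hB hf => ?_, hq⟩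
      · have : (r' + 1) * (t.size + kb) ≤ r * (t.size + kb) := Nat.mul_le_mul_right _ hr'
        rw [add_mul] at this
        omega
      · obtain ⟨f, rfl⟩ : ∃ f', f = f' + 1 := ⟨f - 1, by omega⟩
        have := t.size_pos
        simp only [runLoop, spend, if_pos (show t.size ≤ B by omega), if_neg ht, andThen]
        rw [hrun _ (by omega), PMF.pure_bind]
        simp only
        rw [hl _ _ (by omega) (by omega)]
        congr 3
        omega

/-- Effect of a program without loops and random choices. -/
def Prog.exec (w : ℕ) : Prog → Mem → Mem
  | .skip, σ => σ
  | .store b a t, σ => σ.set b (a.val w σ) (t.val w σ)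
  | .rand _ _ _, σ => σ
  | .seq c d, σ => d.exec w (c.exec w σ)
  | .cond t c d, σ => if t.val w σ = 0 then d.exec w σ else c.exec w σ
  | .loop _ _, σ => σ

/-- Programs without loops and random choices. -/
def Prog.straight : Prog → Bool
  | .skip => true
  | .store _ _ _ => true
  | .rand _ _ _ => false
  | .seq c d => c.straight && d.straight
  | .cond _ c d => c.straight && d.straight
  | .loop _ _ => false

/-- Bound on the running time of a program without loops. -/
def Prog.cost : Prog → ℕ
  | .skip => 1
  | .store _ a t => 1 + a.size + t.size
  | .rand _ a t => 1 + a.size + t.size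
  | .seq c d => c.cost + d.cost
  | .cond t c d => 1 + t.size + (c.cost + d.cost)
  | .loop t _ => t.size

theorem Ex.of_straight {w : ℕ} {Q : Mem → Prop} :
    ∀ (P : Prog) (σ : Mem), P.straight = true → Q (P.exec w σ) → Ex w P σ P.cost Q
  | .skip, σ, _, hQ => ⟨σ, 1, le_rfl, fun B hB => by simp [run, spend, hB], hQ⟩
  | .store b a t, σ, _, hQ => ⟨_, _, le_rfl, fun B hB => by
      simp only [run, spend]; exact if_pos hB, hQ⟩
  | .rand _ _ _, _, h, _ => by simp [Prog.straight] at h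
  | .loop _ _, _, h, _ => by simp [Prog.straight] at h
  | .seq c d, σ, h, hQ => by
      simp only [Prog.straight, Bool.and_eq_true] at h
      exact Ex.seq (Ex.of_straight c σ h.1 (Ex.of_straight d _ h.2 hQ))
  | .cond t c d, σ, h, hQ => by
      simp only [Prog.straight, Bool.and_eq_true] at h
      simp only [Prog.exec] at hQ
      refine Ex.cond (fun ht => ?_) (fun ht => ?_)
      · rw [if_neg ht] at hQ
        exact (Ex.of_straight c σ h.1 hQ).mono (by omega) fun _ => id
      · rw [if_pos ht] at hQ
        exact (Ex.of_straight d σ h.2 hQ).mono (by omega) fun _ => id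

theorem Mem.set_bank_ne (σ : Mem) {b b' : ℕ} (i x : ℕ) (h : b' ≠ b) : (σ.set b i x) b' = σ b' := by
  funext j
  simp [Mem.set, h]

theorem Mem.set_bank_eq (σ : Mem) (b i x : ℕ) :
    (σ.set b i x) b = Function.update (σ b) i x := by
  funext j
  simp [Mem.set, Function.update_apply]

/-! ### Failure probabilities -/

open scoped ENNReal

/-- Probability not to halt with `b` steps left in a memory satisfying `Q`. -/
noncomputable def failProb (p : PMF Outcome) (b : ℕ) (Q : Mem → Prop) : ℝ≥0∞ :=
  p.toOuterMeasure {r | ¬ ∃ σ' B, r = some (σ', B) ∧ b ≤ B ∧ Q σ'}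

theorem PMF.toOuterMeasure_le_one {α : Type*} (p : PMF α) (s : Set α) : p.toOuterMeasure s ≤ 1 := by
  rw [PMF.toOuterMeasure_apply, ← p.tsum_coe]
  exact ENNReal.tsum_le_tsum fun a => Set.indicator_le_self _ _ a

theorem failProb_le_one (p : PMF Outcome) (b : ℕ) (Q : Mem → Prop) : failProb p b Q ≤ 1 :=
  PMF.toOuterMeasure_le_one _ _

theorem failProb_mono {p : PMF Outcome} {b : ℕ} {Q Q' : Mem → Prop} (h : ∀ σ, Q' σ → Q σ) :
    failProb p b Q ≤ failProb p b Q' :=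
  p.toOuterMeasure.mono fun _ hr ⟨σ, B, he, hb, hQ⟩ => hr ⟨σ, B, he, hb, h σ hQ⟩

theorem failProb_pure {b B : ℕ} {Q : Mem → Prop} {σ : Mem} (hb : b ≤ B) (hQ : Q σ) :
    failProb (PMF.pure (some (σ, B))) b Q = 0 := by
  classical
  rw [failProb, PMF.toOuterMeasure_pure_apply, if_neg]
  exact fun h => h ⟨σ, B, rfl, hb, hQ⟩

theorem failProb_bind {α : Type} (p : PMF α) (f : α → PMF Outcome) (b : ℕ) (Q : Mem → Prop) :
    failProb (p.bind f) b Q = ∑' a, p a * failProb (f a) b Q :=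
  PMF.toOuterMeasure_bind_apply _ _ _

/-- A union bound over two phases. The second phase is analyzed only for outcomes of the first that
leave `b₁` steps, which is how one budget is divided among phases. -/
theorem failProb_andThen {p : PMF Outcome} {next : Mem → ℕ → PMF Outcome} {b b₁ : ℕ}
    {Q Q₁ : Mem → Prop} {ε : ℝ≥0∞}
    (h : ∀ σ B, b₁ ≤ B → Q₁ σ → failProb (next σ B) b Q ≤ ε) :
    failProb (andThen p next) b Q ≤ failProb p b₁ Q₁ + ε := by
  classical
  rw [andThen, failProb_bind]
  set bad : Set Outcome := {r | ¬ ∃ σ' B, r = some (σ', B) ∧ b₁ ≤ B ∧ Q₁ σ'}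
  calc _ ≤ ∑' r, (bad.indicator p r + p r * ε) := by
        refine ENNReal.tsum_le_tsum fun r => ?_
        by_cases hr : r ∈ bad
        · rw [Set.indicator_of_mem hr]
          exact (mul_le_of_le_one_right' (failProb_le_one _ _ _)).trans le_self_add
        · rw [Set.indicator_of_notMem hr, zero_add]
          simp only [bad, Set.mem_ofPred_eq, not_not] at hr
          obtain ⟨σ', B, rfl, hB, hQ⟩ := hr
          exact mul_le_mul_right (h σ' B hB hQ) _
    _ = _ := by
        rw [ENNReal.tsum_add, ENNReal.tsum_mul_right, p.tsum_coe, one_mul, failProb,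
          PMF.toOuterMeasure_apply]

theorem one_sub_failProb_le (w : ℕ) (P : Prog) (σ : Mem) (T : ℕ) (Q : Mem → Prop) :
    1 - failProb (run w P σ T) 0 Q ≤ haltProb w P σ T Q := by
  rw [haltProb, failProb]
  set s : Set Outcome := {r | ∃ σ' B, r = some (σ', B) ∧ Q σ'}
  have : {r : Outcome | ¬ ∃ σ' B, r = some (σ', B) ∧ 0 ≤ B ∧ Q σ'} = sᶜ := by
    ext r; simp [s]
  rw [this, tsub_le_iff_right, PMF.toOuterMeasure_apply, PMF.toOuterMeasure_apply,
    ← ENNReal.tsum_add, ← (run w P σ T).tsum_coe]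
  refine ENNReal.tsum_le_tsum fun a => ?_
  by_cases ha : a ∈ s <;> simp [ha]

theorem failProb_of_ex {w : ℕ} {P : Prog} {σ : Mem} {k B b : ℕ} {Q : Mem → Prop}
    (h : Ex w P σ k Q) (hB : k + b ≤ B) : failProb (run w P σ B) b Q = 0 := by
  obtain ⟨σ', j, hj, hr, hq⟩ := h
  rw [hr B (by omega)]
  exact failProb_pure (by omega) hq

/-- At least a quarter of the samples halve the bound, so the average is at most `3/4 * F + 1/4 * (F
/ 2)`. -/
theorem failProb_uniformBelow_bind {t : ℕ} (ht : 0 < t) (f : ℕ → PMF Outcome) (b : ℕ)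
    (Q : Mem → Prop) {F : ℝ} (hF : 0 ≤ F) {S : Finset ℕ} (hS : S ⊆ Finset.range t)
    (hcard : t ≤ 4 * S.card) (h₀ : ∀ x < t, failProb (f x) b Q ≤ ENNReal.ofReal F)
    (h₁ : ∀ x ∈ S, failProb (f x) b Q ≤ ENNReal.ofReal (F / 2)) :
    failProb ((uniformBelow t).bind f) b Q ≤ ENNReal.ofReal (7 / 8 * F) := by
  classical
  obtain ⟨t, rfl⟩ : ∃ t', t = t' + 1 := ⟨t - 1, by omega⟩
  rw [uniformBelow, PMF.bind_map, failProb_bind, tsum_fintype]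
  simp only [PMF.uniformOfFintype_apply, Fintype.card_fin, Function.comp]
  rw [← Finset.mul_sum, Fin.sum_univ_eq_sum_range (fun x => failProb (f x) b Q)]
  have hle : ∑ x ∈ Finset.range (t + 1), failProb (f x) b Q
      ≤ ENNReal.ofReal (∑ x ∈ Finset.range (t + 1), if x ∈ S then F / 2 else F) := by
    rw [ENNReal.ofReal_sum_of_nonneg (fun x _ => by split_ifs <;> linarith)]
    refine Finset.sum_le_sum fun x hx => ?_
    split_ifs with hxS
    · exact h₁ x hxS
    · exact h₀ x (Finset.mem_range.1 hx)
  have hsum : (∑ x ∈ Finset.range (t + 1), if x ∈ S then F / 2 else F)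
      = (t + 1 : ℕ) * F - S.card * (F / 2) := by
    have : ∀ x, (if x ∈ S then F / 2 else F) = F - if x ∈ S then F / 2 else 0 := by
      intro x; split_ifs <;> ring
    simp_rw [this, Finset.sum_sub_distrib]
    rw [← Finset.sum_filter, Finset.filter_mem_eq_inter, Finset.inter_eq_right.2 hS]
    simp
  refine (mul_le_mul_right hle _).trans ?_
  rw [hsum, ← ENNReal.ofReal_natCast, ← ENNReal.ofReal_inv_of_pos (by positivity),
    ← ENNReal.ofReal_mul (by positivity)]
  refine ENNReal.ofReal_le_ofReal ?_
  rw [inv_mul_le_iff₀ (by positivity)]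
  have : ((t + 1 : ℕ) : ℝ) ≤ 4 * S.card := by exact_mod_cast hcard
  nlinarith

/-- A loop whose rounds each begin with a random sample. `Inv r` says that `r` successful rounds
remain to be made; each round is successful with probability at least `1 / 4`. -/
theorem failProb_runLoop {w : ℕ} {g a t : WTerm} {b : ℕ} {body : Prog} {kb : ℕ}
    {Inv : ℕ → Mem → Prop} (hzero : ∀ σ, Inv 0 σ → g.val w σ = 0)
    (hstep : ∀ r σ, Inv (r + 1) σ → g.val w σ ≠ 0 → 0 < t.val w σ ∧
      ∃ S ⊆ Finset.range (t.val w σ), t.val w σ ≤ 4 * S.card ∧ ∀ x < t.val w σ,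
        Ex w body (σ.set b (a.val w σ) x) kb fun σ' =>
          (x ∈ S → Inv r σ') ∧ Inv (r + 1) σ') :
    ∀ (N r : ℕ) (σ : Mem) (f B b' : ℕ), Inv r σ →
      N * (g.size + (1 + a.size + t.size) + kb) + g.size + b' ≤ B → N < f →
      failProb (runLoop w g (run w (.seq (.rand b a t) body)) f σ B) b'
        (fun σ' => (∃ r, Inv r σ') ∧ g.val w σ' = 0) ≤ ENNReal.ofReal (2 ^ r * (7 / 8) ^ N) := by
  intro N
  induction N with
  | zero =>
    intro r σ f B b' _ _ _
    -- With no rounds to count on, the claimed bound `2 ^ r` is at least `1`.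
    refine (failProb_le_one _ _ _).trans ?_
    rw [ENNReal.one_le_ofReal]
    simpa using one_le_pow₀ (by norm_num : (1 : ℝ) ≤ 2)
  | succ N ih =>
    intro r σ f B b' hI hB hf
    obtain ⟨f, rfl⟩ : ∃ f', f = f' + 1 := ⟨f - 1, by omega⟩
    rw [add_mul, one_mul] at hB
    simp only [runLoop, spend, if_pos (show g.size ≤ B by omega)]
    by_cases hg : g.val w σ = 0
    · rw [if_pos hg, failProb_pure (by omega) ⟨⟨r, hI⟩, hg⟩]
      exact zero_le
    · rw [if_neg hg]
      obtain ⟨r, rfl⟩ : ∃ r', r = r' + 1 := by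
        rcases r with _ | r
        · exact absurd (hzero σ hI) hg
        · exact ⟨r, rfl⟩
      obtain ⟨ht, S, hS, hcard, hx⟩ := hstep r σ hI hg
      have hrun : andThen (run w (.seq (.rand b a t) body) σ (B - g.size))
          (runLoop w g (run w (.seq (.rand b a t) body)) f)
          = (uniformBelow (t.val w σ)).bind fun x =>
            andThen (run w body (σ.set b (a.val w σ) x) (B - g.size - (1 + a.size + t.size)))
              (runLoop w g (run w (.seq (.rand b a t) body)) f) := by
        simp only [run, spend, if_pos (show 1 + a.size + t.size ≤ B - g.size by omega), andThen,
          PMF.bind_map, PMF.bind_bind]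
        rfl
      rw [hrun]
      -- `F` is the bound after a round without success. A success lowers `r` by one, which is
      -- exactly the factor `1 / 2` needed on `S`.
      refine (failProb_uniformBelow_bind ht _ _ _
        (F := 2 ^ (r + 1) * (7 / 8) ^ N) (by positivity) hS hcard ?_ ?_).trans
          (ENNReal.ofReal_le_ofReal (by ring_nf; rfl))
      · intro x hxt
        obtain ⟨σ', j, hj, hr, hq⟩ := hx x hxt
        rw [andThen, hr _ (by omega), PMF.pure_bind]
        exact ih _ _ _ _ _ hq.2 (by omega) (by omega)
      · intro x hxS
        obtain ⟨σ', j, hj, hr, hq⟩ := hx x (Finset.mem_range.1 (hS hxS))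
        rw [andThen, hr _ (by omega), PMF.pure_bind]
        refine (ih _ _ _ _ _ (hq.1 hxS) (by omega) (by omega)).trans
          (ENNReal.ofReal_le_ofReal (le_of_eq (by ring)))

/-- The fuel `B + 1` supplied by `run` exceeds `N` because the budget pays at least one step per
round. -/
theorem failProb_run_loop {w : ℕ} {g a t : WTerm} {b : ℕ} {body : Prog} {kb : ℕ}
    {Inv : ℕ → Mem → Prop} (hzero : ∀ σ, Inv 0 σ → g.val w σ = 0)
    (hstep : ∀ r σ, Inv (r + 1) σ → g.val w σ ≠ 0 → 0 < t.val w σ ∧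
      ∃ S ⊆ Finset.range (t.val w σ), t.val w σ ≤ 4 * S.card ∧ ∀ x < t.val w σ,
        Ex w body (σ.set b (a.val w σ) x) kb fun σ' =>
          (x ∈ S → Inv r σ') ∧ Inv (r + 1) σ')
    {N r B b' : ℕ} {σ : Mem} (hI : Inv r σ)
    (hB : N * (g.size + (1 + a.size + t.size) + kb) + g.size + b' ≤ B) :
    failProb (run w (.loop g (.seq (.rand b a t) body)) σ B) b'
        (fun σ' => (∃ r, Inv r σ') ∧ g.val w σ' = 0) ≤ ENNReal.ofReal (2 ^ r * (7 / 8) ^ N) := by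
  refine failProb_runLoop hzero hstep N r σ (B + 1) B b' hI hB ?_
  have := g.size_pos
  have : N * 1 ≤ N * (g.size + (1 + a.size + t.size) + kb) := Nat.mul_le_mul_left _ (by omega)
  omega

end WordRAM

/-! ### Alternating walks and exchanges of two colors along them. -/

namespace EdgeColor

/-- A bipartite multigraph on the vertices below `n` with edges numbered below `m` and degrees at
most `Δ`, a matching `U` of `lam` edges, and two colors `al`, `be`. -/
structure Net where
  n : ℕ
  m : ℕ
  Δ : ℕ
  lam : ℕ
  fst : ℕ → ℕ
  snd : ℕ → ℕ
  deg : ℕ → ℕ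
  U : ℕ → ℕ
  al : ℕ
  be : ℕ
  side : ℕ → Bool
  fst_lt : ∀ i < m, fst i < n
  snd_lt : ∀ i < m, snd i < n
  side_ne : ∀ i < m, side (fst i) ≠ side (snd i)
  deg_eq : ∀ u < n, deg u = ((Finset.range m).filter fun i => fst i = u ∨ snd i = u).card
  deg_le : ∀ u < n, deg u ≤ Δ
  al_lt : al < Δ
  be_lt : be < Δ
  al_ne_be : 2 ≤ Δ → al ≠ be
  U_lt : ∀ a < lam, U a < m
  U_matching : ∀ a < lam, ∀ b < lam, ∀ x, (fst (U a) = x ∨ snd (U a) = x) →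
    (fst (U b) = x ∨ snd (U b) = x) → a = b
  lam_le : lam ≤ m
  Δ_le : Δ ≤ m

/-- The color at position `j` of a walk with alternating colors `t, s, t, …`. -/
def alt (t s j : ℕ) : ℕ := if j % 2 = 0 then t else s

theorem alt_zero (t s : ℕ) : alt t s 0 = t := rfl

theorem alt_add_two (t s j : ℕ) : alt t s (j + 2) = alt t s j := by simp [alt]

theorem alt_succ (t s j : ℕ) : alt t s (j + 1) = alt s t j := by
  unfold alt
  rcases Nat.mod_two_eq_zero_or_one j with h | h
  · rw [if_neg (by omega), if_pos h]
  · rw [if_pos (by omega), if_neg (by omega)]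

theorem alt_add_even (t s j : ℕ) {d : ℕ} (hd : d % 2 = 0) : alt t s (j + d) = alt t s j := by
  simp only [alt, show (j + d) % 2 = j % 2 by omega]

theorem eq_alt_or (t s j c : ℕ) (h : c = t + 1 ∨ c = s + 1) :
    c = alt t s j + 1 ∨ c = alt t s (j + 1) + 1 := by
  rw [alt_succ]
  unfold alt
  split_ifs <;> tauto

namespace Net

variable (I : Net)

/-- The vertex `x` is an endpoint of the edge `i`. -/
def Inc (i x : ℕ) : Prop := I.fst i = x ∨ I.snd i = x

/-- Distinct edges with a common endpoint do not have the same color; color `0` stands for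
uncolored edges. -/
def Proper (col : ℕ → ℕ) : Prop :=
  ∀ i < I.m, ∀ j < I.m, ∀ x, I.Inc i x → I.Inc j x → col i = col j → col i ≠ 0 → i = j

/-- The color `c` is missing at `x`. -/
def Misses (col : ℕ → ℕ) (x c : ℕ) : Prop := ∀ i < I.m, I.Inc i x → col i ≠ c + 1

/-- The endpoints of `i` are `x` and `y`. -/
def Joins (i x y : ℕ) : Prop := (I.fst i = x ∧ I.snd i = y) ∨ (I.fst i = y ∧ I.snd i = x)

/-- A walk of length `k` with vertices `xs` and edges `es` of alternating colors `t, s, t, …`. -/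
structure IsWalk (col : ℕ → ℕ) (t s : ℕ) (xs es : ℕ → ℕ) (k : ℕ) : Prop where
  edge_lt : ∀ j < k, es j < I.m
  color : ∀ j < k, col (es j) = alt t s j + 1
  joins : ∀ j < k, I.Joins (es j) (xs j) (xs (j + 1))

/-- Vertices with an edge of color `c`. -/
noncomputable def haves (col : ℕ → ℕ) (c : ℕ) : Finset ℕ := by
  classical exact (Finset.range I.n).filter fun x => ¬ I.Misses col x c

variable {I} {col : ℕ → ℕ} {t s k : ℕ} {xs es : ℕ → ℕ}

theorem mem_haves {c x : ℕ} : x ∈ I.haves col c ↔ x < I.n ∧ ¬ I.Misses col x c := by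
  simp [haves]

theorem Inc.lt {i x : ℕ} (hi : i < I.m) (h : I.Inc i x) : x < I.n := by
  rcases h with rfl | rfl
  · exact I.fst_lt i hi
  · exact I.snd_lt i hi

theorem Joins.left {i x y : ℕ} (h : I.Joins i x y) : I.Inc i x := by
  rcases h with h | h
  · exact Or.inl h.1
  · exact Or.inr h.2

theorem Joins.right {i x y : ℕ} (h : I.Joins i x y) : I.Inc i y := by
  rcases h with h | h
  · exact Or.inr h.2
  · exact Or.inl h.1

theorem Joins.eq_or {i x y z : ℕ} (h : I.Joins i x y) (hz : I.Inc i z) : z = x ∨ z = y := by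
  unfold Joins Inc at *
  omega

theorem Joins.side_ne {i x y : ℕ} (hi : i < I.m) (h : I.Joins i x y) : I.side x ≠ I.side y := by
  have := I.side_ne i hi
  rcases h with ⟨rfl, rfl⟩ | ⟨rfl, rfl⟩
  · exact this
  · exact this.symm

theorem Joins.ne {i x y : ℕ} (hi : i < I.m) (h : I.Joins i x y) : x ≠ y :=
  fun e => h.side_ne hi (e ▸ rfl)

theorem Joins.unique {i x y x' : ℕ} (hi : i < I.m) (h : I.Joins i x y) (h' : I.Joins i x' y) :
    x = x' := by
  have := h.ne hi
  unfold Joins at *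
  omega

theorem IsWalk.vertex (h : I.IsWalk col t s xs es k) {j x : ℕ} (hj : j < k)
    (hx : I.Inc (es j) x) : ∃ p, (p = j ∨ p = j + 1) ∧ x = xs p := by
  rcases (h.joins j hj).eq_or hx with rfl | rfl
  · exact ⟨j, Or.inl rfl, rfl⟩
  · exact ⟨j + 1, Or.inr rfl, rfl⟩

/-- Exchange of the colors `t` and `s`. -/
def swapColor (t s v : ℕ) : ℕ := if v = t + 1 then s + 1 else if v = s + 1 then t + 1 else v

theorem swapColor_injective (t s : ℕ) : Function.Injective (swapColor t s) := by
  intro a b h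
  unfold swapColor at h
  split_ifs at h <;> omega

theorem swapColor_eq_zero {t s v : ℕ} : swapColor t s v = 0 ↔ v = 0 := by
  unfold swapColor
  constructor <;> intro h <;> split_ifs at * <;> omega

theorem swapColor_alt (t s j : ℕ) : swapColor t s (alt t s j + 1) = alt t s (j + 1) + 1 := by
  rw [alt_succ]
  unfold swapColor
  rcases Nat.mod_two_eq_zero_or_one j with h | h
  · simp [alt, h]
  · simp only [alt, h, one_ne_zero, if_false]
    split_ifs <;> omega

/-- Exchange of the colors `t` and `s` on the first `k` of the edges `es`. -/
noncomputable def flip (col : ℕ → ℕ) (t s : ℕ) (es : ℕ → ℕ) (k : ℕ) : ℕ → ℕ := by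
  classical exact fun i => if ∃ j < k, es j = i then swapColor t s (col i) else col i

theorem flip_of_mem {i : ℕ} (h : ∃ j < k, es j = i) :
    flip col t s es k i = swapColor t s (col i) := by
  simp [flip, h]

theorem flip_of_not_mem {i : ℕ} (h : ¬ ∃ j < k, es j = i) : flip col t s es k i = col i := by
  simp only [flip, if_neg h]

theorem flip_eq_zero {i : ℕ} : flip col t s es k i = 0 ↔ col i = 0 := by
  unfold flip
  split_ifs
  · exact swapColor_eq_zero
  · rfl

theorem flip_eq_iff {i c : ℕ} (ht : c ≠ t) (hs : c ≠ s) :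
    flip col t s es k i = c + 1 ↔ col i = c + 1 := by
  unfold flip swapColor
  split_ifs <;> omega

theorem misses_flip_iff {x c : ℕ} (ht : c ≠ t) (hs : c ≠ s) :
    I.Misses (flip col t s es k) x c ↔ I.Misses col x c := by
  simp only [Misses, ne_eq, flip_eq_iff ht hs]

theorem IsWalk.flip_other {t' s' k' : ℕ} {xs' es' : ℕ → ℕ} (h : I.IsWalk col t' s' xs' es' k')
    (h₁ : t' ≠ t) (h₂ : t' ≠ s) (h₃ : s' ≠ t) (h₄ : s' ≠ s) :
    I.IsWalk (flip col t s es k) t' s' xs' es' k' := by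
  refine ⟨h.edge_lt, fun j hj => ?_, h.joins⟩
  rw [flip_eq_iff]
  · exact h.color j hj
  · unfold alt; split_ifs <;> assumption
  · unfold alt; split_ifs <;> assumption

theorem IsWalk.color_eq_or (h : I.IsWalk col t s xs es k) {j : ℕ} (hj : j < k) :
    col (es j) = t + 1 ∨ col (es j) = s + 1 := by
  rw [h.color j hj]
  unfold alt
  split_ifs <;> tauto

/-- A maximal walk contains all edges of its two colors at each of its vertices. -/
theorem IsWalk.closed (h : I.IsWalk col t s xs es k) (hcol : I.Proper col)
    (h₀ : I.Misses col (xs 0) s) (hk : I.Misses col (xs k) (alt t s k)) {i j x : ℕ} (hj : j < k)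
    (hjx : I.Inc (es j) x) (hi : i < I.m) (hix : I.Inc i x)
    (hc : col i = t + 1 ∨ col i = s + 1) : ∃ j' < k, es j' = i := by
  obtain ⟨p, hp, rfl⟩ := h.vertex hj hjx
  -- An inner position `p` is left by a walk edge of color `alt t s p` and entered by one of the
  -- other color, and properness identifies `i` with one of these. At the two ends the absent one is
  -- excluded by `h₀` or `hk`.
  rcases eq_alt_or t s p _ hc with hc' | hc'
  · by_cases hpk : p < k
    · exact ⟨p, hpk, hcol _ (h.edge_lt p hpk) _ hi _ (h.joins p hpk).left hix
        (by rw [h.color p hpk, hc']) (by rw [h.color p hpk]; omega)⟩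
    · obtain rfl : p = k := by omega
      exact absurd hc' (hk i hi hix)
  · rcases p with _ | p
    · exact absurd hc' (h₀ i hi hix)
    · rw [show p + 1 + 1 = p + 2 from rfl, alt_add_two] at hc'
      have hpk : p < k := by omega
      exact ⟨p, hpk, hcol _ (h.edge_lt p hpk) _ hi _ (h.joins p hpk).right hix
        (by rw [h.color p hpk, hc']) (by rw [h.color p hpk]; omega)⟩

/-- By `closed`, an edge that could clash with an exchanged edge is itself on the walk, and among
walk edges the exchange is injective on colors. -/
theorem IsWalk.flip_proper (h : I.IsWalk col t s xs es k) (hcol : I.Proper col)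
    (h₀ : I.Misses col (xs 0) s) (hk : I.Misses col (xs k) (alt t s k)) :
    I.Proper (flip col t s es k) := by
  have key : ∀ i < I.m, ∀ j < I.m, ∀ x, I.Inc i x → I.Inc j x → (∃ p < k, es p = i) →
      swapColor t s (col i) = col j → ∃ p < k, es p = j := by
    rintro i hi j hj x hix hjx ⟨p, hp, rfl⟩ he
    refine h.closed hcol h₀ hk hp hix hj hjx ?_
    rw [← he]
    rcases h.color_eq_or hp with hc | hc <;> rw [hc] <;> unfold swapColor <;> split_ifs <;> omega
  intro i hi j hj x hix hjx he hne
  by_cases h₁ : ∃ p < k, es p = i <;> by_cases h₂ : ∃ p < k, es p = j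
  · rw [flip_of_mem h₁, flip_of_mem h₂] at he
    rw [flip_of_mem h₁, ne_eq, swapColor_eq_zero] at hne
    exact hcol i hi j hj x hix hjx (swapColor_injective _ _ he) hne
  · rw [flip_of_mem h₁, flip_of_not_mem h₂] at he
    exact absurd (key i hi j hj x hix hjx h₁ he) h₂
  · rw [flip_of_not_mem h₁, flip_of_mem h₂] at he
    exact absurd (key j hj i hi x hjx hix h₂ he.symm) h₁
  · rw [flip_of_not_mem h₁, flip_of_not_mem h₂] at he
    rw [flip_of_not_mem h₁] at hne
    exact hcol i hi j hj x hix hjx he hne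

/-- Inner vertices of a walk have both colors, and so does any vertex where an exchanged edge
becomes `t` while another walk edge gives `t` up. Only the last vertex can gain `t`, and only when
the walk would continue with `t`. -/
theorem IsWalk.misses_flip_first (h : I.IsWalk col t s xs es k) {z : ℕ}
    (hz : I.Misses col z t) (hend : ¬ (z = xs k ∧ alt t s k = t)) :
    I.Misses (flip col t s es k) z t := by
  intro i hi hiz he
  by_cases hm : ∃ j < k, es j = i
  · rw [flip_of_mem hm] at he
    obtain ⟨j, hj, rfl⟩ := hm
    have hne := hz _ hi hiz
    rw [h.color j hj] at he hne
    rw [swapColor_alt] at he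
    have h₁ : alt t s (j + 1) = t := by omega
    obtain ⟨p, rfl | rfl, rfl⟩ := h.vertex hj hiz
    · rcases p with _ | p
      · exact hne rfl
      · exact hz _ (h.edge_lt p (by omega)) (h.joins p (by omega)).right
          (by rw [h.color p (by omega), ← alt_add_two, h₁])
    · by_cases hk : j + 1 < k
      · exact hz _ (h.edge_lt _ hk) (h.joins _ hk).left (by rw [h.color _ hk, h₁])
      · obtain rfl : j + 1 = k := by omega
        exact hend ⟨rfl, h₁⟩
  · rw [flip_of_not_mem hm] at he
    exact hz i hi hiz he

/-- At an inner vertex the exchange only permutes the two walk edges. Hence at most the two ends can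
gain a color, which controls the growth of `haves`. -/
theorem IsWalk.misses_flip_of_ne_ends (h : I.IsWalk col t s xs es k) {z c : ℕ}
    (hz : I.Misses col z c) (h₀ : z ≠ xs 0) (hk : z ≠ xs k) :
    I.Misses (flip col t s es k) z c := by
  intro i hi hiz he
  by_cases hm : ∃ j < k, es j = i
  · rw [flip_of_mem hm] at he
    obtain ⟨j, hj, rfl⟩ := hm
    have hne := hz _ hi hiz
    rw [h.color j hj] at he hne
    rw [swapColor_alt] at he
    have h₁ : alt t s (j + 1) = c := by omega
    obtain ⟨p, rfl | rfl, rfl⟩ := h.vertex hj hiz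
    · rcases p with _ | p
      · exact h₀ rfl
      · exact hz _ (h.edge_lt p (by omega)) (h.joins p (by omega)).right
          (by rw [h.color p (by omega), ← alt_add_two, h₁])
    · by_cases hk' : j + 1 < k
      · exact hz _ (h.edge_lt _ hk') (h.joins _ hk').left (by rw [h.color _ hk', h₁])
      · obtain rfl : j + 1 = k := by omega
        exact hk rfl
  · rw [flip_of_not_mem hm] at he
    exact hz i hi hiz he

theorem IsWalk.misses_flip_start (h : I.IsWalk col t s xs es k) (hcol : I.Proper col)
    (h₀ : I.Misses col (xs 0) s) (hk : I.Misses col (xs k) (alt t s k)) :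
    I.Misses (flip col t s es k) (xs 0) t := by
  intro i hi hiz he
  by_cases hm : ∃ j < k, es j = i
  · rw [flip_of_mem hm] at he
    have := h₀ i hi hiz
    unfold swapColor at he
    split_ifs at he <;> omega
  · rw [flip_of_not_mem hm] at he
    rcases Nat.eq_zero_or_pos k with rfl | hk0
    · exact hk i hi hiz he
    · exact hm (h.closed hcol h₀ hk hk0 (h.joins 0 hk0).left hi hiz (Or.inl he))

/-- A vertex on a maximal walk has all its edges of the two colors exchanged, so its missing colors
are exchanged as well; off the walk nothing changes. -/
theorem IsWalk.misses_flip_or (h : I.IsWalk col t s xs es k) (hcol : I.Proper col)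
    (h₀ : I.Misses col (xs 0) s) (hk : I.Misses col (xs k) (alt t s k)) {z : ℕ}
    (hz : I.Misses col z t ∨ I.Misses col z s) :
    I.Misses (flip col t s es k) z t ∨ I.Misses (flip col t s es k) z s := by
  by_cases hm : ∃ j < k, I.Inc (es j) z
  · obtain ⟨j, hj, hjz⟩ := hm
    have key : ∀ i < I.m, I.Inc i z → flip col t s es k i = swapColor t s (col i) := by
      intro i hi hiz
      by_cases hc : col i = t + 1 ∨ col i = s + 1
      · exact flip_of_mem (h.closed hcol h₀ hk hj hjz hi hiz hc)
      · have : swapColor t s (col i) = col i := by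
          unfold swapColor; split_ifs <;> omega
        rw [this]
        unfold flip
        split_ifs
        · exact this
        · rfl
    rcases hz with hz | hz
    · refine Or.inr fun i hi hiz he => hz i hi hiz ?_
      rw [key i hi hiz] at he
      unfold swapColor at he
      split_ifs at he <;> omega
    · refine Or.inl fun i hi hiz he => hz i hi hiz ?_
      rw [key i hi hiz] at he
      unfold swapColor at he
      split_ifs at he <;> omega
  · have key : ∀ i, I.Inc i z → flip col t s es k i = col i := by
      intro i hiz
      refine flip_of_not_mem ?_
      rintro ⟨j, hj, rfl⟩
      exact hm ⟨j, hj, hiz⟩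
    refine hz.imp (fun hz i hi hiz => ?_) (fun hz i hi hiz => ?_) <;>
      (rw [key i hiz]; exact hz i hi hiz)

theorem IsWalk.side_eq_iff (h : I.IsWalk col t s xs es k) {j : ℕ} (hj : j ≤ k) :
    I.side (xs j) = I.side (xs 0) ↔ j % 2 = 0 := by
  induction j with
  | zero => simp
  | succ j ih =>
    have h₁ := (h.joins j (by omega)).side_ne (h.edge_lt j (by omega))
    have h₂ := ih (by omega)
    rcases Nat.mod_two_eq_zero_or_one j with hj2 | hj2
    · have e := h₂.2 hj2
      rw [e] at h₁
      simp [h₁.symm, show (j + 1) % 2 ≠ 0 by omega]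
    · have e : I.side (xs j) ≠ I.side (xs 0) := fun e => by have := h₂.1 e; omega
      have : I.side (xs (j + 1)) = I.side (xs 0) := by
        revert h₁ e
        generalize I.side (xs j) = a
        generalize I.side (xs (j + 1)) = b
        generalize I.side (xs 0) = c
        revert a b c
        decide
      simp [this, show (j + 1) % 2 = 0 by omega]

theorem IsWalk.length_eq_zero (h : I.IsWalk col t s xs es k) (h₀ : I.Misses col (xs 0) t) :
    k = 0 := by
  by_contra hk
  exact h₀ _ (h.edge_lt 0 (by omega)) (h.joins 0 (by omega)).left (h.color 0 (by omega))

/-- An odd length would force `s = t`, but then the first edge would have a color missing at the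
start. -/
theorem IsWalk.even_length (h : I.IsWalk col t s xs es k) (h₀ : I.Misses col (xs 0) s)
    (hk : alt t s k = t) : k % 2 = 0 := by
  by_contra hodd
  have : s = t := by simpa [alt, hodd] using hk
  subst this
  have := h.length_eq_zero h₀
  omega

/-- The only use of bipartiteness for walks: a walk that can take `t` away from the missing colors
of its last vertex has even length, so it ends on the side where it started. -/
theorem IsWalk.misses_flip_other_side (h : I.IsWalk col t s xs es k)
    (h₀ : I.Misses col (xs 0) s) {z : ℕ} (hz : I.Misses col z t)
    (hside : I.side z ≠ I.side (xs 0)) : I.Misses (flip col t s es k) z t := by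
  refine h.misses_flip_first hz ?_
  rintro ⟨rfl, hk⟩
  exact hside ((h.side_eq_iff le_rfl).2 (h.even_length h₀ hk))

theorem IsWalk.haves_flip_subset (h : I.IsWalk col t s xs es k) (c : ℕ) :
    I.haves (flip col t s es k) c ⊆ insert (xs 0) (insert (xs k) (I.haves col c)) := by
  intro z hz
  rw [mem_haves] at hz
  simp only [Finset.mem_insert, mem_haves]
  by_contra hcon
  push Not at hcon
  exact hz.2 (h.misses_flip_of_ne_ends (hcon.2.2 hz.1) hcon.1 hcon.2.1)

theorem IsWalk.card_haves_flip (h : I.IsWalk col t s xs es k) (c : ℕ) :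
    (I.haves (flip col t s es k) c).card ≤ (I.haves col c).card + 2 := by
  refine (Finset.card_le_card (h.haves_flip_subset c)).trans ?_
  exact (Finset.card_insert_le _ _).trans (Nat.succ_le_succ (Finset.card_insert_le _ _))

/-! ### Coloring a single edge -/

theorem proper_update (hcol : I.Proper col) {e c : ℕ}
    (h₁ : I.Misses col (I.fst e) c) (h₂ : I.Misses col (I.snd e) c) :
    I.Proper (Function.update col e (c + 1)) := by
  have key : ∀ j < I.m, ∀ x, I.Inc e x → I.Inc j x → col j ≠ c + 1 := by
    intro j hj x hex hjx
    rcases hex with rfl | rfl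
    · exact h₁ j hj hjx
    · exact h₂ j hj hjx
  intro i hi j hj x hix hjx he hne
  by_cases hie : i = e <;> by_cases hje : j = e
  · rw [hie, hje]
  · subst hie
    rw [Function.update_self, Function.update_of_ne hje] at he
    exact absurd he.symm (key j hj x hix hjx)
  · subst hje
    rw [Function.update_self, Function.update_of_ne hie] at he
    exact absurd he (key i hi x hjx hix)
  · rw [Function.update_of_ne hie] at he hne
    rw [Function.update_of_ne hje] at he
    exact hcol i hi j hj x hix hjx he hne

theorem misses_update {e v z c : ℕ} (hz : I.Misses col z c) (h : I.Inc e z → v ≠ c + 1) :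
    I.Misses (Function.update col e v) z c := by
  intro i hi hiz
  by_cases hie : i = e
  · subst hie
    rw [Function.update_self]
    exact h hiz
  · rw [Function.update_of_ne hie]
    exact hz i hi hiz

theorem card_haves_update (e v c : ℕ) :
    (I.haves (Function.update col e v) c).card ≤ (I.haves col c).card + 2 := by
  have : I.haves (Function.update col e v) c ⊆
      insert (I.fst e) (insert (I.snd e) (I.haves col c)) := by
    intro z hz
    rw [mem_haves] at hz
    simp only [Finset.mem_insert, mem_haves]
    by_contra hcon
    push Not at hcon
    refine hz.2 (misses_update (hcon.2.2 hz.1) fun hinc => ?_)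
    rcases hinc with h | h
    · exact absurd h.symm hcon.1
    · exact absurd h.symm hcon.2.1
  refine (Finset.card_le_card this).trans ?_
  exact (Finset.card_insert_le _ _).trans (Nat.succ_le_succ (Finset.card_insert_le _ _))

/-! ### Counting walks -/

/-- An even shift `d` keeps the colors aligned, so properness makes the two walks enter the common
vertex through the same edge, and the previous vertices agree too. -/
theorem IsWalk.backtrack {k' : ℕ} {xs' es' : ℕ → ℕ} (hcol : I.Proper col)
    (h : I.IsWalk col t s xs es k) (h' : I.IsWalk col t s xs' es' k') {d : ℕ} (hd : d % 2 = 0) :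
    ∀ j, j ≤ k → j + d ≤ k' → xs j = xs' (j + d) → xs 0 = xs' d := by
  intro j
  induction j with
  | zero => intro _ _ he; simpa using he
  | succ j ih =>
    intro hj hjd he
    have hj' : j + d < k' := by omega
    have hjk : j < k := by omega
    have e₁ := h.joins j hjk
    have e₂ := h'.joins (j + d) hj'
    rw [show j + d + 1 = j + 1 + d by omega, ← he] at e₂
    have hee : es j = es' (j + d) := by
      refine hcol _ (h.edge_lt j hjk) _ (h'.edge_lt _ hj') _ e₁.right e₂.right ?_ ?_
      · rw [h.color j hjk, h'.color _ hj', alt_add_even _ _ _ hd]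
      · rw [h.color j hjk]; omega
    rw [← hee] at e₂
    exact ih (by omega) (by omega) (e₁.unique (h.edge_lt j hjk) e₂)

/-- Tracing both walks back from the meeting point reaches the start of the one that is earlier
there. If the other had not yet reached its start, it would enter this vertex by an edge of color
`s`, which is missing there. -/
theorem IsWalk.meet {k' : ℕ} {xs' es' : ℕ → ℕ} (hcol : I.Proper col)
    (h : I.IsWalk col t s xs es k) (h' : I.IsWalk col t s xs' es' k')
    (h₀ : I.Misses col (xs 0) s) (h₀' : I.Misses col (xs' 0) s) {j j' : ℕ} (hj : j ≤ k)
    (hj' : j' ≤ k') (hpar : j % 2 = j' % 2) (he : xs j = xs' j') :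
    j = j' ∧ xs 0 = xs' 0 := by
  wlog hle : j ≤ j' generalizing k k' xs es xs' es' j j'
  · obtain ⟨h₁, h₂⟩ := this h' h h₀' h₀ hj' hj hpar.symm he.symm (by omega)
    exact ⟨h₁.symm, h₂.symm⟩
  have hb := h.backtrack hcol h' (d := j' - j) (by omega) j hj (by omega)
    (by rw [show j + (j' - j) = j' by omega]; exact he)
  by_cases hd : j' - j = 0
  · exact ⟨by omega, by rw [hb, hd]⟩
  · exfalso
    obtain ⟨d, hd'⟩ : ∃ d, j' - j = d + 1 := ⟨j' - j - 1, by omega⟩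
    rw [hd'] at hb
    -- The shift `d + 1` is even, so the edge at the odd position `d` has color `s` and leads into
    -- `xs 0`.
    refine h₀ _ (h'.edge_lt d (by omega)) (hb ▸ (h'.joins d (by omega)).right) ?_
    rw [h'.color d (by omega), alt, if_neg (by omega)]

variable (I) in
/-- There is a walk of length `k` from `y` with colors `t, s, t, …`. -/
def LongWalk (col : ℕ → ℕ) (t s y k : ℕ) : Prop :=
  ∃ xs es : ℕ → ℕ, xs 0 = y ∧ I.IsWalk col t s xs es k

variable (I) in
/-- There is a maximal walk from `y` with colors `t, s, t, …` that ends in a vertex of `M` where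
the color `t` is missing. -/
def Blocked (col : ℕ → ℕ) (t s y : ℕ) (M : Finset ℕ) : Prop :=
  ∃ (xs es : ℕ → ℕ) (k : ℕ), xs 0 = y ∧ I.IsWalk col t s xs es k ∧ alt t s k = t ∧ xs k ∈ M

/-- A double count of the vertices at even positions: each of them is left by an edge of color `t`.
By `meet`, the vertex together with the second color determines both the start and the position. -/
theorem card_longWalk_le (hcol : I.Proper col) {Y C : Finset ℕ} {c : ℕ → ℕ} {t h : ℕ}
    (hc : ∀ y ∈ Y, c y ∈ C) (hmiss : ∀ y ∈ Y, I.Misses col y (c y))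
    (hlong : ∀ y ∈ Y, I.LongWalk col t (c y) y (2 * h)) :
    Y.card * h ≤ C.card * (I.haves col t).card := by
  choose! xs es h₀ hw using hlong
  rw [← Finset.card_product C, ← Finset.card_range h, ← Finset.card_product]
  refine Finset.card_le_card_of_injOn (fun p => (c p.1, xs p.1 (2 * p.2))) ?_ ?_
  · rintro ⟨y, i⟩ hp
    simp only [Finset.coe_product, Set.mem_prod, Finset.mem_coe, Finset.mem_range] at hp
    simp only [Finset.coe_product, Set.mem_prod, Finset.mem_coe, mem_haves]
    have hi : 2 * i < 2 * h := by omega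
    have hinc := ((hw y hp.1).joins _ hi).left
    have hlt := (hw y hp.1).edge_lt _ hi
    refine ⟨hc y hp.1, hinc.lt hlt, fun hm => hm _ hlt hinc ?_⟩
    rw [(hw y hp.1).color _ hi, alt, if_pos (by omega)]
  · rintro ⟨y, i⟩ hp ⟨y', i'⟩ hp' he
    simp only [Finset.coe_product, Set.mem_prod, Finset.mem_coe, Finset.mem_range] at hp hp'
    simp only [Prod.mk.injEq] at he
    have hw' := hw y' hp'.1
    have hm' := hmiss y' hp'.1
    rw [← he.1] at hw' hm'
    obtain ⟨h₁, h₂⟩ := (hw y hp.1).meet hcol hw' (by rw [h₀ y hp.1]; exact hmiss y hp.1)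
      (by rw [h₀ y' hp'.1]; exact hm') (show 2 * i ≤ 2 * h by omega)
      (show 2 * i' ≤ 2 * h by omega) (by omega) he.2
    rw [h₀ y hp.1, h₀ y' hp'.1] at h₂
    simp only [Prod.mk.injEq]
    exact ⟨h₂, by omega⟩

/-- Blocked walks have even length, so by `meet` the last vertex and the second color determine the
start. -/
theorem card_blocked_le (hcol : I.Proper col) {Y C M : Finset ℕ} {c : ℕ → ℕ} {t : ℕ}
    (hc : ∀ y ∈ Y, c y ∈ C) (hmiss : ∀ y ∈ Y, I.Misses col y (c y))
    (hbl : ∀ y ∈ Y, I.Blocked col t (c y) y M) :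
    Y.card ≤ C.card * M.card := by
  choose! xs es k h₀ hw hk hM using hbl
  rw [← Finset.card_product]
  refine Finset.card_le_card_of_injOn (fun y => (c y, xs y (k y))) ?_ ?_
  · intro y hy
    simp only [Finset.coe_product, Set.mem_prod, Finset.mem_coe]
    exact ⟨hc y hy, hM y hy⟩
  · intro y hy y' hy' he
    simp only [Prod.mk.injEq] at he
    have hw' := hw y' hy'
    have hm' := hmiss y' hy'
    have hk' := hk y' hy'
    rw [← he.1] at hw' hm' hk'
    have m₁ : I.Misses col (xs y 0) (c y) := by rw [h₀ y hy]; exact hmiss y hy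
    have m₂ : I.Misses col (xs y' 0) (c y) := by rw [h₀ y' hy']; exact hm'
    have := (hw y hy).meet hcol hw' m₁ m₂ le_rfl le_rfl
      (by rw [(hw y hy).even_length m₁ (hk y hy), hw'.even_length m₂ hk']) he.2
    rw [h₀ y hy, h₀ y' hy'] at this
    exact this.2

end Net

end EdgeColor

/-! ### The invariant of the two loops. -/

namespace EdgeColor

namespace Net

/-- The vertices carrying a mark. -/
def marked (I : Net) (mark : ℕ → ℕ) : Finset ℕ := (Finset.range I.n).filter fun x => mark x ≠ 0

/-- The state of the algorithm: a coloring `col` obtained from `col₀`, an array `phi` of `R` edges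
of `U` whose endpoints are marked, and the number `D` of colored edges in this array. Endpoints of
uncolored edges in the array miss one of the two colors `al` and `be`. -/
structure Inv (I : Net) (col₀ col mark phi : ℕ → ℕ) (R D : ℕ) : Prop where
  keeps : ∀ i < I.m, col₀ i ≠ 0 → col i ≠ 0
  mark_card : (I.marked mark).card ≤ 2 * R
  phi_mem : ∀ j < R, ∃ a < I.lam, phi j = I.U a
  phi_inj : ∀ i < R, ∀ j < R, phi i = phi j → i = j
  phi_mark : ∀ j < R, ∀ x, I.Inc (phi j) x → mark x ≠ 0
  phi_miss : ∀ j < R, col (phi j) = 0 → ∀ x, I.Inc (phi j) x →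
    I.Misses col x I.al ∨ I.Misses col x I.be
  count : D = ((Finset.range R).filter fun j => col (phi j) ≠ 0).card
  U_mark : ∀ a < I.lam, col (I.U a) ≠ 0 → mark (I.fst (I.U a)) ≠ 0
  haves_al : I.Δ * (I.haves col I.al).card ≤ 4 * I.m + 4 * I.Δ * (R + D)
  haves_be : I.Δ * (I.haves col I.be).card ≤ 4 * I.m + 4 * I.Δ * (R + D)
  size : R = 0 ∨ (R - 1) * 24 * I.Δ < I.lam

variable {I : Net} {col₀ col col' mark phi : ℕ → ℕ} {R D : ℕ}

theorem Inv.count_le (h : I.Inv col₀ col mark phi R D) : D ≤ R := by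
  rw [h.count]
  exact (Finset.card_filter_le _ _).trans (by simp)

theorem Inv.phi_lt (h : I.Inv col₀ col mark phi R D) {j : ℕ} (hj : j < R) : phi j < I.m := by
  obtain ⟨a, ha, he⟩ := h.phi_mem j hj
  rw [he]
  exact I.U_lt a ha

theorem Inv.phi_matching (h : I.Inv col₀ col mark phi R D) {i j x : ℕ} (hi : i < R) (hj : j < R)
    (hix : I.Inc (phi i) x) (hjx : I.Inc (phi j) x) : i = j := by
  obtain ⟨a, ha, hea⟩ := h.phi_mem i hi
  obtain ⟨b, hb, heb⟩ := h.phi_mem j hj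
  rw [hea] at hix
  rw [heb] at hjx
  have := I.U_matching a ha b hb x hix hjx
  exact h.phi_inj i hi j hj (by rw [hea, heb, this])

/-- Adding an edge to the array. -/
theorem Inv.push (h : I.Inv col₀ col mark phi R D) {a : ℕ} (ha : a < I.lam)
    (hmark : mark (I.fst (I.U a)) = 0) (hR : R * 24 * I.Δ < I.lam)
    (hcol : ∀ i < I.m, i ≠ I.U a → (col' i = 0 ↔ col i = 0))
    (hcolU : col₀ (I.U a) ≠ 0 → col' (I.U a) ≠ 0)
    (hmiss : ∀ z, mark z ≠ 0 → (I.Misses col z I.al ∨ I.Misses col z I.be) →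
      (I.Misses col' z I.al ∨ I.Misses col' z I.be))
    (hU : col' (I.U a) = 0 → ∀ x, I.Inc (I.U a) x → I.Misses col' x I.al ∨ I.Misses col' x I.be)
    (hal : (I.haves col' I.al).card ≤ (I.haves col I.al).card + 4)
    (hbe : (I.haves col' I.be).card ≤ (I.haves col I.be).card + 4) :
    I.Inv col₀ col' (Function.update (Function.update mark (I.fst (I.U a)) 1) (I.snd (I.U a)) 1)
      (Function.update phi R (I.U a)) (R + 1) (D + if col' (I.U a) = 0 then 0 else 1) := by
  -- Both endpoints of every array edge are marked, whereas the new edge has an unmarked endpoint.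
  have hnew : ∀ j < R, phi j ≠ I.U a := by
    intro j hj he
    exact h.phi_mark j hj (I.fst (I.U a)) (by rw [he]; exact Or.inl rfl) hmark
  have hphi : ∀ j < R, Function.update phi R (I.U a) j = phi j := fun j hj =>
    Function.update_of_ne (by omega) _ _
  have hmk : ∀ x, mark x ≠ 0 →
      Function.update (Function.update mark (I.fst (I.U a)) 1) (I.snd (I.U a)) 1 x ≠ 0 := by
    intro x hx
    rw [Function.update_apply, Function.update_apply]
    split_ifs <;> simp [hx]
  -- The increase by 4 comes from two exchanges with two ends each, and it is paid for by the
  -- increase of `R` by one.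
  have hgrow : ∀ X Y : ℕ, Y ≤ X + 4 → I.Δ * X ≤ 4 * I.m + 4 * I.Δ * (R + D) →
      I.Δ * Y ≤ 4 * I.m + 4 * I.Δ * (R + 1 + (D + if col' (I.U a) = 0 then 0 else 1)) := by
    intro X Y hXY hX
    calc I.Δ * Y ≤ I.Δ * (X + 4) := Nat.mul_le_mul_left _ hXY
      _ ≤ 4 * I.m + 4 * I.Δ * (R + D) + 4 * I.Δ := by linarith
      _ = 4 * I.m + 4 * I.Δ * (R + 1 + D) := by ring
      _ ≤ _ := by gcongr; omega
  refine ⟨?_, ?_, ?_, ?_, ?_, ?_, ?_, ?_, hgrow _ _ hal h.haves_al, hgrow _ _ hbe h.haves_be, ?_⟩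
  · intro i hi hi0
    by_cases hie : i = I.U a
    · subst hie; exact hcolU hi0
    · rw [ne_eq, hcol i hi hie]; exact h.keeps i hi hi0
  · have : I.marked (Function.update (Function.update mark (I.fst (I.U a)) 1) (I.snd (I.U a)) 1) ⊆
        insert (I.fst (I.U a)) (insert (I.snd (I.U a)) (I.marked mark)) := by
      intro x hx
      simp only [marked, Finset.mem_filter, Finset.mem_insert] at hx ⊢
      rw [Function.update_apply, Function.update_apply] at hx
      by_cases h₁ : x = I.fst (I.U a)
      · exact Or.inl h₁
      · by_cases h₂ : x = I.snd (I.U a)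
        · exact Or.inr (Or.inl h₂)
        · rw [if_neg h₂, if_neg h₁] at hx
          exact Or.inr (Or.inr hx)
    have h₁ := Finset.card_le_card this
    have h₂ := Finset.card_insert_le (I.fst (I.U a)) (insert (I.snd (I.U a)) (I.marked mark))
    have h₃ := Finset.card_insert_le (I.snd (I.U a)) (I.marked mark)
    have := h.mark_card
    omega
  · intro j hj
    by_cases hjR : j = R
    · subst hjR; exact ⟨a, ha, Function.update_self _ _ _⟩
    · rw [hphi j (by omega)]; exact h.phi_mem j (by omega)
  · intro i hi j hj he
    by_cases hiR : i = R <;> by_cases hjR : j = R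
    · omega
    · subst hiR
      rw [Function.update_self, hphi j (by omega)] at he
      exact absurd he.symm (hnew j (by omega))
    · subst hjR
      rw [Function.update_self, hphi i (by omega)] at he
      exact absurd he (hnew i (by omega))
    · rw [hphi i (by omega), hphi j (by omega)] at he
      exact h.phi_inj i (by omega) j (by omega) he
  · intro j hj x hx
    by_cases hjR : j = R
    · subst hjR
      rw [Function.update_self] at hx
      rw [Function.update_apply, Function.update_apply]
      rcases hx with rfl | rfl <;> simp
    · rw [hphi j (by omega)] at hx
      exact hmk x (h.phi_mark j (by omega) x hx)
  · intro j hj hj0 x hx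
    by_cases hjR : j = R
    · subst hjR
      rw [Function.update_self] at hx hj0
      exact hU hj0 x hx
    · rw [hphi j (by omega)] at hx hj0
      rw [hcol _ (h.phi_lt (by omega)) (hnew j (by omega))] at hj0
      exact hmiss x (h.phi_mark j (by omega) x hx) (h.phi_miss j (by omega) hj0 x hx)
  · have hfil : (Finset.range R).filter (fun j => col' (Function.update phi R (I.U a) j) ≠ 0)
        = (Finset.range R).filter (fun j => col (phi j) ≠ 0) := by
      refine Finset.filter_congr fun j hj => ?_
      rw [Finset.mem_range] at hj
      rw [hphi j hj, ne_eq, ne_eq, hcol _ (h.phi_lt hj) (hnew j hj)]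
    rw [Finset.range_add_one, Finset.filter_insert, hfil, Function.update_self, h.count]
    by_cases h0 : col' (I.U a) = 0
    · simp [h0]
    · simp [h0]
  · intro b hb hb0
    by_cases hba : I.U b = I.U a
    · rw [hba, Function.update_apply, Function.update_apply]
      simp
    · rw [ne_eq, hcol _ (I.U_lt b hb) hba] at hb0
      exact hmk _ (h.U_mark b hb hb0)
  · exact Or.inr (by simpa using hR)

/-- Coloring an edge of the array. -/
theorem Inv.color (h : I.Inv col₀ col mark phi R D) {p : ℕ} (hp : p < R) (hp0 : col (phi p) = 0)
    (hcol : ∀ i < I.m, i ≠ phi p → (col' i = 0 ↔ col i = 0)) (hcolp : col' (phi p) ≠ 0)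
    (hmiss : ∀ z, ¬ I.Inc (phi p) z → (I.Misses col z I.al ∨ I.Misses col z I.be) →
      (I.Misses col' z I.al ∨ I.Misses col' z I.be))
    (hal : (I.haves col' I.al).card ≤ (I.haves col I.al).card + 4)
    (hbe : (I.haves col' I.be).card ≤ (I.haves col I.be).card + 4) :
    I.Inv col₀ col' mark phi R (D + 1) := by
  have hgrow : ∀ X Y : ℕ, Y ≤ X + 4 → I.Δ * X ≤ 4 * I.m + 4 * I.Δ * (R + D) →
      I.Δ * Y ≤ 4 * I.m + 4 * I.Δ * (R + (D + 1)) := by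
    intro X Y hXY hX
    calc I.Δ * Y ≤ I.Δ * (X + 4) := Nat.mul_le_mul_left _ hXY
      _ ≤ 4 * I.m + 4 * I.Δ * (R + D) + 4 * I.Δ := by linarith
      _ = 4 * I.m + 4 * I.Δ * (R + (D + 1)) := by ring
  refine ⟨?_, h.mark_card, h.phi_mem, h.phi_inj, h.phi_mark, ?_, ?_, ?_,
    hgrow _ _ hal h.haves_al, hgrow _ _ hbe h.haves_be, h.size⟩
  · intro i hi hi0
    by_cases hie : i = phi p
    · subst hie; exact hcolp
    · rw [ne_eq, hcol i hi hie]; exact h.keeps i hi hi0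
  · intro j hj hj0 x hx
    by_cases hjp : j = p
    · subst hjp; exact absurd hj0 hcolp
    · have hne : phi j ≠ phi p := fun e => hjp (h.phi_inj j hj p hp e)
      rw [hcol _ (h.phi_lt hj) hne] at hj0
      -- Array edges are pairwise disjoint, so `x` is not an endpoint of the edge being colored.
      exact hmiss x (fun hpx => hjp (h.phi_matching hj hp hx hpx)) (h.phi_miss j hj hj0 x hx)
  · have : (Finset.range R).filter (fun j => col' (phi j) ≠ 0)
        = insert p ((Finset.range R).filter fun j => col (phi j) ≠ 0) := by
      ext j
      simp only [Finset.mem_filter, Finset.mem_range, Finset.mem_insert]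
      by_cases hjp : j = p
      · subst hjp; simp [hp, hcolp]
      · simp only [hjp, false_or, and_congr_right_iff]
        intro hj
        rw [ne_eq, ne_eq, hcol _ (h.phi_lt hj) fun e => hjp (h.phi_inj j hj p hp e)]
    rw [this, Finset.card_insert_of_notMem (by simp [hp0]), h.count]
  · intro b hb hb0
    by_cases hbp : I.U b = phi p
    · exact h.phi_mark p hp _ (by rw [← hbp]; exact Or.inl rfl)
    · rw [ne_eq, hcol _ (I.U_lt b hb) hbp] at hb0
      exact h.U_mark b hb hb0

/-! ### Most samples are good -/

/-- The edge number `a` of `U` can be added to the array: the walks from both of its endpoints are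
shorter than `2 * q` and do not end in a marked vertex in a harmful way. -/
def GoodSample (I : Net) (col mark c : ℕ → ℕ) (q a : ℕ) : Prop :=
  col (I.U a) = 0 ∧ (∀ y, I.Inc (I.U a) y → mark y = 0) ∧ ∀ y, I.Inc (I.U a) y → ∀ t, t = I.al ∨ t = I.be →
    ¬ I.LongWalk col t (c y) y (2 * q) ∧ ¬ I.Blocked col t (c y) y (I.marked mark)

/-- If `Δ ≤ lam`, the count over all second colors gives `|Y| * q ≤ 5 * m`, and `1536 = 7680 / 5`.
If `Δ > lam`, even a single walk of this length would need more vertices of color `t` than exist, so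
there is none. -/
theorem card_long_le (hcol : I.Proper col) {Y : Finset ℕ} {c : ℕ → ℕ} {t q : ℕ}
    (hlam : 0 < I.lam) (hq : 7680 * I.m < q * max I.lam I.Δ)
    (hN : I.Δ * (I.haves col t).card ≤ 5 * I.m) (hc : ∀ y ∈ Y, c y < I.Δ)
    (hmiss : ∀ y ∈ Y, I.Misses col y (c y))
    (hlong : ∀ y ∈ Y, I.LongWalk col t (c y) y (2 * q)) : Y.card * 1536 ≤ I.lam := by
  have hm : 0 < I.m := hlam.trans_le I.lam_le
  rcases le_or_gt I.Δ I.lam with hle | hlt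
  · rw [max_eq_left hle] at hq
    have h₁ := card_longWalk_le hcol (C := Finset.range I.Δ) (c := c)
      (fun y hy => Finset.mem_range.2 (hc y hy)) hmiss hlong
    rw [Finset.card_range] at h₁
    have h₂ : (5 * I.m) * (Y.card * 1536) ≤ (5 * I.m) * I.lam := by
      calc (5 * I.m) * (Y.card * 1536) = Y.card * (7680 * I.m) := by ring
        _ ≤ Y.card * (q * I.lam) := Nat.mul_le_mul_left _ hq.le
        _ = (Y.card * q) * I.lam := by ring
        _ ≤ (5 * I.m) * I.lam := Nat.mul_le_mul_right _ (h₁.trans hN)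
    exact Nat.le_of_mul_le_mul_left h₂ (by omega)
  · rw [max_eq_right hlt.le] at hq
    have : Y = ∅ := by
      by_contra hne
      obtain ⟨y, hy⟩ := Finset.nonempty_iff_ne_empty.2 hne
      have h₁ := card_longWalk_le hcol (Y := {y}) (C := {c y}) (c := c) (t := t) (h := q)
        (by simp) (by simpa using hmiss y hy) (by simpa using hlong y hy)
      simp only [Finset.card_singleton, one_mul] at h₁
      have : q * I.Δ ≤ I.Δ * (I.haves col t).card := by
        rw [mul_comm]; exact Nat.mul_le_mul_left _ h₁
      omega
    simp [this]

open Classical in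
-- A bad sample touches a marked vertex, the start of a long walk, or the start of a blocked walk.
-- As `U` is a matching, counting these vertices bounds the bad samples. The color `c y` has to be a
-- function of the vertex, so that each vertex starts only one walk per color `t`.
theorem Inv.card_goodSample (h : I.Inv col₀ col mark phi R D) (hcol : I.Proper col)
    {c : ℕ → ℕ} {q : ℕ}
    (hq : 7680 * I.m < q * max I.lam I.Δ) (hR : R * 24 * I.Δ < I.lam)
    (hc : ∀ a < I.lam, col (I.U a) = 0 → ∀ y, I.Inc (I.U a) y → c y < I.Δ ∧ I.Misses col y (c y)) :
    I.lam ≤ 4 * ((Finset.range I.lam).filter (I.GoodSample col mark c q)).card := by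
  have hΔ : 0 < I.Δ := (Nat.zero_le _).trans_lt I.al_lt
  have hlam : 0 < I.lam := (Nat.zero_le _).trans_lt hR
  have hN : ∀ t, t = I.al ∨ t = I.be → I.Δ * (I.haves col t).card ≤ 5 * I.m := by
    have h₁ : 4 * I.Δ * (R + D) ≤ I.m := by
      calc 4 * I.Δ * (R + D) ≤ 4 * I.Δ * (6 * R) := by
            gcongr; have := h.count_le; omega
        _ = R * 24 * I.Δ := by ring
        _ ≤ I.m := hR.le.trans I.lam_le
    rintro t (rfl | rfl)
    · exact h.haves_al.trans (by omega)
    · exact h.haves_be.trans (by omega)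
  -- Since `U` is a matching, a vertex set meets at most as many edges of `U` as it has elements.
  have hcard : ∀ S : Finset ℕ,
      ((Finset.range I.lam).filter fun a => ∃ y, I.Inc (I.U a) y ∧ y ∈ S).card ≤ S.card := by
    intro S
    have hex : ∀ a ∈ (Finset.range I.lam).filter (fun a => ∃ y, I.Inc (I.U a) y ∧ y ∈ S),
        ∃ y, I.Inc (I.U a) y ∧ y ∈ S := fun a ha => (Finset.mem_filter.1 ha).2
    choose! f hf hfS using hex
    refine Finset.card_le_card_of_injOn f (fun a ha => hfS a ha) ?_
    intro a ha b hb he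
    have ha' := Finset.mem_range.1 (Finset.mem_filter.1 ha).1
    have hb' := Finset.mem_range.1 (Finset.mem_filter.1 hb).1
    refine I.U_matching a ha' b hb' _ (hf a ha) ?_
    rw [he]
    exact hf b hb
  set B₀ := (Finset.range I.lam).filter fun a => ∃ y, I.Inc (I.U a) y ∧ y ∈ I.marked mark with hB₀
  let act : ℕ → Prop := fun y => ∃ a < I.lam, I.Inc (I.U a) y ∧ col (I.U a) = 0
  let Y : ℕ → Finset ℕ := fun t =>
    (Finset.range I.n).filter fun y => act y ∧ I.LongWalk col t (c y) y (2 * q)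
  let Z : ℕ → Finset ℕ := fun t =>
    (Finset.range I.n).filter fun y => act y ∧ I.Blocked col t (c y) y (I.marked mark)
  set W := (Y I.al ∪ Y I.be) ∪ (Z I.al ∪ Z I.be) with hW
  set B₁ := (Finset.range I.lam).filter fun a => ∃ y, I.Inc (I.U a) y ∧ y ∈ W with hB₁
  have hact : ∀ y, act y → c y < I.Δ ∧ I.Misses col y (c y) := by
    rintro y ⟨a, ha, hy, h0⟩
    exact hc a ha h0 y hy
  have cB₀ : B₀.card ≤ 2 * R := (hcard _).trans h.mark_card
  have cB₁ : B₁.card ≤ W.card := hcard W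
  have cY : ∀ t, t = I.al ∨ t = I.be → (Y t).card * 1536 ≤ I.lam := by
    intro t ht
    refine card_long_le hcol hlam hq (hN t ht) (c := c) ?_ ?_ ?_ <;> intro y hy <;>
      have hy' := (Finset.mem_filter.1 hy).2
    · exact (hact y hy'.1).1
    · exact (hact y hy'.1).2
    · exact hy'.2
  have cZ : ∀ t, (Z t).card ≤ I.Δ * (2 * R) := by
    intro t
    refine (card_blocked_le hcol (C := Finset.range I.Δ) (M := I.marked mark) (c := c) (t := t)
      ?_ ?_ ?_).trans ?_
    · exact fun y hy => Finset.mem_range.2 (hact y (Finset.mem_filter.1 hy).2.1).1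
    · exact fun y hy => (hact y (Finset.mem_filter.1 hy).2.1).2
    · exact fun y hy => (Finset.mem_filter.1 hy).2.2
    · rw [Finset.card_range]
      exact Nat.mul_le_mul_left _ h.mark_card
  have hbad : (Finset.range I.lam).filter (fun a => ¬ I.GoodSample col mark c q a) ⊆ B₀ ∪ B₁ := by
    intro a ha
    rw [Finset.mem_filter, Finset.mem_range] at ha
    obtain ⟨ha, hbad⟩ := ha
    rw [Finset.mem_union]
    by_cases hm : ∀ y, I.Inc (I.U a) y → mark y = 0
    · right
      -- Colored edges of `U` have a marked endpoint, so an edge without marks is uncolored and its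
      -- endpoints do have missing colors.
      have h0 : col (I.U a) = 0 := by
        by_contra h0
        exact h.U_mark a ha h0 (hm _ (Or.inl rfl))
      rw [GoodSample, not_and, not_and] at hbad
      replace hbad := hbad h0 hm
      push Not at hbad
      obtain ⟨y, hy, t, ht, hbad⟩ := hbad
      have hyn : y < I.n := Inc.lt (I.U_lt a ha) hy
      refine Finset.mem_filter.2 ⟨Finset.mem_range.2 ha, y, hy, ?_⟩
      have hay : act y := ⟨a, ha, hy, h0⟩
      by_cases hl : I.LongWalk col t (c y) y (2 * q)
      · have : y ∈ Y t := Finset.mem_filter.2 ⟨Finset.mem_range.2 hyn, hay, hl⟩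
        simp only [hW, Finset.mem_union]
        rcases ht with rfl | rfl
        · exact Or.inl (Or.inl this)
        · exact Or.inl (Or.inr this)
      · have : y ∈ Z t := Finset.mem_filter.2 ⟨Finset.mem_range.2 hyn, hay, hbad hl⟩
        simp only [hW, Finset.mem_union]
        rcases ht with rfl | rfl
        · exact Or.inr (Or.inl this)
        · exact Or.inr (Or.inr this)
    · push Not at hm
      obtain ⟨y, hy, hym⟩ := hm
      exact Or.inl (Finset.mem_filter.2 ⟨Finset.mem_range.2 ha, y, hy,
        Finset.mem_filter.2 ⟨Finset.mem_range.2 (hy.lt (I.U_lt a ha)), hym⟩⟩)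
  have hsplit := Finset.card_filter_add_card_filter_not (s := Finset.range I.lam)
    (I.GoodSample col mark c q)
  rw [Finset.card_range] at hsplit
  have hb := (Finset.card_le_card hbad).trans (Finset.card_union_le _ _)
  have hWc : W.card ≤ ((Y I.al).card + (Y I.be).card) + ((Z I.al).card + (Z I.be).card) :=
    (Finset.card_union_le _ _).trans
      (add_le_add (Finset.card_union_le _ _) (Finset.card_union_le _ _))
  have y₁ := cY I.al (Or.inl rfl)
  have y₂ := cY I.be (Or.inr rfl)
  have z₁ := cZ I.al
  have z₂ := cZ I.be
  -- The bad samples number at most `2R + 2 * lam / 1536 + 4RΔ`, and `6RΔ < lam / 4`, which leaves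
  -- more than a quarter of the samples.
  have hRΔ : R ≤ R * I.Δ := Nat.le_mul_of_pos_right _ hΔ
  have e₁ : R * 24 * I.Δ = 24 * (R * I.Δ) := by ring
  have e₂ : I.Δ * (2 * R) = 2 * (R * I.Δ) := by ring
  rw [e₁] at hR
  rw [e₂] at z₁ z₂
  omega

/-- The edge number `j` of the array can be colored: the walk from its first endpoint is shorter
than `2 * q`. -/
def GoodEdge (I : Net) (col phi : ℕ → ℕ) (q j : ℕ) : Prop :=
  col (phi j) = 0 ∧ ∀ t s, (t = I.al ∧ s = I.be ∨ t = I.be ∧ s = I.al) →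
    I.Misses col (I.fst (phi j)) s → ¬ I.LongWalk col t s (I.fst (phi j)) (2 * q)

open Classical in
-- Fewer than half of the array edges are colored. For each of the two color orders at most `336 /
-- 7680` of the array starts a long walk, since here the second color is fixed and the array has at
-- least `lam / (24Δ)` edges.
theorem Inv.card_goodEdge (h : I.Inv col₀ col mark phi R D) (hcol : I.Proper col) {q : ℕ}
    (hq : 7680 * I.m < q * max I.lam I.Δ) (hR : I.lam ≤ R * 24 * I.Δ) (hD : 2 * D < R) :
    R ≤ 4 * ((Finset.range R).filter (I.GoodEdge col phi q)).card := by
  have hΔ : 0 < I.Δ := (Nat.zero_le _).trans_lt I.al_lt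
  have hm : 0 < I.m := hΔ.trans_le I.Δ_le
  have hR0 : 0 < R := by omega
  have hN : ∀ t, t = I.al ∨ t = I.be → I.Δ * (I.haves col t).card ≤ 14 * I.m := by
    -- The last edge put into the array may overshoot the bound `m` on `24RΔ`. Its contribution `8Δ`
    -- is absorbed by `Δ ≤ m`, which matters when `R = 1`.
    have h₁ : 4 * I.Δ * (R + D) ≤ 9 * I.m := by
      have h₂ : (R - 1) * 24 * I.Δ ≤ I.m := by
        rcases h.size with h' | h'
        · omega
        · exact h'.le.trans I.lam_le
      obtain ⟨r, rfl⟩ : ∃ r, R = r + 1 := ⟨R - 1, by omega⟩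
      simp only [Nat.add_sub_cancel] at h₂
      have := h.count_le
      calc 4 * I.Δ * (r + 1 + D) ≤ 4 * I.Δ * (2 * (r + 1)) := by gcongr; omega
        _ = 8 * (r * I.Δ) + 8 * I.Δ := by ring
        _ ≤ r * 24 * I.Δ + 8 * I.Δ := by nlinarith [Nat.zero_le (r * I.Δ)]
        _ ≤ 9 * I.m := by have := I.Δ_le; omega
    rintro t (rfl | rfl)
    · exact h.haves_al.trans (by omega)
    · exact h.haves_be.trans (by omega)
  let L : ℕ → ℕ → Finset ℕ := fun t s => (Finset.range R).filter fun j =>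
    I.Misses col (I.fst (phi j)) s ∧ I.LongWalk col t s (I.fst (phi j)) (2 * q)
  have cL : ∀ t s, t = I.al ∨ t = I.be → (L t s).card * 7680 ≤ 336 * R := by
    intro t s ht
    have hinj : Set.InjOn (fun j => I.fst (phi j)) (L t s : Set ℕ) := by
      intro i hi j hj he
      have hi' := Finset.mem_range.1 (Finset.mem_filter.1 hi).1
      have hj' := Finset.mem_range.1 (Finset.mem_filter.1 hj).1
      exact h.phi_matching hi' hj' (Or.inl rfl) (Or.inl he.symm)
    have h₁ := card_longWalk_le hcol (Y := (L t s).image fun j => I.fst (phi j)) (C := {s})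
      (c := fun _ => s) (t := t) (h := q) (by simp)
      (by
        intro y hy
        obtain ⟨j, hj, rfl⟩ := Finset.mem_image.1 hy
        exact (Finset.mem_filter.1 hj).2.1)
      (by
        intro y hy
        obtain ⟨j, hj, rfl⟩ := Finset.mem_image.1 hy
        exact (Finset.mem_filter.1 hj).2.2)
    rw [Finset.card_image_of_injOn hinj, Finset.card_singleton, one_mul] at h₁
    have hmx : max I.lam I.Δ ≤ R * 24 * I.Δ := by
      refine max_le hR ?_
      calc I.Δ = 1 * I.Δ := (one_mul _).symm
        _ ≤ R * 24 * I.Δ := Nat.mul_le_mul_right _ (by omega)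
    have h₂ : (I.m * I.Δ) * ((L t s).card * 7680) ≤ (I.m * I.Δ) * (336 * R) := by
      calc (I.m * I.Δ) * ((L t s).card * 7680) = ((L t s).card * I.Δ) * (7680 * I.m) := by ring
        _ ≤ ((L t s).card * I.Δ) * (q * max I.lam I.Δ) := Nat.mul_le_mul_left _ hq.le
        _ = I.Δ * ((L t s).card * q) * max I.lam I.Δ := by ring
        _ ≤ I.Δ * (I.haves col t).card * (R * 24 * I.Δ) := by gcongr
        _ ≤ (14 * I.m) * (R * 24 * I.Δ) := Nat.mul_le_mul_right _ (hN t ht)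
        _ = (I.m * I.Δ) * (336 * R) := by ring
    exact Nat.le_of_mul_le_mul_left h₂ (Nat.mul_pos hm hΔ)
  have hbad : (Finset.range R).filter (fun j => ¬ I.GoodEdge col phi q j) ⊆
      ((Finset.range R).filter fun j => col (phi j) ≠ 0) ∪ (L I.al I.be ∪ L I.be I.al) := by
    intro j hj
    rw [Finset.mem_filter, Finset.mem_range] at hj
    obtain ⟨hj, hbad⟩ := hj
    rw [Finset.mem_union]
    by_cases h0 : col (phi j) = 0
    · right
      simp only [GoodEdge, h0, true_and] at hbad
      push Not at hbad
      obtain ⟨t, s, hts, hbad⟩ := hbad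
      have : j ∈ L t s := Finset.mem_filter.2 ⟨Finset.mem_range.2 hj, hbad⟩
      rw [Finset.mem_union]
      rcases hts with ⟨rfl, rfl⟩ | ⟨rfl, rfl⟩
      · exact Or.inl this
      · exact Or.inr this
    · exact Or.inl (Finset.mem_filter.2 ⟨Finset.mem_range.2 hj, h0⟩)
  have hsplit := Finset.card_filter_add_card_filter_not (s := Finset.range R)
    (I.GoodEdge col phi q)
  rw [Finset.card_range] at hsplit
  have hb := (Finset.card_le_card hbad).trans (Finset.card_union_le _ _)
  have hLc := Finset.card_union_le (L I.al I.be) (L I.be I.al)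
  have l₁ := cL I.al I.be (Or.inl rfl)
  have l₂ := cL I.be I.al (Or.inr rfl)
  rw [← h.count] at hb
  omega

end Net

end EdgeColor

namespace EdgeColor

/-! ### Rows of the data structure -/

theorem index_inj {Δ u u' c c' : ℕ} (hc : c < Δ) (hc' : c' < Δ) (h : u * Δ + c = u' * Δ + c') :
    u = u' ∧ c = c' := by
  have h₁ : (u * Δ + c) / Δ = u := by
    rw [mul_comm, Nat.mul_add_div (by omega), Nat.div_eq_of_lt hc, add_zero]
  have h₂ : (u' * Δ + c') / Δ = u' := by
    rw [mul_comm, Nat.mul_add_div (by omega), Nat.div_eq_of_lt hc', add_zero]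
  have : u = u' := by rw [← h₁, h, h₂]
  subst this
  exact ⟨rfl, by omega⟩

theorem index_lt {Δ n u c : ℕ} (hu : u < n) (hc : c < Δ) : u * Δ + c < n * Δ := by
  calc u * Δ + c < u * Δ + Δ := by omega
    _ = (u + 1) * Δ := by ring
    _ ≤ n * Δ := Nat.mul_le_mul_right _ hu

/-- The list of the colors below `d` that are missing at `u`, where `inc` is the table of incident
edges, `cnt` the sizes of the lists, `lst` their elements and `pos` the positions of the elements. -/
def Row (Δ d u : ℕ) (inc cnt lst pos : ℕ → ℕ) : Prop :=
  (∀ j < cnt u, ∃ c < Δ, inc (u * Δ + c) = 0 ∧ c < d ∧ lst (u * Δ + j) = c ∧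
    pos (u * Δ + c) = j) ∧
  ∀ c < Δ, inc (u * Δ + c) = 0 → c < d → ∃ j < cnt u, lst (u * Δ + j) = c

section Row

variable {Δ d u : ℕ} {inc cnt lst pos inc' cnt' lst' pos' : ℕ → ℕ}

/-- The stored positions invert the list, so the list has no repetitions. -/
theorem Row.cnt_le_card (h : Row Δ d u inc cnt lst pos) {S : Finset ℕ}
    (hS : ∀ c < Δ, inc (u * Δ + c) = 0 → c ∈ S) : cnt u ≤ S.card := by
  rw [← Finset.card_range (cnt u)]
  refine Finset.card_le_card_of_injOn (fun j => lst (u * Δ + j)) ?_ ?_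
  · intro j hj
    obtain ⟨c, hc, h0, _, hl, _⟩ := h.1 j (by simpa using hj)
    simp only [hl]
    exact hS c hc h0
  · intro i hi j hj he
    obtain ⟨c, hc, _, _, hl, hp⟩ := h.1 i (by simpa using hi)
    obtain ⟨c', hc', _, _, hl', hp'⟩ := h.1 j (by simpa using hj)
    simp only [hl, hl'] at he
    rw [← hp, ← hp', he]

theorem Row.cnt_le (h : Row Δ d u inc cnt lst pos) : cnt u ≤ Δ := by
  simpa using h.cnt_le_card (S := Finset.range Δ) fun c hc _ => Finset.mem_range.2 hc

/-- A color present at `u` leaves a free slot in the segment of length `Δ` that belongs to `u`, so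
an insertion does not run into the next row. -/
theorem Row.cnt_lt (h : Row Δ d u inc cnt lst pos) {c : ℕ} (hc : c < Δ)
    (hne : inc (u * Δ + c) ≠ 0) : cnt u < Δ := by
  have := h.cnt_le_card (S := (Finset.range Δ).erase c) fun c' hc' h0 =>
    Finset.mem_erase.2 ⟨fun e => hne (e ▸ h0), Finset.mem_range.2 hc'⟩
  rw [Finset.card_erase_of_mem (Finset.mem_range.2 hc), Finset.card_range] at this
  omega

theorem Row.congr (h : Row Δ d u inc cnt lst pos)
    (h₁ : ∀ c < Δ, inc' (u * Δ + c) = inc (u * Δ + c)) (h₂ : cnt' u = cnt u)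
    (h₃ : ∀ c < Δ, lst' (u * Δ + c) = lst (u * Δ + c))
    (h₄ : ∀ c < Δ, pos' (u * Δ + c) = pos (u * Δ + c)) : Row Δ d u inc' cnt' lst' pos' := by
  have hle := h.cnt_le
  refine ⟨fun j hj => ?_, fun c hc h0 hd => ?_⟩
  · rw [h₂] at hj
    obtain ⟨c, hc, h0, hd, hl, hp⟩ := h.1 j hj
    exact ⟨c, hc, by rw [h₁ c hc, h0], hd, by rw [h₃ j (by omega), hl], by rw [h₄ c hc, hp]⟩
  · rw [h₁ c hc] at h0
    obtain ⟨j, hj, hl⟩ := h.2 c hc h0 hd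
    exact ⟨j, h₂ ▸ hj, by rw [h₃ j (by omega), hl]⟩

theorem Row.insert (h : Row Δ d u inc cnt lst pos) {c : ℕ} (hc : c < Δ) (hd : c < d)
    (hne : inc (u * Δ + c) ≠ 0) :
    Row Δ d u (Function.update inc (u * Δ + c) 0) (Function.update cnt u (cnt u + 1))
      (Function.update lst (u * Δ + cnt u) c) (Function.update pos (u * Δ + c) (cnt u)) := by
  have hlt := h.cnt_lt hc hne
  refine ⟨fun j hj => ?_, fun c' hc' h0 hd' => ?_⟩
  · rw [Function.update_self] at hj
    by_cases hjc : j = cnt u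
    · subst hjc
      exact ⟨c, hc, by simp, hd, by simp, by simp⟩
    · obtain ⟨c', hc', h0, hd', hl, hp⟩ := h.1 j (by omega)
      have hcc : c' ≠ c := by rintro rfl; exact hne h0
      refine ⟨c', hc', ?_, hd', ?_, ?_⟩
      · rw [Function.update_of_ne (by omega), h0]
      · rw [Function.update_of_ne (by omega), hl]
      · rw [Function.update_of_ne (by omega), hp]
  · rw [Function.update_self]
    by_cases hcc : c' = c
    · subst hcc
      exact ⟨cnt u, by omega, by simp⟩
    · rw [Function.update_of_ne (by omega)] at h0
      obtain ⟨j, hj, hl⟩ := h.2 c' hc' h0 hd'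
      exact ⟨j, by omega, by rw [Function.update_of_ne (by omega), hl]⟩

theorem Row.update_of_not_lt (h : Row Δ d u inc cnt lst pos) {c : ℕ} (hd : ¬ c < d) (v : ℕ) :
    Row Δ d u (Function.update inc (u * Δ + c) v) cnt lst pos := by
  refine ⟨fun j hj => ?_, fun c' hc' h0 hd' => ?_⟩
  · obtain ⟨c', hc', h0, hd', hl, hp⟩ := h.1 j hj
    exact ⟨c', hc', by rw [Function.update_of_ne (by omega), h0], hd', hl, hp⟩
  · rw [Function.update_of_ne (by omega)] at h0
    exact h.2 c' hc' h0 hd'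

theorem Row.cnt_pos (h : Row Δ d u inc cnt lst pos) {c : ℕ} (hc : c < Δ) (hd : c < d)
    (h0 : inc (u * Δ + c) = 0) : 0 < cnt u := by
  obtain ⟨j, hj, -⟩ := h.2 c hc h0 hd
  omega

theorem Row.pos_lt (h : Row Δ d u inc cnt lst pos) {c : ℕ} (hc : c < Δ) (hd : c < d)
    (h0 : inc (u * Δ + c) = 0) : pos (u * Δ + c) < cnt u ∧ lst (u * Δ + pos (u * Δ + c)) = c := by
  obtain ⟨j, hj, hl⟩ := h.2 c hc h0 hd
  obtain ⟨c', -, -, -, hl', hp⟩ := h.1 j hj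
  have : c' = c := by rw [← hl', hl]
  subst this
  rw [hp]
  exact ⟨hj, hl⟩

theorem Row.lst_lt (h : Row Δ d u inc cnt lst pos) {j : ℕ} (hj : j < cnt u) :
    lst (u * Δ + j) < Δ := by
  obtain ⟨c, hc, -, -, hl, -⟩ := h.1 j hj
  rw [hl]; exact hc

/-- The vacated slot receives the last element `z` of the list. If `z` is the deleted color itself,
its slot lies beyond the new length and nothing needs to be repaired. -/
theorem Row.delete (h : Row Δ d u inc cnt lst pos) {c v : ℕ} (hc : c < Δ) (hd : c < d)
    (h0 : inc (u * Δ + c) = 0) (hv : v ≠ 0) :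
    Row Δ d u (Function.update inc (u * Δ + c) v) (Function.update cnt u (cnt u - 1))
      (Function.update lst (u * Δ + pos (u * Δ + c)) (lst (u * Δ + (cnt u - 1))))
      (Function.update pos (u * Δ + lst (u * Δ + (cnt u - 1))) (pos (u * Δ + c))) := by
  obtain ⟨hq, hlq⟩ := h.pos_lt hc hd h0
  have hcnt := h.cnt_pos hc hd h0
  obtain ⟨z, hz, hz0, hzd, hlz, hpz⟩ := h.1 (cnt u - 1) (by omega)
  rw [hlz]
  set q := pos (u * Δ + c) with hqdef
  refine ⟨fun j hj => ?_, fun c' hc' hc0 hd' => ?_⟩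
  · rw [Function.update_self] at hj
    by_cases hjq : j = q
    · have hzc : z ≠ c := by
        rintro rfl
        omega
      refine ⟨z, hz, ?_, hzd, ?_, ?_⟩
      · rw [Function.update_of_ne (by omega), hz0]
      · rw [hjq, Function.update_self]
      · rw [hjq, Function.update_self]
    · obtain ⟨c', hc', hc0, hd', hl, hp⟩ := h.1 j (by omega)
      have hcc : c' ≠ c := by
        rintro rfl
        omega
      have hcz : c' ≠ z := by
        rintro rfl
        omega
      refine ⟨c', hc', ?_, hd', ?_, ?_⟩
      · rw [Function.update_of_ne (by omega), hc0]
      · rw [Function.update_of_ne (by omega), hl]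
      · rw [Function.update_of_ne (by omega), hp]
  · have hcc : c' ≠ c := by
      rintro rfl
      rw [Function.update_self] at hc0
      exact hv hc0
    rw [Function.update_of_ne (by omega)] at hc0
    obtain ⟨j, hj, hl⟩ := h.2 c' hc' hc0 hd'
    rw [Function.update_self]
    have hjq : j ≠ q := by
      rintro rfl
      exact hcc (hl.symm.trans hlq)
    by_cases hj1 : j = cnt u - 1
    · subst hj1
      refine ⟨q, by omega, ?_⟩
      rw [Function.update_self, ← hl, hlz]
    · exact ⟨j, by omega, by rw [Function.update_of_ne (by omega), hl]⟩

end Row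

/-! ### Programs -/

open WordRAM

instance : Add WTerm := ⟨.bin .add⟩
instance : Sub WTerm := ⟨.bin .sub⟩
instance : Mul WTerm := ⟨.bin .mul⟩
instance : Div WTerm := ⟨.bin .div⟩

/-- Comparison of words. -/
def ltT (s t : WTerm) : WTerm := .bin .lt s t

/-- Equality of words. -/
def eqT (s t : WTerm) : WTerm := .bin .eq s t

/-- The register stored in bank `b`. -/
def reg (b : ℕ) : WTerm := .load b (.const 0)

/-- The entry of the parameter bank with index `i`. -/
def par (i : ℕ) : WTerm := .load 0 (.const i)

/-- Write the value of `t` to the register in bank `b`. -/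
def setReg (b : ℕ) (t : WTerm) : Prog := .store b (.const 0) t

section val

variable {w : ℕ} {σ : Mem}

theorem val_add {s t : WTerm} {x y : ℕ} (hs : s.val w σ = x) (ht : t.val w σ = y)
    (h : x + y < 2 ^ w) : (s + t).val w σ = x + y := by
  change (s.val w σ + t.val w σ) % 2 ^ w = _
  rw [hs, ht, Nat.mod_eq_of_lt h]

theorem val_sub {s t : WTerm} {x y : ℕ} (hs : s.val w σ = x) (ht : t.val w σ = y)
    (h : x < 2 ^ w) : (s - t).val w σ = x - y := by
  change (s.val w σ - t.val w σ) % 2 ^ w = _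
  rw [hs, ht, Nat.mod_eq_of_lt ((Nat.sub_le _ _).trans_lt h)]

theorem val_mul {s t : WTerm} {x y : ℕ} (hs : s.val w σ = x) (ht : t.val w σ = y)
    (h : x * y < 2 ^ w) : (s * t).val w σ = x * y := by
  change (s.val w σ * t.val w σ) % 2 ^ w = _
  rw [hs, ht, Nat.mod_eq_of_lt h]

theorem val_div {s t : WTerm} {x y : ℕ} (hs : s.val w σ = x) (ht : t.val w σ = y)
    (h : x < 2 ^ w) : (s / t).val w σ = x / y := by
  change (s.val w σ / t.val w σ) % 2 ^ w = _
  rw [hs, ht, Nat.mod_eq_of_lt ((Nat.div_le_self _ _).trans_lt h)]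

theorem val_lt {s t : WTerm} {x y : ℕ} (hw : 1 < 2 ^ w) (hs : s.val w σ = x)
    (ht : t.val w σ = y) : (ltT s t).val w σ = if x < y then 1 else 0 := by
  change (if s.val w σ < t.val w σ then 1 else 0) % 2 ^ w = _
  rw [hs, ht, Nat.mod_eq_of_lt (by split_ifs <;> omega)]

theorem val_eq {s t : WTerm} {x y : ℕ} (hw : 1 < 2 ^ w) (hs : s.val w σ = x)
    (ht : t.val w σ = y) : (eqT s t).val w σ = if x = y then 1 else 0 := by
  change (if s.val w σ = t.val w σ then 1 else 0) % 2 ^ w = _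
  rw [hs, ht, Nat.mod_eq_of_lt (by split_ifs <;> omega)]

theorem val_reg (b : ℕ) : (reg b).val w σ = σ b 0 := by
  simp [reg, WTerm.val]

theorem val_load {b x : ℕ} {t : WTerm} (ht : t.val w σ = x) :
    (WTerm.load b t).val w σ = σ b x := by
  simp [WTerm.val, ht]

theorem val_const {k : ℕ} (hk : k < 2 ^ w) : (WTerm.const k).val w σ = k :=
  Nat.mod_eq_of_lt hk

theorem val_par {i : ℕ} (hi : i < 2 ^ w) : (par i).val w σ = σ 0 i :=
  val_load (val_const hi)

theorem Ex.store {b i v : ℕ} {a t : WTerm} {Q : Mem → Prop} (ha : a.val w σ = i)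
    (ht : t.val w σ = v) (h : Q (σ.set b i v)) :
    Ex w (.store b a t) σ (1 + a.size + t.size) Q := by
  refine Ex.of_straight (.store b a t) σ rfl ?_
  simpa [Prog.exec, ha, ht] using h

theorem Ex.setReg {b v : ℕ} {t : WTerm} {Q : Mem → Prop} (ht : t.val w σ = v)
    (h : Q (σ.set b 0 v)) : Ex w (setReg b t) σ (2 + t.size) Q :=
  Ex.store (by simp [WTerm.val]) ht h

theorem Ex.skip {Q : Mem → Prop} (h : Q σ) : Ex w .skip σ 1 Q := Ex.of_straight .skip σ rfl h

end val

/-- The two memories agree outside of the banks `bs`. -/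
def Same (bs : List ℕ) (σ σ' : Mem) : Prop := ∀ b, b ∉ bs → σ' b = σ b

theorem Same.refl (bs : List ℕ) (σ : Mem) : Same bs σ σ := fun _ _ => rfl

theorem Same.trans {bs cs : List ℕ} {σ σ₁ σ₂ : Mem} (h : Same bs σ σ₁) (h' : Same cs σ₁ σ₂) :
    Same (bs ++ cs) σ σ₂ := by
  intro b hb
  rw [List.mem_append, not_or] at hb
  rw [h' b hb.2, h b hb.1]

theorem Same.set {bs : List ℕ} {σ σ' : Mem} (h : Same bs σ σ') {b : ℕ} (hb : b ∈ bs) (i x : ℕ) :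
    Same bs σ (σ'.set b i x) := by
  intro b' hb'
  rw [Mem.set_bank_ne _ _ _ (by rintro rfl; exact hb' hb)]
  exact h b' hb'

theorem Same.mono {bs cs : List ℕ} {σ σ' : Mem} (h : Same bs σ σ') (hs : bs ⊆ cs) :
    Same cs σ σ' := fun b hb => h b fun hb' => hb (hs hb')

/-! ### Memory contents that represent a net and a coloring. -/

variable (I : Net) (w : ℕ)

/-- The constant part of the memory. -/
structure Base (σ : Mem) : Prop where
  num_vertices : σ 0 0 = I.n
  num_edges : σ 0 1 = I.m
  num_colors : σ 0 2 = I.Δ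
  num_U : σ 0 3 = I.lam
  first : σ 0 4 = I.al
  second : σ 0 5 = I.be
  fst : ∀ i < I.m, σ 1 i = I.fst i
  snd : ∀ i < I.m, σ 2 i = I.snd i
  U : ∀ a < I.lam, σ 8 a = I.U a
  deg : ∀ u < I.n, σ 9 u = I.deg u

/-- The data structure for the coloring stored in bank `3`. -/
structure DS (σ : Mem) : Prop where
  le : ∀ i < I.m, σ 3 i ≤ I.Δ
  inc_some : ∀ u c i, c < I.Δ → i < I.m → I.Inc i u → σ 3 i = c + 1 → σ 4 (u * I.Δ + c) = i + 1
  inc_none : ∀ u < I.n, ∀ c < I.Δ, I.Misses (σ 3) u c → σ 4 (u * I.Δ + c) = 0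
  row : ∀ u < I.n, Row I.Δ (I.deg u) u (σ 4) (σ 5) (σ 6) (σ 7)

/-- All numbers that occur fit into words. -/
def Fits : Prop := 40000 * (I.n * I.Δ + I.n + I.m + 1) < 2 ^ w

variable {I w} {σ σ' : Mem}

theorem Base.congr {bs : List ℕ} (h : Base I σ) (hs : Same bs σ σ')
    (hb : ∀ b ∈ [0, 1, 2, 8, 9], b ∉ bs) : Base I σ' := by
  have e₀ := hs 0 (hb 0 (by simp))
  have e₁ := hs 1 (hb 1 (by simp))
  have e₂ := hs 2 (hb 2 (by simp))
  have e₈ := hs 8 (hb 8 (by simp))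
  have e₉ := hs 9 (hb 9 (by simp))
  obtain ⟨h0, h1, h2, h3, h4, h5, h6, h7, h8, h9⟩ := h
  constructor <;> simpa only [e₀, e₁, e₂, e₈, e₉]

theorem DS.congr {bs : List ℕ} (h : DS I σ) (hs : Same bs σ σ')
    (hb : ∀ b ∈ [3, 4, 5, 6, 7], b ∉ bs) : DS I σ' := by
  have e₃ := hs 3 (hb 3 (by simp))
  have e₄ := hs 4 (hb 4 (by simp))
  have e₅ := hs 5 (hb 5 (by simp))
  have e₆ := hs 6 (hb 6 (by simp))
  have e₇ := hs 7 (hb 7 (by simp))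
  obtain ⟨h1, h2, h3, h4⟩ := h
  constructor <;> simpa only [e₃, e₄, e₅, e₆, e₇]

/-- The table has room for only one edge per vertex and color, so its correctness already implies
properness. -/
theorem DS.proper (h : DS I σ) : I.Proper (σ 3) := by
  intro i hi j hj x hix hjx he hne
  have hle := h.le i hi
  have h₁ := h.inc_some x (σ 3 i - 1) i (by omega) hi hix (by omega)
  have h₂ := h.inc_some x (σ 3 i - 1) j (by omega) hj hjx (by omega)
  omega

theorem DS.inc_eq_zero (h : DS I σ) {u c : ℕ} (hu : u < I.n) (hc : c < I.Δ) :
    σ 4 (u * I.Δ + c) = 0 ↔ I.Misses (σ 3) u c := by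
  refine ⟨fun h0 i hi hiu he => ?_, h.inc_none u hu c hc⟩
  have := h.inc_some u c i hc hi hiu he
  omega

theorem DS.exists_inc (h : DS I σ) {u c : ℕ} (hu : u < I.n) (hc : c < I.Δ)
    (hne : σ 4 (u * I.Δ + c) ≠ 0) :
    ∃ i < I.m, I.Inc i u ∧ σ 3 i = c + 1 ∧ σ 4 (u * I.Δ + c) = i + 1 := by
  by_contra hcon
  push Not at hcon
  refine hne (h.inc_none u hu c hc fun i hi hiu he => ?_)
  exact hcon i hi hiu he (h.inc_some u c i hc hi hiu he)

theorem Fits.one_lt (h : Fits I w) : 1 < 2 ^ w := by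
  unfold Fits at h; omega

end EdgeColor

/-! ### Programs that change the color of one edge. -/

namespace EdgeColor

open WordRAM

attribute [simp] bPar bFst bSnd bCol bInc bMissCnt bMissList bMissPos bU bDeg

/-! Registers and arrays of the algorithm. -/

/-- Number of recorded edges. -/
@[simp] abbrev rK : ℕ := 19
/-- Current edge. -/
@[simp] abbrev rE : ℕ := 23
/-- Loop counter. -/
@[simp] abbrev rJ : ℕ := 24
/-- Current color. -/
@[simp] abbrev rC : ℕ := 25
/-- Current vertex. -/
@[simp] abbrev rY : ℕ := 26
/-- Current position in the table of incident edges. -/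
@[simp] abbrev rP : ℕ := 27
/-- Position of a deleted color in its list. -/
@[simp] abbrev rQ : ℕ := 28
/-- Last color of a list. -/
@[simp] abbrev rZ : ℕ := 29
/-- Recorded edges. -/
@[simp] abbrev aEdge : ℕ := 33
/-- New colors of the recorded edges. -/
@[simp] abbrev aColor : ℕ := 34

theorem set_bank (σ : Mem) (b i x b' : ℕ) :
    (σ.set b i x) b' = if b' = b then Function.update (σ b) i x else σ b' := by
  split_ifs with h
  · subst h; exact Mem.set_bank_eq _ _ _ _
  · exact Mem.set_bank_ne _ _ _ h

/-- Insert the color `rC` into the list of missing colors of the vertex `rY`. -/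
def insRow : Prog :=
  .seq (setReg rP (reg rY * par 2 + reg rC)) <|
  .seq (.store bInc (reg rP) (.const 0)) <|
  .cond (ltT (reg rC) (.load bDeg (reg rY)))
    (.seq (.store bMissList (reg rY * par 2 + .load bMissCnt (reg rY)) (reg rC)) <|
      .seq (.store bMissPos (reg rP) (.load bMissCnt (reg rY))) <|
      .store bMissCnt (reg rY) (.load bMissCnt (reg rY) + .const 1))
    .skip

/-- Delete the color `rC` of the edge `rE` from the list of missing colors of the vertex `rY`. -/
def delRow : Prog :=
  .seq (setReg rP (reg rY * par 2 + reg rC)) <|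
  .seq (.store bInc (reg rP) (reg rE + .const 1)) <|
  .cond (ltT (reg rC) (.load bDeg (reg rY)))
    (.seq (.store bMissCnt (reg rY) (.load bMissCnt (reg rY) - .const 1)) <|
      .seq (setReg rZ (.load bMissList (reg rY * par 2 + .load bMissCnt (reg rY)))) <|
      .seq (setReg rQ (.load bMissPos (reg rP))) <|
      .seq (.store bMissList (reg rY * par 2 + reg rQ) (reg rZ))
        (.store bMissPos (reg rY * par 2 + reg rZ) (reg rQ)))
    .skip

variable {I : Net} {w : ℕ} {σ : Mem}

theorem Fits.const (h : Fits I w) {k : ℕ} (hk : k < 40000) : k < 2 ^ w := by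
  unfold Fits at h; omega

theorem Fits.index (h : Fits I w) {u c : ℕ} (hu : u < I.n) (hc : c < I.Δ) :
    u * I.Δ + c < 2 ^ w := by
  have := index_lt hu hc
  unfold Fits at h; omega

theorem Fits.index' (h : Fits I w) {u : ℕ} (hu : u < I.n) : u * I.Δ < 2 ^ w := by
  have : u * I.Δ ≤ I.n * I.Δ := Nat.mul_le_mul_right _ hu.le
  unfold Fits at h; omega

theorem val_index (hf : Fits I w) (hb : σ 0 2 = I.Δ) {s t : WTerm} {u c : ℕ}
    (hs : s.val w σ = u) (ht : t.val w σ = c) (hu : u < I.n) (hc : c < I.Δ) :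
    (s * par 2 + t).val w σ = u * I.Δ + c := by
  refine val_add (val_mul hs ?_ (hf.index' hu)) ht (hf.index hu hc)
  rw [val_par (hf.const (by omega)), hb]

/-- All rows of the data structure are intact. -/
def Rows (I : Net) (σ : Mem) : Prop :=
  ∀ u < I.n, Row I.Δ (I.deg u) u (σ 4) (σ 5) (σ 6) (σ 7)

theorem update_index_of_ne {f : ℕ → ℕ} {Δ y u c c' v : ℕ} (hu : u ≠ y) (hc : c < Δ)
    (hc' : c' < Δ) : Function.update f (y * Δ + c) v (u * Δ + c') = f (u * Δ + c') :=
  Function.update_of_ne (fun e => hu (index_inj hc' hc e).1) _ _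

theorem ex_insRow (hf : Fits I w) (hb : Base I σ) (hrow : Rows I σ) {y c : ℕ}
    (hy : σ rY 0 = y) (hc : σ rC 0 = c) (hyn : y < I.n) (hcΔ : c < I.Δ)
    (hne : σ 4 (y * I.Δ + c) ≠ 0) :
    Ex w insRow σ insRow.cost fun σ' =>
      Rows I σ' ∧ σ' 4 = Function.update (σ 4) (y * I.Δ + c) 0 ∧ Same [4, 5, 6, 7, rP] σ σ' := by
  have hcnt := (hrow y hyn).cnt_lt hcΔ hne
  have hw := hf.one_lt
  simp only [rY, rC] at hy hc
  refine Ex.seq (Ex.setReg (v := y * I.Δ + c) ?_ ?_)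
  · exact val_index hf hb.num_colors (by rw [val_reg, hy]) (by rw [val_reg, hc]) hyn hcΔ
  refine Ex.seq (Ex.store (i := y * I.Δ + c) (v := 0) ?_ (val_const (hf.const (by omega))) ?_)
  · rw [val_reg]; simp [set_bank]
  -- `Prog.cost` charges a conditional for both branches; the `1` is the `skip` branch.
  refine (Ex.cond (k := _ + 1) (fun ht => ?_) (fun ht => ?_)).mono le_rfl fun _ h => h
  · rw [val_lt hw (val_reg _) (val_load (val_reg _))] at ht
    simp only [set_bank, rC, rP, bInc, bDeg, rY] at ht
    simp only [Nat.reduceEqDiff, if_false, hc, hy, hb.deg y hyn] at ht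
    have hd : c < I.deg y := by
      by_contra hcon
      simp [hcon] at ht
    refine Ex.mono ?_ (Nat.le_add_right _ _) fun _ h => h
    refine Ex.seq (Ex.store (i := y * I.Δ + σ 5 y) (v := c) ?_ ?_ ?_)
    · refine val_index hf ?_ ?_ ?_ hyn hcnt
      · simp [set_bank, hb.num_colors]
      · rw [val_reg]; simp [set_bank, hy]
      · rw [val_load (val_reg _)]; simp [set_bank, hy]
    · rw [val_reg]; simp [set_bank, hc]
    refine Ex.seq (Ex.store (i := y * I.Δ + c) (v := σ 5 y) ?_ ?_ ?_)
    · rw [val_reg]; simp [set_bank]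
    · rw [val_load (val_reg _)]; simp [set_bank, hy]
    refine Ex.store (i := y) (v := σ 5 y + 1) ?_ ?_ ?_
    · rw [val_reg]; simp [set_bank, hy]
    · refine val_add ?_ (val_const hw) ?_
      · rw [val_load (val_reg _)]; simp [set_bank, hy]
      · have := hf.index hyn hcnt
        have := hf
        have : I.Δ ≤ I.n * I.Δ := Nat.le_mul_of_pos_left _ (by omega)
        unfold Fits at hf
        omega
    · refine ⟨fun u hu => ?_, ?_, ?_⟩
      · by_cases huy : u = y
        · subst huy
          simpa [set_bank] using (hrow u hu).insert hcΔ hd hne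
        · refine (hrow u hu).congr ?_ ?_ ?_ ?_
          · intro c' hc'
            simp [set_bank, update_index_of_ne huy hcΔ hc']
          · simp [set_bank, huy]
          · intro c' hc'
            simp [set_bank, update_index_of_ne huy hcnt hc']
          · intro c' hc'
            simp [set_bank, update_index_of_ne huy hcΔ hc']
      · simp [set_bank]
      · refine Same.set (Same.set (Same.set (Same.set (Same.set (Same.refl _ _) ?_ _ _)
          ?_ _ _) ?_ _ _) ?_ _ _) ?_ _ _ <;> simp
  · rw [val_lt hw (val_reg _) (val_load (val_reg _))] at ht
    simp only [set_bank, rC, rP, bInc, bDeg, rY] at ht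
    simp only [Nat.reduceEqDiff, if_false, hc, hy, hb.deg y hyn] at ht
    have hd : ¬ c < I.deg y := by
      intro hcon
      simp [hcon] at ht
    refine (Ex.skip ?_).mono (Nat.le_add_left _ _) fun _ h => h
    refine ⟨fun u hu => ?_, ?_, ?_⟩
    · by_cases huy : u = y
      · subst huy
        simpa [set_bank] using (hrow u hu).update_of_not_lt hd 0
      · refine (hrow u hu).congr ?_ ?_ ?_ ?_
        · intro c' hc'
          simp [set_bank, update_index_of_ne huy hcΔ hc']
        · simp [set_bank]
        · intro c' hc'
          simp [set_bank]
        · intro c' hc'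
          simp [set_bank]
    · simp [set_bank]
    · refine Same.set (Same.set (Same.refl _ _) ?_ _ _) ?_ _ _ <;> simp

end EdgeColor

namespace EdgeColor

open WordRAM

variable {I : Net} {w : ℕ} {σ : Mem}

theorem ex_delRow (hf : Fits I w) (hb : Base I σ) (hrow : Rows I σ) {y c e : ℕ}
    (hy : σ rY 0 = y) (hc : σ rC 0 = c) (he : σ rE 0 = e) (hyn : y < I.n) (hcΔ : c < I.Δ)
    (hem : e < I.m) (h0 : σ 4 (y * I.Δ + c) = 0) :
    Ex w delRow σ delRow.cost fun σ' =>
      Rows I σ' ∧ σ' 4 = Function.update (σ 4) (y * I.Δ + c) (e + 1) ∧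
        Same [4, 5, 6, 7, rP, rQ, rZ] σ σ' := by
  have hw := hf.one_lt
  have hr := hrow y hyn
  have hΔw : I.Δ < 2 ^ w := by
    have : I.Δ ≤ I.n * I.Δ := Nat.le_mul_of_pos_left _ (by omega)
    unfold Fits at hf
    omega
  simp only [rY, rC, rE] at hy hc he
  refine Ex.seq (Ex.setReg (v := y * I.Δ + c) ?_ ?_)
  · exact val_index hf hb.num_colors (by rw [val_reg, hy]) (by rw [val_reg, hc]) hyn hcΔ
  refine Ex.seq (Ex.store (i := y * I.Δ + c) (v := e + 1) ?_ (val_add ?_ (val_const hw) ?_) ?_)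
  · rw [val_reg]; simp [set_bank]
  · rw [val_reg]; simp [set_bank, he]
  · unfold Fits at hf; omega
  refine (Ex.cond (k := _ + 1) (fun ht => ?_) (fun ht => ?_)).mono le_rfl fun _ h => h
  · rw [val_lt hw (val_reg _) (val_load (val_reg _))] at ht
    simp only [set_bank, rC, rP, bInc, bDeg, rY] at ht
    simp only [Nat.reduceEqDiff, if_false, hc, hy, hb.deg y hyn] at ht
    have hd : c < I.deg y := by
      by_contra hcon
      simp [hcon] at ht
    have hcp := hr.cnt_pos hcΔ hd h0
    have hcl := hr.cnt_le
    have hq := hr.pos_lt hcΔ hd h0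
    have hz := hr.lst_lt (j := σ 5 y - 1) (by omega)
    refine Ex.mono ?_ (Nat.le_add_right _ _) fun _ h => h
    refine Ex.seq (Ex.store (i := y) (v := σ 5 y - 1) ?_ (val_sub ?_ (val_const hw) ?_) ?_)
    · rw [val_reg]; simp [set_bank, hy]
    · rw [val_load (val_reg _)]; simp [set_bank, hy]
    · omega
    refine Ex.seq (Ex.setReg (v := σ 6 (y * I.Δ + (σ 5 y - 1))) ?_ ?_)
    · rw [val_load (val_index hf (u := y) (c := σ 5 y - 1) ?_ ?_ ?_ hyn (by omega))]
      · simp [set_bank]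
      · simp [set_bank, hb.num_colors]
      · rw [val_reg]; simp [set_bank, hy]
      · rw [val_load (val_reg _)]; simp [set_bank, hy]
    refine Ex.seq (Ex.setReg (v := σ 7 (y * I.Δ + c)) ?_ ?_)
    · rw [val_load (val_reg _)]; simp [set_bank]
    refine Ex.seq (Ex.store (i := y * I.Δ + σ 7 (y * I.Δ + c))
      (v := σ 6 (y * I.Δ + (σ 5 y - 1))) ?_ ?_ ?_)
    · refine val_index hf ?_ ?_ ?_ hyn (by omega)
      · simp [set_bank, hb.num_colors]
      · rw [val_reg]; simp [set_bank, hy]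
      · rw [val_reg]; simp [set_bank]
    · rw [val_reg]; simp [set_bank]
    refine Ex.store (i := y * I.Δ + σ 6 (y * I.Δ + (σ 5 y - 1)))
      (v := σ 7 (y * I.Δ + c)) ?_ ?_ ?_
    · refine val_index hf ?_ ?_ ?_ hyn hz
      · simp [set_bank, hb.num_colors]
      · rw [val_reg]; simp [set_bank, hy]
      · rw [val_reg]; simp [set_bank]
    · rw [val_reg]; simp [set_bank]
    · refine ⟨fun u hu => ?_, ?_, ?_⟩
      · by_cases huy : u = y
        · subst huy
          simpa [set_bank] using hr.delete hcΔ hd h0 (Nat.succ_ne_zero e)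
        · refine (hrow u hu).congr ?_ ?_ ?_ ?_
          · intro c' hc'
            simp [set_bank, update_index_of_ne huy hcΔ hc']
          · simp [set_bank, huy]
          · intro c' hc'
            simp [set_bank, update_index_of_ne huy (hq.1.trans_le hcl) hc']
          · intro c' hc'
            simp [set_bank, update_index_of_ne huy hz hc']
      · simp [set_bank]
      · refine Same.set (Same.set (Same.set (Same.set (Same.set (Same.set (Same.set
          (Same.refl _ _) ?_ _ _) ?_ _ _) ?_ _ _) ?_ _ _) ?_ _ _) ?_ _ _) ?_ _ _ <;> simp
  · rw [val_lt hw (val_reg _) (val_load (val_reg _))] at ht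
    simp only [set_bank, rC, rP, bInc, bDeg, rY] at ht
    simp only [Nat.reduceEqDiff, if_false, hc, hy, hb.deg y hyn] at ht
    have hd : ¬ c < I.deg y := by
      intro hcon
      simp [hcon] at ht
    refine (Ex.skip ?_).mono (Nat.le_add_left _ _) fun _ h => h
    refine ⟨fun u hu => ?_, ?_, ?_⟩
    · by_cases huy : u = y
      · subst huy
        simpa [set_bank] using hr.update_of_not_lt hd (e + 1)
      · refine (hrow u hu).congr ?_ ?_ ?_ ?_
        · intro c' hc'
          simp [set_bank, update_index_of_ne huy hcΔ hc']
        · simp [set_bank]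
        · intro c' hc'
          simp [set_bank]
        · intro c' hc'
          simp [set_bank]
    · simp [set_bank]
    · refine Same.set (Same.set (Same.refl _ _) ?_ _ _) ?_ _ _ <;> simp

/-- Remove the color of the edge `rE`. -/
def uncolorEdge : Prog :=
  .seq (setReg rC (.load bCol (reg rE) - .const 1)) <|
  .seq (setReg rY (.load bFst (reg rE))) <|
  .seq insRow <|
  .seq (setReg rY (.load bSnd (reg rE))) <|
  .seq insRow (.store bCol (reg rE) (.const 0))

/-- Give the color `rC` to the edge `rE`. -/
def colorEdge : Prog :=
  .seq (.store bCol (reg rE) (reg rC + .const 1)) <|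
  .seq (setReg rY (.load bFst (reg rE))) <|
  .seq delRow <|
  .seq (setReg rY (.load bSnd (reg rE))) delRow

theorem DS.uncolor {σ' : Mem} {e c : ℕ} (h : DS I σ) (he : e < I.m) (hec : σ 3 e = c + 1)
    (hrow : Rows I σ') (h3 : σ' 3 = Function.update (σ 3) e 0)
    (h4 : σ' 4 = Function.update (Function.update (σ 4) (I.fst e * I.Δ + c) 0)
      (I.snd e * I.Δ + c) 0) : DS I σ' := by
  have hcΔ : c < I.Δ := by have := h.le e he; omega
  have hp := h.proper
  refine ⟨fun i hi => ?_, fun u c' i hc' hi hiu hic => ?_, fun u hu c' hc' hm => ?_, hrow⟩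
  · rw [h3, Function.update_apply]
    split_ifs
    · exact Nat.zero_le _
    · exact h.le i hi
  · rw [h3, Function.update_apply] at hic
    by_cases hie : i = e
    · simp [hie] at hic
    rw [if_neg hie] at hic
    -- By properness no other edge of color `c` meets `e`, so the two cleared entries are not needed
    -- for any remaining edge.
    have key : ∀ x, I.Inc e x → u * I.Δ + c' ≠ x * I.Δ + c := by
      intro x hx hidx
      obtain ⟨rfl, rfl⟩ := index_inj hc' hcΔ hidx
      exact hie (hp i hi e he u hiu hx (by rw [hic, hec]) (by omega))
    rw [h4, Function.update_of_ne (key _ (Or.inr rfl)), Function.update_of_ne (key _ (Or.inl rfl))]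
    exact h.inc_some u c' i hc' hi hiu hic
  · rw [h4, Function.update_apply, Function.update_apply]
    split_ifs with h₁ h₂
    · rfl
    · rfl
    · refine h.inc_none u hu c' hc' fun i hi hiu hic => ?_
      by_cases hie : i = e
      · subst hie
        have : c' = c := by omega
        subst this
        rcases hiu with rfl | rfl
        · exact h₂ rfl
        · exact h₁ rfl
      · refine hm i hi hiu ?_
        rw [h3, Function.update_of_ne hie, hic]

theorem DS.color {σ' : Mem} {e c : ℕ} (h : DS I σ) (he : e < I.m) (hcΔ : c < I.Δ)
    (hec : σ 3 e = 0) (hmf : I.Misses (σ 3) (I.fst e) c) (hms : I.Misses (σ 3) (I.snd e) c)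
    (hrow : Rows I σ') (h3 : σ' 3 = Function.update (σ 3) e (c + 1))
    (h4 : σ' 4 = Function.update (Function.update (σ 4) (I.fst e * I.Δ + c) (e + 1))
      (I.snd e * I.Δ + c) (e + 1)) : DS I σ' := by
  refine ⟨fun i hi => ?_, fun u c' i hc' hi hiu hic => ?_, fun u hu c' hc' hm => ?_, hrow⟩
  · rw [h3, Function.update_apply]
    split_ifs
    · exact hcΔ
    · exact h.le i hi
  · rw [h3, Function.update_apply] at hic
    by_cases hie : i = e
    · subst hie
      rw [if_pos rfl] at hic
      have : c' = c := by omega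
      subst this
      rw [h4, Function.update_apply, Function.update_apply]
      rcases hiu with rfl | rfl <;> simp
    · rw [if_neg hie] at hic
      have key : ∀ x, I.Misses (σ 3) x c → u * I.Δ + c' ≠ x * I.Δ + c := by
        intro x hx hidx
        obtain ⟨rfl, rfl⟩ := index_inj hc' hcΔ hidx
        exact hx i hi hiu hic
      rw [h4, Function.update_of_ne (key _ hms), Function.update_of_ne (key _ hmf)]
      exact h.inc_some u c' i hc' hi hiu hic
  · have key : ∀ x, I.Inc e x → u * I.Δ + c' ≠ x * I.Δ + c := by
      intro x hx hidx
      obtain ⟨rfl, rfl⟩ := index_inj hc' hcΔ hidx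
      exact hm e he hx (by rw [h3, Function.update_self])
    rw [h4, Function.update_of_ne (key _ (Or.inr rfl)), Function.update_of_ne (key _ (Or.inl rfl))]
    refine h.inc_none u hu c' hc' fun i hi hiu hic => ?_
    by_cases hie : i = e
    · subst hie; omega
    · exact hm i hi hiu (by rw [h3, Function.update_of_ne hie, hic])

theorem ex_uncolorEdge (hf : Fits I w) (hb : Base I σ) (h : DS I σ) {e c : ℕ}
    (he : σ rE 0 = e) (hem : e < I.m) (hec : σ 3 e = c + 1) :
    Ex w uncolorEdge σ uncolorEdge.cost fun σ' =>
      DS I σ' ∧ σ' 3 = Function.update (σ 3) e 0 ∧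
        Same [3, 4, 5, 6, 7, rC, rY, rP] σ σ' := by
  have hw := hf.one_lt
  have hcΔ : c < I.Δ := by have := h.le e hem; omega
  have hne : I.fst e ≠ I.snd e := fun e' => I.side_ne e hem (by rw [e'])
  simp only [rE] at he
  refine Ex.seq (Ex.setReg (v := c) ?_ ?_)
  · rw [val_sub (x := c + 1) (y := 1) ?_ (val_const hw) ?_]
    · simp
    · rw [val_load (val_reg _)]; simp [he, hec]
    · have := h.le e hem
      have : I.Δ ≤ I.m := I.Δ_le
      unfold Fits at hf; omega
  refine Ex.seq (Ex.setReg (v := I.fst e) ?_ ?_)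
  · rw [val_load (val_reg _)]; simp [set_bank, he, hb.fst e hem]
  set σ₁ := (σ.set rC 0 c).set rY 0 (I.fst e) with hσ₁
  have s₁ : Same [rC, rY] σ σ₁ := ((Same.refl _ _).set (by simp) _ _).set (by simp) _ _
  have b₁ : Base I σ₁ := hb.congr s₁ (by simp)
  have d₁ : DS I σ₁ := h.congr s₁ (by simp)
  refine Ex.seq ((ex_insRow hf b₁ d₁.row (y := I.fst e) (c := c) (by simp [hσ₁, set_bank])
    (by simp [hσ₁, set_bank]) (I.fst_lt e hem) hcΔ ?_).mono le_rfl ?_)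
  · rw [s₁ 4 (by simp), h.inc_some _ c e hcΔ hem (Or.inl rfl) hec]; omega
  rintro σ₂ ⟨r₂, h₂, s₂⟩
  have e₂ : σ₂ rE 0 = e := by
    rw [s₂ rE (by simp), s₁ rE (by simp)]; exact he
  have b₂ : Base I σ₂ := b₁.congr s₂ (by simp)
  refine Ex.seq (Ex.setReg (v := I.snd e) ?_ ?_)
  · rw [val_load (val_reg _), e₂]; exact b₂.snd e hem
  set σ₃ := σ₂.set rY 0 (I.snd e) with hσ₃
  have s₃ : Same [rY] σ₂ σ₃ := (Same.refl _ _).set (by simp) _ _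
  have b₃ : Base I σ₃ := b₂.congr s₃ (by simp)
  have r₃ : Rows I σ₃ := by
    intro u hu
    rw [s₃ 4 (by simp), s₃ 5 (by simp), s₃ 6 (by simp), s₃ 7 (by simp)]
    exact r₂ u hu
  have s₀₃ := (s₁.trans s₂).trans s₃
  refine Ex.seq ((ex_insRow hf b₃ r₃ (y := I.snd e) (c := c) (by simp [hσ₃, set_bank])
    ?_ (I.snd_lt e hem) hcΔ ?_).mono le_rfl ?_)
  · rw [s₃ rC (by simp), s₂ rC (by simp)]; simp [hσ₁, set_bank]
  -- The endpoints are distinct, so clearing the entry of the first one has not touched that of the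
  -- second.
  · rw [s₃ 4 (by simp), h₂, update_index_of_ne hne.symm hcΔ hcΔ, s₁ 4 (by simp),
      h.inc_some _ c e hcΔ hem (Or.inr rfl) hec]
    omega
  rintro σ₄ ⟨r₄, h₄, s₄⟩
  have s₀₄ := s₀₃.trans s₄
  have e₄ : σ₄ rE 0 = e := by rw [s₀₄ rE (by simp)]; exact he
  refine Ex.store (i := e) (v := 0) (by rw [val_reg, e₄]) (val_const (by omega)) ?_
  have h3 : (σ₄.set bCol e 0) 3 = Function.update (σ 3) e 0 := by
    rw [set_bank, if_pos rfl, s₀₄ bCol (by simp)]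
  refine ⟨h.uncolor hem hec ?_ h3 ?_, h3, ?_⟩
  · intro u hu
    simpa [set_bank] using r₄ u hu
  · rw [set_bank, if_neg (by simp), h₄, s₃ 4 (by simp), h₂, s₁ 4 (by simp)]
  · exact (s₀₄.mono (by simp)).set (by simp) _ _

theorem ex_colorEdge (hf : Fits I w) (hb : Base I σ) (h : DS I σ) {e c : ℕ}
    (he : σ rE 0 = e) (hc : σ rC 0 = c) (hem : e < I.m) (hcΔ : c < I.Δ) (hec : σ 3 e = 0)
    (hmf : I.Misses (σ 3) (I.fst e) c) (hms : I.Misses (σ 3) (I.snd e) c) :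
    Ex w colorEdge σ colorEdge.cost fun σ' =>
      DS I σ' ∧ σ' 3 = Function.update (σ 3) e (c + 1) ∧
        Same [3, 4, 5, 6, 7, rY, rP, rQ, rZ] σ σ' := by
  have hw := hf.one_lt
  have hne : I.fst e ≠ I.snd e := fun e' => I.side_ne e hem (by rw [e'])
  simp only [rE, rC] at he hc
  refine Ex.seq (Ex.store (i := e) (v := c + 1) (by rw [val_reg, he])
    (val_add (by rw [val_reg, hc]) (val_const hw) ?_) ?_)
  · have : I.Δ ≤ I.m := I.Δ_le
    unfold Fits at hf; omega
  refine Ex.seq (Ex.setReg (v := I.fst e) ?_ ?_)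
  · rw [val_load (val_reg _)]; simp [set_bank, he, hb.fst e hem]
  set σ₁ := (σ.set bCol e (c + 1)).set rY 0 (I.fst e) with hσ₁
  have s₁ : Same [3, rY] σ σ₁ := ((Same.refl _ _).set (by simp) _ _).set (by simp) _ _
  have b₁ : Base I σ₁ := hb.congr s₁ (by simp)
  have r₁ : Rows I σ₁ := by
    intro u hu
    rw [s₁ 4 (by simp), s₁ 5 (by simp), s₁ 6 (by simp), s₁ 7 (by simp)]
    exact h.row u hu
  refine Ex.seq ((ex_delRow hf b₁ r₁ (y := I.fst e) (c := c) (e := e) (by simp [hσ₁, set_bank])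
    (by simp [hσ₁, set_bank, hc]) (by simp [hσ₁, set_bank, he]) (I.fst_lt e hem) hcΔ hem
    ?_).mono le_rfl ?_)
  · rw [s₁ 4 (by simp), h.inc_none _ (I.fst_lt e hem) _ hcΔ hmf]
  rintro σ₂ ⟨r₂, h₂, s₂⟩
  have e₂ : σ₂ rE 0 = e := by
    rw [s₂ rE (by simp), s₁ rE (by simp)]; exact he
  have b₂ : Base I σ₂ := b₁.congr s₂ (by simp)
  refine Ex.seq (Ex.setReg (v := I.snd e) ?_ ?_)
  · rw [val_load (val_reg _), e₂]; exact b₂.snd e hem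
  set σ₃ := σ₂.set rY 0 (I.snd e) with hσ₃
  have s₃ : Same [rY] σ₂ σ₃ := (Same.refl _ _).set (by simp) _ _
  have b₃ : Base I σ₃ := b₂.congr s₃ (by simp)
  have r₃ : Rows I σ₃ := by
    intro u hu
    rw [s₃ 4 (by simp), s₃ 5 (by simp), s₃ 6 (by simp), s₃ 7 (by simp)]
    exact r₂ u hu
  have s₀₃ := (s₁.trans s₂).trans s₃
  refine (ex_delRow hf b₃ r₃ (y := I.snd e) (c := c) (e := e) (by simp [hσ₃, set_bank])
    ?_ ?_ (I.snd_lt e hem) hcΔ hem ?_).mono le_rfl ?_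
  · rw [s₀₃ rC (by simp)]; exact hc
  · rw [s₀₃ rE (by simp)]; exact he
  · rw [s₃ 4 (by simp), h₂, update_index_of_ne hne.symm hcΔ hcΔ, s₁ 4 (by simp),
      h.inc_none _ (I.snd_lt e hem) _ hcΔ hms]
  rintro σ₄ ⟨r₄, h₄, s₄⟩
  have h3 : σ₄ 3 = Function.update (σ 3) e (c + 1) := by
    rw [s₄ 3 (by simp), s₃ 3 (by simp), s₂ 3 (by simp)]
    simp [hσ₁, set_bank]
  refine ⟨h.color hem hcΔ hec hmf hms r₄ h3 ?_, h3, ?_⟩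
  · rw [h₄, s₃ 4 (by simp), h₂, s₁ 4 (by simp)]
  · exact (s₀₃.trans s₄).mono (by simp)

/-! ### Recoloring the recorded edges -/

/-- Remove the colors of all recorded edges. -/
def uncolorRec : Prog :=
  .seq (setReg rJ (.const 0)) <|
  .loop (ltT (reg rJ) (reg rK)) <|
    .seq (setReg rE (.load aEdge (reg rJ))) <|
    .seq (.cond (.load bCol (reg rE)) uncolorEdge .skip) <|
    setReg rJ (reg rJ + .const 1)

/-- Give their new colors to all recorded edges. -/
def colorRec : Prog :=
  .seq (setReg rJ (.const 0)) <|
  .loop (ltT (reg rJ) (reg rK)) <|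
    .seq (setReg rE (.load aEdge (reg rJ))) <|
    .seq (.cond (.load bCol (reg rE)) .skip
      (.seq (setReg rC (.load aColor (reg rJ))) colorEdge)) <|
    setReg rJ (reg rJ + .const 1)

/-- Recolor all recorded edges. -/
def applyRec : Prog := .seq uncolorRec colorRec

theorem ex_uncolorRec (hf : Fits I w) (hb : Base I σ) (h : DS I σ) {K : ℕ} (hK : σ rK 0 = K)
    (hKw : K < 2 ^ w) (hes : ∀ j < K, σ aEdge j < I.m) :
    Ex w uncolorRec σ ((K + 1) * 300) fun σ' =>
      DS I σ' ∧ (∀ i, (∃ j < K, σ aEdge j = i) → σ' 3 i = 0) ∧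
        (∀ i, (¬ ∃ j < K, σ aEdge j = i) → σ' 3 i = σ 3 i) ∧
        Same [3, 4, 5, 6, 7, rE, rJ, rC, rY, rP] σ σ' := by
  have hw := hf.one_lt
  simp only [aEdge] at hes ⊢
  refine Ex.mono (k := (2 + 1) + (K * ((ltT (reg rJ) (reg rK)).size + 280) +
    (ltT (reg rJ) (reg rK)).size)) (Ex.seq (Ex.setReg (val_const (by omega)) ?_))
    (by change _ + (K * (5 + 280) + 5) ≤ _; omega) fun _ h => h
  refine (Ex.loop (r := K) (kb := 280) (fun r σ' => ∃ j, j + r = K ∧ σ' rJ 0 = j ∧ DS I σ' ∧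
      (∀ i, (∃ p < j, σ aEdge p = i) → σ' 3 i = 0) ∧
      (∀ i, (¬ ∃ p < j, σ aEdge p = i) → σ' 3 i = σ 3 i) ∧
      Same [3, 4, 5, 6, 7, rE, rJ, rC, rY, rP] σ σ') ?_ ?_).mono le_rfl ?_
  · rintro r σ₁ ⟨j, hj, hJ, hd, hz, hs, hsame⟩ hg
    have hK₁ : σ₁ rK 0 = K := by rw [hsame rK (by simp), hK]
    rw [val_lt hw (val_reg _) (val_reg _), hJ, hK₁] at hg
    have hjK : j < K := by
      by_contra hcon
      simp [hcon] at hg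
    refine ⟨r - 1, by omega, ?_⟩
    have hb₁ : Base I σ₁ := hb.congr hsame (by simp)
    have hej := hes j hjK
    refine Ex.mono (k := (2 + 2 + 1) + ((1 + 3 + (uncolorEdge.cost + 1)) + (2 + 4))) ?_
      (by decide) fun _ h => h
    refine Ex.seq (Ex.mono (Ex.setReg (v := σ 33 j) ?_ ?_) (by decide) fun _ h => h)
    · rw [val_load (val_reg _), hJ, hsame aEdge (by simp)]
    set σ₂ := σ₁.set rE 0 (σ 33 j) with hσ₂
    have s₂ : Same [rE] σ₁ σ₂ := (Same.refl _ _).set (by simp) _ _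
    have he₂ : σ₂ rE 0 = σ 33 j := by simp [hσ₂, set_bank]
    have hd₂ : DS I σ₂ := hd.congr s₂ (by simp)
    have hb₂ : Base I σ₂ := hb₁.congr s₂ (by simp)
    refine Ex.seq ((Ex.cond (Q := fun σ₃ => DS I σ₃ ∧ σ₃ 3 = Function.update (σ₁ 3) (σ 33 j) 0 ∧
      Same [3, 4, 5, 6, 7, rC, rY, rP] σ₂ σ₃) (fun ht => ?_) (fun ht => ?_)).mono le_rfl ?_)
    · rw [val_load (val_reg _), he₂] at ht
      obtain ⟨c, hc⟩ : ∃ c, σ₂ 3 (σ 33 j) = c + 1 := ⟨σ₂ 3 (σ 33 j) - 1, by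
        simp only [bCol] at ht; omega⟩
      refine (ex_uncolorEdge hf hb₂ hd₂ he₂ hej hc).mono (by omega) fun σ₃ h₃ => ?_
      rw [s₂ 3 (by simp)] at h₃
      exact h₃
    · rw [val_load (val_reg _), he₂] at ht
      refine (Ex.skip ⟨hd₂, ?_, Same.refl _ _⟩).mono (by omega) fun _ h => h
      rw [s₂ 3 (by simp)]
      rw [s₂ bCol (by simp)] at ht
      exact (Function.update_eq_self_iff.2 ht.symm).symm
    · rintro σ₃ ⟨hd₃, h3, s₃⟩
      have hJ₃ : σ₃ rJ 0 = j := by rw [s₃ rJ (by simp), s₂ rJ (by simp), hJ]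
      refine (Ex.setReg (v := j + 1) (val_add (by rw [val_reg, hJ₃]) (val_const hw) (by omega))
        ?_).mono (by decide) fun _ h => h
      refine ⟨j + 1, by omega, by simp [set_bank],
        hd₃.congr (bs := [rJ]) ((Same.refl _ _).set (by simp) _ _) (by simp), ?_, ?_, ?_⟩
      · rintro i ⟨p, hp, hpi⟩
        rw [set_bank, if_neg (by simp), h3, Function.update_apply]
        split_ifs with hi
        · rfl
        · refine hz i ⟨p, ?_, hpi⟩
          rcases Nat.lt_succ_iff_lt_or_eq.1 hp with hlt | rfl
          · exact hlt
          · exact absurd hpi.symm hi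
      · intro i hi
        rw [set_bank, if_neg (by simp), h3, Function.update_of_ne]
        · exact hs i fun ⟨p, hp, hpi⟩ => hi ⟨p, by omega, hpi⟩
        · rintro rfl
          exact hi ⟨j, by omega, rfl⟩
      · exact (((hsame.trans s₂).trans s₃).mono (by simp)).set (by simp) _ _
  · refine ⟨0, by omega, by simp [set_bank],
      h.congr (bs := [rJ]) ((Same.refl _ _).set (by simp) _ _) (by simp), by simp, ?_, ?_⟩
    · intro i _
      simp [set_bank]
    · exact (Same.refl _ _).set (by simp) _ _
  · rintro σ' ⟨⟨r, j, hj, hJ, hd, hz, hs, hsame⟩, hg⟩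
    have hK₁ : σ' rK 0 = K := by rw [hsame rK (by simp), hK]
    rw [val_lt hw (val_reg _) (val_reg _), hJ, hK₁] at hg
    have hjK : ¬ j < K := by
      intro hcon
      simp [hcon] at hg
    obtain rfl : j = K := by omega
    exact ⟨hd, hz, hs, hsame⟩

theorem ex_colorRec (hf : Fits I w) (hb : Base I σ) (h : DS I σ) {K : ℕ} (hK : σ rK 0 = K)
    (hKw : K < 2 ^ w) (hes : ∀ j < K, σ aEdge j < I.m) (hcs : ∀ j < K, σ aColor j < I.Δ)
    {col : ℕ → ℕ} (hcol : I.Proper col) (hrec : ∀ j < K, col (σ aEdge j) = σ aColor j + 1)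
    (hzero : ∀ i, (∃ j < K, σ aEdge j = i) → σ 3 i = 0)
    (hrest : ∀ i, (¬ ∃ j < K, σ aEdge j = i) → σ 3 i = col i) :
    Ex w colorRec σ ((K + 1) * 300) fun σ' =>
      DS I σ' ∧ σ' 3 = col ∧ Same [3, 4, 5, 6, 7, rE, rJ, rC, rY, rP, rQ, rZ] σ σ' := by
  have hw := hf.one_lt
  simp only [aEdge, aColor] at hes hcs hrec hzero hrest ⊢
  refine Ex.mono (k := (2 + 1) + (K * ((ltT (reg rJ) (reg rK)).size + 280) +
    (ltT (reg rJ) (reg rK)).size)) (Ex.seq (Ex.setReg (val_const (by omega)) ?_))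
    (by change _ + (K * (5 + 280) + 5) ≤ _; omega) fun _ h => h
  refine (Ex.loop (r := K) (kb := 280) (fun r σ' => ∃ j, j + r = K ∧ σ' rJ 0 = j ∧ DS I σ' ∧
      (∀ i, (∃ p < j, σ 33 p = i) → σ' 3 i = col i) ∧
      (∀ i, (¬ ∃ p < j, σ 33 p = i) → σ' 3 i = σ 3 i) ∧
      Same [3, 4, 5, 6, 7, rE, rJ, rC, rY, rP, rQ, rZ] σ σ') ?_ ?_).mono le_rfl ?_
  · rintro r σ₁ ⟨j, hj, hJ, hd, hz, hs, hsame⟩ hg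
    have hK₁ : σ₁ rK 0 = K := by rw [hsame rK (by simp), hK]
    rw [val_lt hw (val_reg _) (val_reg _), hJ, hK₁] at hg
    have hjK : j < K := by
      by_contra hcon
      simp [hcon] at hg
    refine ⟨r - 1, by omega, ?_⟩
    have hb₁ : Base I σ₁ := hb.congr hsame (by simp)
    have hej := hes j hjK
    refine Ex.mono (k := (2 + 2 + 1) + ((1 + 3 + ((2 + 3) + colorEdge.cost)) + (2 + 4))) ?_
      (by decide) fun _ h => h
    refine Ex.seq (Ex.mono (Ex.setReg (v := σ 33 j) ?_ ?_) (by decide) fun _ h => h)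
    · rw [val_load (val_reg _), hJ, hsame aEdge (by simp)]
    set σ₂ := σ₁.set rE 0 (σ 33 j) with hσ₂
    have s₂ : Same [rE] σ₁ σ₂ := (Same.refl _ _).set (by simp) _ _
    have he₂ : σ₂ rE 0 = σ 33 j := by simp [hσ₂, set_bank]
    have hd₂ : DS I σ₂ := hd.congr s₂ (by simp)
    have hb₂ : Base I σ₂ := hb₁.congr s₂ (by simp)
    have hJ₂ : σ₂ rJ 0 = j := by rw [s₂ rJ (by simp), hJ]
    -- The current coloring is a restriction of `col`. Hence properness of `col` alone makes the new
    -- color of the next edge available at both of its endpoints.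
    have hnz : ∀ i, σ₁ 3 i ≠ 0 → σ₁ 3 i = col i := by
      intro i hi
      by_cases h₁ : ∃ p < j, σ 33 p = i
      · exact hz i h₁
      · rw [hs i h₁] at hi ⊢
        by_cases h₂ : ∃ p < K, σ 33 p = i
        · exact absurd (hzero i h₂) hi
        · exact hrest i h₂
    refine Ex.seq ((Ex.cond (Q := fun σ₃ => DS I σ₃ ∧
      σ₃ 3 = Function.update (σ₁ 3) (σ 33 j) (col (σ 33 j)) ∧
      Same [3, 4, 5, 6, 7, rC, rY, rP, rQ, rZ] σ₂ σ₃) (fun ht => ?_) (fun ht => ?_)).mono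
        le_rfl ?_)
    · rw [val_load (val_reg _), he₂, s₂ bCol (by simp)] at ht
      refine (Ex.skip ⟨hd₂, ?_, Same.refl _ _⟩).mono (by omega) fun _ h => h
      rw [s₂ 3 (by simp)]
      exact (Function.update_eq_self_iff.2 (hnz _ ht).symm).symm
    · rw [val_load (val_reg _), he₂, s₂ bCol (by simp)] at ht
      refine Ex.seq ((Ex.setReg (v := σ 34 j) ?_ ?_).mono (by decide) fun _ h => h)
      · rw [val_load (val_reg _), hJ₂, s₂ aColor (by simp), hsame aColor (by simp)]
      set σ₃ := σ₂.set rC 0 (σ 34 j) with hσ₃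
      have s₃ : Same [rC] σ₂ σ₃ := (Same.refl _ _).set (by simp) _ _
      have h33 : σ₃ 3 = σ₁ 3 := by rw [s₃ 3 (by simp), s₂ 3 (by simp)]
      have hmiss : ∀ x, I.Inc (σ 33 j) x → I.Misses (σ₃ 3) x (σ 34 j) := by
        intro x hx i hi hix hic
        rw [h33] at hic
        have h₁ := hnz i (by omega)
        have : i = σ 33 j := hcol i hi _ hej x hix hx (by rw [hrec j hjK]; omega) (by omega)
        rw [this] at hic
        simp only [bCol] at ht
        omega
      refine (ex_colorEdge hf (hb₂.congr s₃ (by simp)) (hd₂.congr s₃ (by simp)) (e := σ 33 j)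
        (c := σ 34 j) (by rw [s₃ rE (by simp), he₂]) (by simp [hσ₃, set_bank]) hej (hcs j hjK)
        (by rw [h33]; exact ht) (hmiss _ (Or.inl rfl)) (hmiss _ (Or.inr rfl))).mono le_rfl ?_
      rintro σ₄ ⟨hd₄, h4, s₄⟩
      exact ⟨hd₄, by rw [h4, h33, hrec j hjK], (s₃.trans s₄).mono (by simp)⟩
    · rintro σ₃ ⟨hd₃, h3, s₃⟩
      have hJ₃ : σ₃ rJ 0 = j := by rw [s₃ rJ (by simp), hJ₂]
      refine (Ex.setReg (v := j + 1) (val_add (by rw [val_reg, hJ₃]) (val_const hw) (by omega))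
        ?_).mono (by decide) fun _ h => h
      refine ⟨j + 1, by omega, by simp [set_bank],
        hd₃.congr (bs := [rJ]) ((Same.refl _ _).set (by simp) _ _) (by simp), ?_, ?_, ?_⟩
      · rintro i ⟨p, hp, hpi⟩
        rw [set_bank, if_neg (by simp), h3, Function.update_apply]
        split_ifs with hi
        · rw [hi]
        · refine hz i ⟨p, ?_, hpi⟩
          rcases Nat.lt_succ_iff_lt_or_eq.1 hp with hlt | rfl
          · exact hlt
          · exact absurd hpi.symm hi
      · intro i hi
        rw [set_bank, if_neg (by simp), h3, Function.update_of_ne]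
        · exact hs i fun ⟨p, hp, hpi⟩ => hi ⟨p, by omega, hpi⟩
        · rintro rfl
          exact hi ⟨j, by omega, rfl⟩
      · exact (((hsame.trans s₂).trans s₃).mono (by simp)).set (by simp) _ _
  · refine ⟨0, by omega, by simp [set_bank],
      h.congr (bs := [rJ]) ((Same.refl _ _).set (by simp) _ _) (by simp), by simp, ?_, ?_⟩
    · intro i _
      simp [set_bank]
    · exact (Same.refl _ _).set (by simp) _ _
  · rintro σ' ⟨⟨r, j, hj, hJ, hd, hz, hs, hsame⟩, hg⟩
    have hK₁ : σ' rK 0 = K := by rw [hsame rK (by simp), hK]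
    rw [val_lt hw (val_reg _) (val_reg _), hJ, hK₁] at hg
    have hjK : ¬ j < K := by
      intro hcon
      simp [hcon] at hg
    obtain rfl : j = K := by omega
    refine ⟨hd, ?_, hsame⟩
    funext i
    by_cases hi : ∃ p < j, σ 33 p = i
    · exact hz i hi
    · rw [hs i hi, hrest i hi]

/-- Recoloring the edges one by one would pass through improper colorings, which the table cannot
hold. Erasing all of them beforehand makes every intermediate coloring a restriction of the old or
the new one. The tests for color `0` also allow uncolored and repeated entries in the record. -/
theorem ex_applyRec (hf : Fits I w) (hb : Base I σ) (h : DS I σ) {K : ℕ} (hK : σ rK 0 = K)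
    (hKw : K < 2 ^ w) (hes : ∀ j < K, σ aEdge j < I.m) (hcs : ∀ j < K, σ aColor j < I.Δ)
    {col : ℕ → ℕ} (hcol : I.Proper col) (hrec : ∀ j < K, col (σ aEdge j) = σ aColor j + 1)
    (hrest : ∀ i, (¬ ∃ j < K, σ aEdge j = i) → col i = σ 3 i) :
    Ex w applyRec σ ((K + 1) * 600) fun σ' =>
      DS I σ' ∧ σ' 3 = col ∧ Same [3, 4, 5, 6, 7, rE, rJ, rC, rY, rP, rQ, rZ] σ σ' := by
  refine Ex.mono (k := (K + 1) * 300 + (K + 1) * 300) (Ex.seq ?_) (by omega) fun _ h => h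
  refine (ex_uncolorRec hf hb h hK hKw hes).mono le_rfl ?_
  rintro σ₁ ⟨hd₁, hz, hs, s₁⟩
  have e₁ : σ₁ aEdge = σ aEdge := s₁ aEdge (by simp)
  have e₂ : σ₁ aColor = σ aColor := s₁ aColor (by simp)
  refine (ex_colorRec hf (hb.congr s₁ (by simp)) hd₁ (K := K) (by rw [s₁ rK (by simp), hK]) hKw
    (by rwa [e₁]) (by rwa [e₂]) hcol (by rwa [e₁, e₂]) (by rwa [e₁]) ?_).mono le_rfl ?_
  · rw [e₁]
    intro i hi
    rw [hs i hi, hrest i hi]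
  · rintro σ₂ ⟨hd₂, h3, s₂⟩
    exact ⟨hd₂, h3, (s₁.trans s₂).mono (by simp)⟩

end EdgeColor

/-! ### Tracing alternating walks in memory. -/

namespace EdgeColor

open WordRAM

/-- Current vertex of a walk. -/
@[simp] abbrev rX : ℕ := 20
/-- Color of the next edge of a walk. -/
@[simp] abbrev rT : ℕ := 21
/-- The other color of a walk. -/
@[simp] abbrev rS : ℕ := 22
/-- Bound for the number of recorded edges. -/
@[simp] abbrev rLim : ℕ := 32

/-- Follow the edges with the colors `rT, rS, rT, …` from the vertex `rX` and record them together
with the colors they get when the two colors are exchanged. -/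
def walk : Prog :=
  .loop (.load bInc (reg rX * par 2 + reg rT) * ltT (reg rK) (reg rLim)) <|
    .seq (setReg rE (.load bInc (reg rX * par 2 + reg rT) - .const 1)) <|
    .seq (.store aEdge (reg rK) (reg rE)) <|
    .seq (.store aColor (reg rK) (reg rS)) <|
    .seq (setReg rX (.load bFst (reg rE) + .load bSnd (reg rE) - reg rX)) <|
    .seq (setReg rC (reg rT)) <|
    .seq (setReg rT (reg rS)) <|
    .seq (setReg rS (reg rC)) <|
    setReg rK (reg rK + .const 1)

variable {I : Net} {w : ℕ} {σ : Mem}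

theorem alt_lt {t s b : ℕ} (ht : t < b) (hs : s < b) (j : ℕ) : alt t s j < b := by
  unfold alt; split_ifs <;> assumption

theorem Net.IsWalk.extend {col : ℕ → ℕ} {t s k : ℕ} {xs es : ℕ → ℕ}
    (h : I.IsWalk col t s xs es k) {e y : ℕ} (he : e < I.m) (hc : col e = alt t s k + 1)
    (hj : I.Joins e (xs k) y) :
    I.IsWalk col t s (Function.update xs (k + 1) y) (Function.update es k e) (k + 1) := by
  refine ⟨fun j hjk => ?_, fun j hjk => ?_, fun j hjk => ?_⟩ <;>
    rcases Nat.lt_succ_iff_lt_or_eq.1 hjk with hlt | rfl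
  · rw [Function.update_of_ne (by omega)]; exact h.edge_lt j hlt
  · rwa [Function.update_self]
  · rw [Function.update_of_ne (by omega)]; exact h.color j hlt
  · rwa [Function.update_self]
  · rw [Function.update_of_ne (by omega), Function.update_of_ne (by omega),
      Function.update_of_ne (by omega)]
    exact h.joins j hlt
  · rw [Function.update_self, Function.update_self, Function.update_of_ne (by omega)]
    exact hj

/-- The product serves as a conjunction: an edge of the required color exists and the cutoff is not
reached. -/
theorem val_walkGuard (hf : Fits I w) (hb : Base I σ) (h : DS I σ) {x t k l : ℕ}
    (hx : σ rX 0 = x) (ht : σ rT 0 = t) (hk : σ rK 0 = k) (hl : σ rLim 0 = l) (hxn : x < I.n)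
    (htΔ : t < I.Δ) :
    (WTerm.load bInc (reg rX * par 2 + reg rT) * ltT (reg rK) (reg rLim)).val w σ =
      σ 4 (x * I.Δ + t) * if k < l then 1 else 0 := by
  refine val_mul (val_load (val_index hf hb.num_colors (by rw [val_reg, hx])
    (by rw [val_reg, ht]) hxn htΔ)) (val_lt hf.one_lt (by rw [val_reg, hk])
      (by rw [val_reg, hl])) ?_
  have : σ 4 (x * I.Δ + t) ≤ I.m := by
    by_cases h0 : σ 4 (x * I.Δ + t) = 0
    · omega
    · obtain ⟨i, hi, -, -, he⟩ := h.exists_inc hxn htΔ h0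
      omega
  unfold Fits at hf
  split_ifs <;> omega

/-- The coloring itself is left alone; the edges and their exchanged colors are only recorded behind
the `k₀` entries already there. The alternative `k = l` is the cutoff, in which case the walk need
not be maximal. -/
theorem ex_walk (hf : Fits I w) (hb : Base I σ) (h : DS I σ) {y t s k₀ l : ℕ}
    (hx : σ rX 0 = y) (ht : σ rT 0 = t) (hs : σ rS 0 = s) (hk : σ rK 0 = k₀)
    (hl : σ rLim 0 = k₀ + l) (hw : k₀ + l < 2 ^ w) (hy : y < I.n) (htΔ : t < I.Δ)
    (hsΔ : s < I.Δ) :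
    Ex w walk σ ((l + 1) * 100) fun σ' => ∃ (xs es : ℕ → ℕ) (k : ℕ),
      xs 0 = y ∧ I.IsWalk (σ 3) t s xs es k ∧ k ≤ l ∧
      (I.Misses (σ 3) (xs k) (alt t s k) ∨ k = l) ∧ xs k < I.n ∧
      σ' rX 0 = xs k ∧ σ' rT 0 = alt t s k ∧ σ' rK 0 = k₀ + k ∧
      (∀ j < k, σ' aEdge (k₀ + j) = es j ∧ σ' aColor (k₀ + j) = alt t s (j + 1)) ∧
      (∀ j < k₀, σ' aEdge j = σ aEdge j ∧ σ' aColor j = σ aColor j) ∧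
      Same [rE, rC, rX, rT, rS, rK, aEdge, aColor] σ σ' := by
  have hw1 := hf.one_lt
  refine (Ex.loop (r := l) (kb := 80) (fun r σ' => ∃ (xs es : ℕ → ℕ) (k : ℕ), k + r = l ∧
      xs 0 = y ∧ I.IsWalk (σ 3) t s xs es k ∧ xs k < I.n ∧
      σ' rX 0 = xs k ∧ σ' rT 0 = alt t s k ∧ σ' rS 0 = alt t s (k + 1) ∧ σ' rK 0 = k₀ + k ∧
      (∀ j < k, σ' aEdge (k₀ + j) = es j ∧ σ' aColor (k₀ + j) = alt t s (j + 1)) ∧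
      (∀ j < k₀, σ' aEdge j = σ aEdge j ∧ σ' aColor j = σ aColor j) ∧
      Same [rE, rC, rX, rT, rS, rK, aEdge, aColor] σ σ') ?_ ?_).mono
      (show l * (15 + 80) + 15 ≤ _ by omega) ?_
  · rintro r σ₁ ⟨xs, es, k, hkr, hx0, hwalk, hxn, hX, hT, hS, hK, hrec, hold, hsame⟩ hg
    have hb₁ : Base I σ₁ := hb.congr hsame (by simp)
    have hd₁ : DS I σ₁ := h.congr hsame (by simp)
    have e3 : σ₁ 3 = σ 3 := hsame 3 (by simp)
    have halt := alt_lt htΔ hsΔ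
    rw [val_walkGuard hf hb₁ hd₁ hX hT hK (l := k₀ + l) (by rw [hsame rLim (by simp), hl]) hxn
      (halt k)] at hg
    have hkl : k < l := by
      by_contra hcon
      exact hg (by rw [if_neg (by omega), mul_zero])
    have hne : σ₁ 4 (xs k * I.Δ + alt t s k) ≠ 0 := left_ne_zero_of_mul hg
    obtain ⟨e, hem, heinc, hecol, hinc⟩ := hd₁.exists_inc hxn (halt k) hne
    rw [e3] at hecol
    have hfl := I.fst_lt e hem
    have hsl := I.snd_lt e hem
    -- The endpoint of `e` other than the current vertex is computed as the sum of both endpoints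
    -- minus the current one.
    obtain ⟨x', hjoin, hsum⟩ : ∃ x', I.Joins e (xs k) x' ∧ I.fst e + I.snd e - xs k = x' := by
      refine ⟨_, ?_, rfl⟩
      rcases heinc with h₁ | h₁
      · exact Or.inl ⟨h₁, by omega⟩
      · exact Or.inr ⟨by omega, h₁⟩
    simp only [rX, rT, rS, rK] at hX hT hS hK
    refine ⟨r - 1, by omega, ?_⟩
    refine Ex.mono (k := (2 + 11) + ((1 + 2 + 2) + ((1 + 2 + 2) + ((2 + 10) + ((2 + 2) + ((2 + 2) +
      ((2 + 2) + (2 + 4)))))))) ?_ (by decide) fun _ h => h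
    refine Ex.seq (Ex.setReg (v := e) ?_ ?_)
    · rw [val_sub (x := e + 1) (y := 1) ?_ (val_const hw1) ?_]
      · simp
      · rw [val_load (val_index hf hb₁.num_colors (by rw [val_reg]; exact hX)
          (by rw [val_reg]; exact hT) hxn (halt k)), bInc, hinc]
      · unfold Fits at hf; omega
    refine Ex.seq (Ex.store (i := k₀ + k) (v := e) ?_ ?_ ?_)
    · rw [val_reg]; simp [set_bank, hK]
    · rw [val_reg]; simp [set_bank]
    refine Ex.seq (Ex.store (i := k₀ + k) (v := alt t s (k + 1)) ?_ ?_ ?_)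
    · rw [val_reg]; simp [set_bank, hK]
    · rw [val_reg]; simp [set_bank, hS]
    refine Ex.seq (Ex.setReg (v := x') ?_ ?_)
    · rw [val_sub (x := I.fst e + I.snd e) (y := xs k) (val_add ?_ ?_ ?_) ?_ ?_, hsum]
      · rw [val_load (val_reg _)]; simp [set_bank, hb₁.fst e hem]
      · rw [val_load (val_reg _)]; simp [set_bank, hb₁.snd e hem]
      · unfold Fits at hf; omega
      · rw [val_reg]; simp [set_bank, hX]
      · unfold Fits at hf; omega
    refine Ex.seq (Ex.setReg (v := alt t s k) ?_ ?_)
    · rw [val_reg]; simp [set_bank, hT]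
    refine Ex.seq (Ex.setReg (v := alt t s (k + 1)) ?_ ?_)
    · rw [val_reg]; simp [set_bank, hS]
    refine Ex.seq (Ex.setReg (v := alt t s k) ?_ ?_)
    · rw [val_reg]; simp [set_bank]
    refine Ex.setReg (v := k₀ + k + 1) (val_add ?_ (val_const hw1) (by omega)) ?_
    · rw [val_reg]; simp [set_bank, hK]
    refine ⟨Function.update xs (k + 1) x', Function.update es k e, k + 1, by omega, ?_,
      hwalk.extend hem hecol hjoin, ?_, ?_, ?_, ?_, ?_, ?_, ?_, ?_⟩
    · rw [Function.update_of_ne (by omega), hx0]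
    · rw [Function.update_self]; exact hjoin.right.lt hem
    · simp [set_bank]
    · simp [set_bank]
    · rw [show k + 1 + 1 = k + 2 from rfl, alt_add_two]; simp [set_bank]
    · simp [set_bank, add_assoc]
    · intro j hj
      rcases Nat.lt_succ_iff_lt_or_eq.1 hj with hlt | rfl
      · have := hrec j hlt
        simp only [aEdge, aColor] at this
        simp [set_bank, Function.update_of_ne (show j ≠ k by omega),
          Function.update_of_ne (show k₀ + j ≠ k₀ + k by omega), this]
      · simp [set_bank]
    · intro j hj
      have := hold j hj
      simp only [aEdge, aColor] at this
      simp [set_bank, Function.update_of_ne (show j ≠ k₀ + k by omega), this]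
    · refine Same.set (Same.set (Same.set (Same.set (Same.set (Same.set (Same.set (Same.set
        hsame ?_ _ _) ?_ _ _) ?_ _ _) ?_ _ _) ?_ _ _) ?_ _ _) ?_ _ _) ?_ _ _ <;> simp
  · exact ⟨fun _ => y, fun _ => 0, 0, by omega, rfl, ⟨by simp, by simp, by simp⟩, hy, hx,
      by rw [ht, alt_zero], by rw [hs]; rfl, by rw [hk, add_zero], by simp, by simp,
      Same.refl _ _⟩
  · rintro σ' ⟨⟨r, xs, es, k, hkr, hx0, hwalk, hxn, hX, hT, hS, hK, hrec, hold, hsame⟩, hg⟩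
    have halt := alt_lt htΔ hsΔ
    rw [val_walkGuard hf (hb.congr hsame (by simp)) (h.congr hsame (by simp)) hX hT hK
      (l := k₀ + l) (by rw [hsame rLim (by simp), hl]) hxn (halt k)] at hg
    refine ⟨xs, es, k, hx0, hwalk, by omega, ?_, hxn, hX, hT, hK, hrec, hold, hsame⟩
    by_cases hkl : k = l
    · exact Or.inr hkl
    · left
      rw [if_pos (by omega), mul_one, hsame 4 (by simp)] at hg
      exact (h.inc_eq_zero hxn (halt k)).1 hg

end EdgeColor

/-! ### Color changes made by a single round. -/

namespace EdgeColor

open WordRAM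

namespace Net

variable {I : Net} {col : ℕ → ℕ}

/-- Recoloring `col` along the walks from the endpoints of an edge: after the exchange of colors one
endpoint misses `tu` and the other one misses `tv`. -/
theorem IsWalk.two_flips {tu cu tv cv k₁ k₂ : ℕ} {xs₁ es₁ xs₂ es₂ : ℕ → ℕ}
    (h₁ : I.IsWalk col tu cu xs₁ es₁ k₁) (h₂ : I.IsWalk col tv cv xs₂ es₂ k₂)
    (hcol : I.Proper col) (m₁ : I.Misses col (xs₁ 0) cu)
    (e₁ : I.Misses col (xs₁ k₁) (alt tu cu k₁)) (m₂ : I.Misses col (xs₂ 0) cv)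
    (e₂ : I.Misses col (xs₂ k₂) (alt tv cv k₂)) (htt : tu ≠ tv) (htc : tu ≠ cv) (hct : cu ≠ tv)
    (hcc : cu ≠ cv) :
    ∃ col' : ℕ → ℕ, I.Proper col' ∧ (∀ i, col' i = 0 ↔ col i = 0) ∧
      (∀ z, ¬ (z = xs₁ k₁ ∧ alt tu cu k₁ = tu) → I.Misses col z tu → I.Misses col' z tu) ∧
      (∀ z, ¬ (z = xs₂ k₂ ∧ alt tv cv k₂ = tv) → I.Misses col z tv → I.Misses col' z tv) ∧
      I.Misses col' (xs₁ 0) tu ∧ I.Misses col' (xs₂ 0) tv ∧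
      (∀ c, (I.haves col' c).card ≤ (I.haves col c).card + 4) ∧
      (∀ j < k₁, col' (es₁ j) = alt tu cu (j + 1) + 1) ∧
      (∀ j < k₂, col' (es₂ j) = alt tv cv (j + 1) + 1) ∧
      ∀ i, (∀ j < k₁, es₁ j ≠ i) → (∀ j < k₂, es₂ j ≠ i) → col' i = col i := by
  set col₁ := flip col tu cu es₁ k₁ with hcol₁
  -- The color pairs of the two walks are disjoint, so the first exchange leaves the second walk and
  -- its maximality intact, even if the walks share vertices.
  have w₂ : I.IsWalk col₁ tv cv xs₂ es₂ k₂ := h₂.flip_other htt.symm hct.symm htc.symm hcc.symm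
  have p₁ : I.Proper col₁ := h₁.flip_proper hcol m₁ e₁
  have m₂' : I.Misses col₁ (xs₂ 0) cv := (misses_flip_iff htc.symm hcc.symm).2 m₂
  have e₂' : I.Misses col₁ (xs₂ k₂) (alt tv cv k₂) := by
    refine (misses_flip_iff ?_ ?_).2 e₂ <;> unfold alt <;> split_ifs <;> omega
  have c₁ : ∀ j < k₁, col₁ (es₁ j) = alt tu cu (j + 1) + 1 := by
    intro j hj
    rw [hcol₁, flip_of_mem ⟨j, hj, rfl⟩, h₁.color j hj, swapColor_alt]
  refine ⟨flip col₁ tv cv es₂ k₂, w₂.flip_proper p₁ m₂' e₂', ?_, ?_, ?_, ?_, ?_, ?_, ?_, ?_, ?_⟩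
  · intro i
    rw [flip_eq_zero, hcol₁, flip_eq_zero]
  · intro z hz hm
    exact (misses_flip_iff htt htc).2 (h₁.misses_flip_first hm hz)
  · intro z hz hm
    exact w₂.misses_flip_first ((misses_flip_iff htt.symm hct.symm).2 hm) hz
  · exact (misses_flip_iff htt htc).2 (h₁.misses_flip_start hcol m₁ e₁)
  · exact w₂.misses_flip_start p₁ m₂' e₂'
  · intro c
    have a₁ := h₁.card_haves_flip c
    have a₂ := w₂.card_haves_flip c
    rw [← hcol₁] at a₁
    omega
  · intro j hj
    refine (flip_eq_iff ?_ ?_).2 (c₁ j hj) <;> unfold alt <;> split_ifs <;> omega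
  · intro j hj
    rw [flip_of_mem ⟨j, hj, rfl⟩, w₂.color j hj, swapColor_alt]
  · intro i hi₁ hi₂
    rw [flip_of_not_mem (by push Not; exact hi₂), hcol₁,
      flip_of_not_mem (by push Not; exact hi₁)]

/-- Coloring an edge `e` after an exchange of the colors `t`, `s` along a walk from one of its
endpoints. -/
theorem IsWalk.flip_color {e t s k : ℕ} {xs es : ℕ → ℕ} (h : I.IsWalk col t s xs es k)
    (hcol : I.Proper col) (he : e < I.m) (hec : col e = 0) (hx : xs 0 = I.fst e)
    (hs : I.Misses col (I.fst e) s) (ht : I.Misses col (I.snd e) t)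
    (hk : I.Misses col (xs k) (alt t s k)) (htI : t = I.al ∨ t = I.be)
    (hsI : s = I.al ∨ s = I.be) :
    ∃ col' : ℕ → ℕ, I.Proper col' ∧ (∀ i, i ≠ e → (col' i = 0 ↔ col i = 0)) ∧ col' e = t + 1 ∧
      (∀ z, ¬ I.Inc e z → (I.Misses col z I.al ∨ I.Misses col z I.be) →
        (I.Misses col' z I.al ∨ I.Misses col' z I.be)) ∧
      (∀ c, (I.haves col' c).card ≤ (I.haves col c).card + 4) ∧
      (∀ j < k, col' (es j) = alt t s (j + 1) + 1) ∧
      ∀ i, (∀ j < k, es j ≠ i) → i ≠ e → col' i = col i := by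
  rw [← hx] at hs
  have hne : ∀ j < k, es j ≠ e := by
    rintro j hj rfl
    rw [h.color j hj] at hec
    omega
  have hside : I.side (I.snd e) ≠ I.side (xs 0) := by
    rw [hx]; exact (I.side_ne e he).symm
  refine ⟨Function.update (flip col t s es k) e (t + 1), ?_, ?_, ?_, ?_, ?_, ?_, ?_⟩
  -- The start misses `t` because of the exchange; the other endpoint still misses `t` because it
  -- lies on the other side of the bipartition.
  · refine proper_update (h.flip_proper hcol hs hk) ?_ (h.misses_flip_other_side hs ht hside)
    rw [← hx]
    exact h.misses_flip_start hcol hs hk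
  · intro i hi
    rw [Function.update_of_ne hi, flip_eq_zero]
  · exact Function.update_self _ _ _
  · intro z hz hm
    have hm' : I.Misses (flip col t s es k) z I.al ∨ I.Misses (flip col t s es k) z I.be := by
      -- For `t = s` the exchange statement would speak of one color only, but then the walk is
      -- empty and the coloring unchanged.
      by_cases hts : t = s
      · subst hts
        have hk0 := h.length_eq_zero hs
        subst hk0
        have : flip col t t es 0 = col := by
          funext i
          exact flip_of_not_mem (by simp)
        rwa [this]
      · have hor := h.misses_flip_or hcol hs hk (z := z)
        rcases htI with rfl | rfl <;> rcases hsI with rfl | rfl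
        · exact absurd rfl hts
        · exact hor hm
        · exact (hor hm.symm).symm
        · exact absurd rfl hts
    exact hm'.imp (fun h' => misses_update h' fun hi => absurd hi hz)
      (fun h' => misses_update h' fun hi => absurd hi hz)
  · intro c
    have a₁ := h.card_haves_flip c
    have a₂ := card_haves_update (I := I) (col := flip col t s es k) e (t + 1) c
    omega
  · intro j hj
    rw [Function.update_of_ne (hne j hj), flip_of_mem ⟨j, hj, rfl⟩, h.color j hj, swapColor_alt]
  · intro i hi hie
    rw [Function.update_of_ne hie, flip_of_not_mem (by push Not; exact hi)]

end Net

variable {I : Net} {w : ℕ} {σ : Mem}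

/-- The first element of the list of missing colors at an endpoint of an uncolored edge. -/
theorem DS.first_missing (h : DS I σ) {e y : ℕ} (he : e < I.m) (hec : σ 3 e = 0)
    (hy : I.Inc e y) : σ 6 (y * I.Δ + 0) < I.Δ ∧ I.Misses (σ 3) y (σ 6 (y * I.Δ + 0)) := by
  have hyn := hy.lt he
  have hrow := h.row y hyn
  have hpos : 0 < σ 5 y := by
    by_contra h0
    -- If the list were empty, the first `deg y` colors would need as many edges at `y`, all
    -- different from the uncolored edge `e`, which exceeds the degree.
    have hall : ∀ c < I.deg y, ∃ i < I.m, I.Inc i y ∧ σ 3 i = c + 1 := by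
      intro c hc
      have hcΔ := hc.trans_le (I.deg_le y hyn)
      have hne : σ 4 (y * I.Δ + c) ≠ 0 := by
        intro hz
        obtain ⟨j, hj, -⟩ := hrow.2 c hcΔ hz hc
        omega
      obtain ⟨i, hi, hiy, hic, -⟩ := h.exists_inc hyn hcΔ hne
      exact ⟨i, hi, hiy, hic⟩
    choose! f hfm hfy hfc using hall
    set E := (Finset.range I.m).filter fun i => I.fst i = y ∨ I.snd i = y with hE
    have heE : e ∈ E := Finset.mem_filter.2 ⟨Finset.mem_range.2 he, hy⟩
    have hcard : (Finset.range (I.deg y)).card ≤ (E.erase e).card := by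
      refine Finset.card_le_card_of_injOn f ?_ ?_
      · intro c hc
        have hc' := Finset.mem_range.1 hc
        refine Finset.mem_erase.2 ⟨?_, Finset.mem_filter.2 ⟨Finset.mem_range.2 (hfm c hc'),
          hfy c hc'⟩⟩
        intro hce
        have := hfc c hc'
        rw [hce] at this
        omega
      · intro c hc c' hc' hcc
        have h₁ := hfc c (Finset.mem_range.1 hc)
        have h₂ := hfc c' (Finset.mem_range.1 hc')
        rw [hcc] at h₁
        omega
    rw [Finset.card_range, Finset.card_erase_of_mem heE, I.deg_eq y hyn, ← hE] at hcard
    have : 0 < E.card := Finset.card_pos.2 ⟨e, heE⟩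
    omega
  obtain ⟨c, hc, h0, -, hl, -⟩ := hrow.1 0 hpos
  rw [hl]
  exact ⟨hc, (h.inc_eq_zero hyn hc).1 h0⟩

/-- Cutoff for the lengths of walks. -/
@[simp] abbrev rL : ℕ := 35

/-- Walk from the vertex in register `bx`, beginning with the color in register `bt` and alternating
it with the color in register `bs`. -/
def walkFrom (bx bt bs : ℕ) : Prog :=
  .seq (setReg rX (reg bx)) <|
  .seq (setReg rT (reg bt)) <|
  .seq (setReg rS (reg bs)) <|
  .seq (setReg rLim (reg rK + reg rL)) walk

theorem ex_walkFrom (hf : Fits I w) (hb : Base I σ) (h : DS I σ) {bx bt bs y t s k₀ l : ℕ}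
    (hbt : 9 < bt ∧ bt < 19) (hbs : 9 < bs ∧ bs < 19)
    (hx : σ bx 0 = y) (ht : σ bt 0 = t) (hs : σ bs 0 = s) (hk : σ rK 0 = k₀) (hl : σ rL 0 = l)
    (hw : k₀ + l < 2 ^ w) (hy : y < I.n) (htΔ : t < I.Δ) (hsΔ : s < I.Δ) :
    Ex w (walkFrom bx bt bs) σ ((l + 1) * 200) fun σ' => ∃ (xs es : ℕ → ℕ) (k : ℕ),
      xs 0 = y ∧ I.IsWalk (σ 3) t s xs es k ∧ k ≤ l ∧
      (I.Misses (σ 3) (xs k) (alt t s k) ∨ k = l) ∧ xs k < I.n ∧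
      σ' rX 0 = xs k ∧ σ' rT 0 = alt t s k ∧ σ' rK 0 = k₀ + k ∧
      (∀ j < k, σ' aEdge (k₀ + j) = es j ∧ σ' aColor (k₀ + j) = alt t s (j + 1)) ∧
      (∀ j < k₀, σ' aEdge j = σ aEdge j ∧ σ' aColor j = σ aColor j) ∧
      Same [rE, rC, rX, rT, rS, rLim, rK, aEdge, aColor] σ σ' := by
  refine Ex.mono (k := (2 + 2) + ((2 + 2) + ((2 + 2) + ((2 + 5) + (l + 1) * 100)))) ?_ (by omega)
    fun _ h => h
  simp only [rK, rL] at hk hl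
  refine Ex.seq (Ex.setReg (v := y) (by rw [val_reg, hx]) ?_)
  refine Ex.seq (Ex.setReg (v := t) ?_ ?_)
  · rw [val_reg, set_bank, if_neg (by simp; omega), ht]
  refine Ex.seq (Ex.setReg (v := s) ?_ ?_)
  · rw [val_reg, set_bank, if_neg (by simp; omega), set_bank, if_neg (by simp; omega), hs]
  refine Ex.seq (Ex.setReg (v := k₀ + l) (val_add ?_ ?_ hw) ?_)
  · rw [val_reg]; simp [set_bank, hk]
  · rw [val_reg]; simp [set_bank, hl]
  set σ₁ := (((σ.set rX 0 y).set rT 0 t).set rS 0 s).set rLim 0 (k₀ + l) with hσ₁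
  have s₁ : Same [rX, rT, rS, rLim] σ σ₁ := by
    refine Same.set (Same.set (Same.set (Same.set (Same.refl _ _) ?_ _ _) ?_ _ _) ?_ _ _) ?_ _ _
      <;> simp
  refine (ex_walk hf (hb.congr s₁ (by simp)) (h.congr s₁ (by simp)) (y := y) (t := t) (s := s)
    (k₀ := k₀) (l := l) ?_ ?_ ?_ ?_ ?_ hw hy htΔ hsΔ).mono le_rfl ?_
  · simp [hσ₁, set_bank]
  · simp [hσ₁, set_bank]
  · simp [hσ₁, set_bank]
  · simp [hσ₁, set_bank, hk]
  · simp [hσ₁, set_bank]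
  · rintro σ₂ ⟨xs, es, k, h0, hwalk, hkl, hend, hn, hX, hT, hK, hrec, hold, s₂⟩
    rw [s₁ 3 (by simp)] at hwalk hend
    refine ⟨xs, es, k, h0, hwalk, hkl, hend, hn, hX, hT, hK, hrec, fun j hj => ?_,
      (s₁.trans s₂).mono (by simp)⟩
    rw [← s₁ aEdge (by simp), ← s₁ aColor (by simp)]
    exact hold j hj

end EdgeColor

/-! ### The first loop: collecting edges of `U`. -/

namespace EdgeColor

open WordRAM

/-- Index of the sampled entry. -/
@[simp] abbrev rI : ℕ := 10
/-- The sampled edge. -/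
@[simp] abbrev rE0 : ℕ := 11
/-- First endpoint of the sampled edge. -/
@[simp] abbrev rU : ℕ := 12
/-- Second endpoint of the sampled edge. -/
@[simp] abbrev rV : ℕ := 13
/-- A color missing at `rU`. -/
@[simp] abbrev rCu : ℕ := 14
/-- A color missing at `rV`. -/
@[simp] abbrev rCv : ℕ := 15
/-- Target color at `rU`. -/
@[simp] abbrev rTu : ℕ := 16
/-- Target color at `rV`. -/
@[simp] abbrev rTv : ℕ := 17
/-- Nonzero if the recorded edges are to be recolored. -/
@[simp] abbrev rOK : ℕ := 18
/-- Number of edges in the array `aPhi`. -/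
@[simp] abbrev rR : ℕ := 30
/-- Number of colored edges in the array `aPhi`. -/
@[simp] abbrev rD : ℕ := 31
/-- Marked vertices. -/
@[simp] abbrev aMark : ℕ := 36
/-- Edges of `U` whose endpoints miss one of the two least common colors. -/
@[simp] abbrev aPhi : ℕ := 37

variable {I : Net} {w : ℕ} {σ : Mem}

/-- The memory between two rounds of the algorithm; `col₀` is the initial coloring. -/
structure MemInv (I : Net) (col₀ : ℕ → ℕ) (q : ℕ) (σ : Mem) : Prop where
  base : Base I σ
  ds : DS I σ
  inv : I.Inv col₀ (σ 3) (σ aMark) (σ aPhi) (σ rR 0) (σ rD 0)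
  mark_le : ∀ x, σ aMark x ≤ 1
  cutoff : σ rL 0 = 2 * q

theorem MemInv.congr {bs : List ℕ} {col₀ : ℕ → ℕ} {q : ℕ} {σ' : Mem} (h : MemInv I col₀ q σ)
    (hs : Same bs σ σ')
    (hb : ∀ b ∈ [0, 1, 2, 3, 4, 5, 6, 7, 8, 9, rR, rD, rL, aMark, aPhi], b ∉ bs) :
    MemInv I col₀ q σ' := by
  refine ⟨h.base.congr hs fun b hb' => hb b ?_, h.ds.congr hs fun b hb' => hb b ?_, ?_, ?_, ?_⟩
  · simp at hb' ⊢; omega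
  · simp at hb' ⊢; omega
  · rw [hs 3 (hb _ (by simp)), hs aMark (hb _ (by simp)), hs aPhi (hb _ (by simp)),
      hs rR (hb _ (by simp)), hs rD (hb _ (by simp))]
    exact h.inv
  · rw [hs aMark (hb _ (by simp))]; exact h.mark_le
  · rw [hs rL (hb _ (by simp))]; exact h.cutoff

/-- The recorded edges in `σ'` describe the change from the coloring in `σ` to `col'`. -/
structure Recorded (I : Net) (q : ℕ) (σ σ' : Mem) (col' : ℕ → ℕ) : Prop where
  len : σ' rK 0 ≤ 4 * q + 1
  edge_lt : ∀ j < σ' rK 0, σ' aEdge j < I.m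
  color_lt : ∀ j < σ' rK 0, σ' aColor j < I.Δ
  proper : I.Proper col'
  color : ∀ j < σ' rK 0, col' (σ' aEdge j) = σ' aColor j + 1
  rest : ∀ i, (¬ ∃ j < σ' rK 0, σ' aEdge j = i) → col' i = σ 3 i

/-- The change of colors makes it possible to add the edge `e` to the array. -/
structure PushOK (I : Net) (col mark : ℕ → ℕ) (e : ℕ) (col' : ℕ → ℕ) : Prop where
  zero_iff : ∀ i < I.m, i ≠ e → (col' i = 0 ↔ col i = 0)
  miss : ∀ z, mark z ≠ 0 → (I.Misses col z I.al ∨ I.Misses col z I.be) →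
    (I.Misses col' z I.al ∨ I.Misses col' z I.be)
  ends : col' e = 0 → ∀ x, I.Inc e x → I.Misses col' x I.al ∨ I.Misses col' x I.be
  haves : ∀ c, (I.haves col' c).card ≤ (I.haves col c).card + 4

/-- Load the edge with index `rI` from the array in bank `b`. -/
def loadEdge (b : ℕ) : Prog :=
  .seq (setReg rE0 (.load b (reg rI))) <|
  .seq (setReg rU (.load bFst (reg rE0))) <|
  .seq (setReg rV (.load bSnd (reg rE0))) <|
  .seq (setReg rK (.const 0)) (setReg rOK (.const 0))

/-- Choose target colors for the endpoints of the sampled edge. -/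
def chooseTargets : Prog :=
  .cond (eqT (reg rCu) (par 4) + eqT (reg rCu) (par 5))
    (.seq (setReg rTu (reg rCu)) (setReg rTv (par 4 + par 5 - reg rCu)))
    (.cond (eqT (reg rCv) (par 4) + eqT (reg rCv) (par 5))
      (.seq (setReg rTv (reg rCv)) (setReg rTu (par 4 + par 5 - reg rCv)))
      (.seq (setReg rTu (par 4)) (setReg rTv (par 5))))

/-- Test whether a walk was maximal and did not end in a marked vertex where its first color, stored
in register `bt`, is missing. -/
def endOk (bt : ℕ) : WTerm :=
  eqT (.load bInc (reg rX * par 2 + reg rT) + .load aMark (reg rX) * eqT (reg rT) (reg bt))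
    (.const 0)

/-- Plan to color the sampled edge with a common missing color of its endpoints. -/
def planDirect : Prog :=
  .seq (.store aEdge (.const 0) (reg rE0)) <|
  .seq (.store aColor (.const 0) (reg rCu)) <|
  .seq (setReg rK (.const 1)) (setReg rOK (.const 1))

/-- Plan to exchange colors along walks from the endpoints of the sampled edge. -/
def planWalks : Prog :=
  .seq chooseTargets <|
  .seq (walkFrom rU rTu rCu) <|
  .seq (setReg rOK (endOk rTu)) <|
  .seq (walkFrom rV rTv rCv) (setReg rOK (reg rOK * endOk rTv))

/-- Plan the change of colors for the sampled edge. -/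
def planPush : Prog :=
  .seq (setReg rCu (.load bMissList (reg rU * par 2 + .const 0))) <|
  .seq (setReg rCv (.load bMissList (reg rV * par 2 + .const 0))) <|
  .cond (eqT (reg rCu) (reg rCv)) planDirect planWalks

/-- Recolor the recorded edges and add the sampled edge to the array. -/
def commitPush : Prog :=
  .seq applyRec <|
  .seq (.store aMark (reg rU) (.const 1)) <|
  .seq (.store aMark (reg rV) (.const 1)) <|
  .seq (.store aPhi (reg rR) (reg rE0)) <|
  .seq (setReg rR (reg rR + .const 1)) <|
  setReg rD (reg rD + ltT (.const 0) (.load bCol (reg rE0)))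

/-- A round of the first loop, after the choice of a random index. -/
def pushBody : Prog :=
  .seq (loadEdge bU) <|
  .seq (.cond (eqT (.load bCol (reg rE0) + .load aMark (reg rU) + .load aMark (reg rV)) (.const 0))
    planPush .skip) <|
  .cond (reg rOK) commitPush .skip

theorem ex_loadEdge (hb : Base I σ) {b e : ℕ}
    (he : σ b (σ rI 0) = e) (hem : e < I.m) :
    Ex w (loadEdge b) σ 30 fun σ' => σ' rE0 0 = e ∧ σ' rU 0 = I.fst e ∧ σ' rV 0 = I.snd e ∧
      σ' rK 0 = 0 ∧ σ' rOK 0 = 0 ∧ Same [rE0, rU, rV, rK, rOK] σ σ' := by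
  refine Ex.mono (k := (2 + 3) + ((2 + 3) + ((2 + 3) + ((2 + 1) + (2 + 1))))) ?_ (by decide)
    fun _ h => h
  refine Ex.seq (Ex.setReg (v := e) (by rw [val_load (val_reg _), he]) ?_)
  refine Ex.seq (Ex.setReg (v := I.fst e) ?_ ?_)
  · rw [val_load (val_reg _)]; simp [set_bank, hb.fst e hem]
  refine Ex.seq (Ex.setReg (v := I.snd e) ?_ ?_)
  · rw [val_load (val_reg _)]; simp [set_bank, hb.snd e hem]
  refine Ex.seq (Ex.setReg (v := 0) (by simp [WTerm.val]) ?_)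
  refine Ex.setReg (v := 0) (by simp [WTerm.val]) ?_
  refine ⟨by simp [set_bank], by simp [set_bank], by simp [set_bank], by simp [set_bank],
    by simp [set_bank], ?_⟩
  refine Same.set (Same.set (Same.set (Same.set (Same.set (Same.refl _ _) ?_ _ _) ?_ _ _)
    ?_ _ _) ?_ _ _) ?_ _ _ <;> simp

theorem val_eq_or (hf : Fits I w) (hb : Base I σ) {b c : ℕ} (hc : σ b 0 = c) :
    (eqT (reg b) (par 4) + eqT (reg b) (par 5)).val w σ ≠ 0 ↔ c = I.al ∨ c = I.be := by
  have h4 : (par 4).val w σ = I.al := by rw [val_par (hf.const (by omega)), hb.first]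
  have h5 : (par 5).val w σ = I.be := by rw [val_par (hf.const (by omega)), hb.second]
  rw [val_add (val_eq hf.one_lt (by rw [val_reg, hc]) h4) (val_eq hf.one_lt (by rw [val_reg, hc]) h5)]
  · split_ifs <;> simp_all
  · have := hf.const (k := 2) (by omega)
    split_ifs <;> omega

/-- A missing color that is already α or β is kept as the target of its own vertex, so the walk from
there is empty. This makes the pairs `{tu, cu}` and `{tv, cv}` disjoint, as `two_flips` requires. -/
theorem ex_chooseTargets (hf : Fits I w) (hb : Base I σ) {cu cv : ℕ} (hcu : σ rCu 0 = cu)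
    (hcv : σ rCv 0 = cv) (hne : cu ≠ cv) (hu : cu < I.Δ) (hv : cv < I.Δ) :
    Ex w chooseTargets σ 60 fun σ' => ∃ tu tv, σ' rTu 0 = tu ∧ σ' rTv 0 = tv ∧
      (tu = I.al ∧ tv = I.be ∨ tu = I.be ∧ tv = I.al) ∧ tu ≠ tv ∧ tu ≠ cv ∧ cu ≠ tv ∧
      Same [rTu, rTv] σ σ' := by
  -- Two different colors `cu`, `cv` below `Δ` force `2 ≤ Δ`.
  have hab := I.al_ne_be (by omega)
  have hal := I.al_lt
  have hbe := I.be_lt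
  have hΔ := I.Δ_le
  simp only [rCu, rCv] at hcu hcv
  have h4 : ∀ b x, b ≠ 0 → (par 4).val w (σ.set b 0 x) = I.al := by
    intro b x hb0
    rw [val_par (hf.const (by omega)), set_bank, if_neg hb0.symm, hb.first]
  have h5 : ∀ b x, b ≠ 0 → (par 5).val w (σ.set b 0 x) = I.be := by
    intro b x hb0
    rw [val_par (hf.const (by omega)), set_bank, if_neg hb0.symm, hb.second]
  have hsum : ∀ b x b' y, b ≠ 0 → (reg b').val w (σ.set b 0 x) = y → y = I.al ∨ y = I.be →
      (par 4 + par 5 - reg b').val w (σ.set b 0 x) = if y = I.al then I.be else I.al := by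
    intro b x b' y hb0 hy hor
    have : I.al + I.be < 2 ^ w := by unfold Fits at hf; omega
    rw [val_sub (val_add (h4 b x hb0) (h5 b x hb0) this) hy this]
    split_ifs <;> omega
  have hsame : ∀ x y, Same [rTu, rTv] σ ((σ.set rTu 0 x).set rTv 0 y) := fun x y =>
    ((Same.refl _ _).set (by simp) _ _).set (by simp) _ _
  have hsame' : ∀ x y, Same [rTu, rTv] σ ((σ.set rTv 0 x).set rTu 0 y) := fun x y =>
    ((Same.refl _ _).set (by simp) _ _).set (by simp) _ _
  refine Ex.mono (k := 1 + 11 + (1 + 11 + 20)) (Ex.cond (fun ht => ?_) fun ht => Ex.cond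
    (fun ht' => ?_) fun ht' => ?_) (by decide) fun _ h => h
  · rw [val_eq_or hf hb hcu] at ht
    refine Ex.mono (k := (2 + 2) + (2 + 8)) (Ex.seq (Ex.setReg (v := cu) (by rw [val_reg, hcu]) ?_))
      (by decide) fun _ h => h
    refine Ex.setReg (hsum rTu cu rCu cu (by simp) (by rw [val_reg]; simp [set_bank, hcu]) ht) ?_
    refine ⟨cu, if cu = I.al then I.be else I.al, by simp [set_bank], by simp [set_bank],
      ?_, ?_, ?_, ?_, hsame _ _⟩ <;> (try split_ifs) <;> omega
  · rw [val_eq_or hf hb hcv] at ht'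
    have ht := (val_eq_or hf hb hcu (w := w)).not.1 (not_not.2 ht)
    refine Ex.mono (k := (2 + 2) + (2 + 8)) (Ex.seq (Ex.setReg (v := cv) (by rw [val_reg, hcv]) ?_))
      (by decide) fun _ h => h
    refine Ex.setReg (hsum rTv cv rCv cv (by simp) (by rw [val_reg]; simp [set_bank, hcv]) ht') ?_
    refine ⟨if cv = I.al then I.be else I.al, cv, by simp [set_bank], by simp [set_bank],
      ?_, ?_, ?_, ?_, hsame' _ _⟩ <;> (try split_ifs) <;> omega
  · have ht := (val_eq_or hf hb hcu (w := w)).not.1 (not_not.2 ht)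
    have ht' := (val_eq_or hf hb hcv (w := w)).not.1 (not_not.2 ht')
    refine Ex.mono (k := (2 + 2) + (2 + 2)) (Ex.seq (Ex.setReg (v := I.al) ?_ ?_))
      (by decide) fun _ h => h
    · rw [val_par (hf.const (by omega)), hb.first]
    refine Ex.setReg (h5 _ _ (by simp)) ?_
    exact ⟨I.al, I.be, by simp [set_bank], by simp [set_bank], Or.inl ⟨rfl, rfl⟩, hab,
      by omega, by omega, hsame _ _⟩

/-- A sum of naturals vanishes only if each term does, so one comparison with `0` checks both
maximality and the harmless end. Marks are at most `1`, which keeps the product and the sum within a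
word. -/
theorem val_endOk (hf : Fits I w) (hb : Base I σ) (h : DS I σ) {bt x t' t : ℕ}
    (hX : σ rX 0 = x) (hT : σ rT 0 = t') (ht : σ bt 0 = t) (hx : x < I.n) (ht' : t' < I.Δ)
    (hm : σ aMark x ≤ 1) :
    (endOk bt).val w σ ≤ 1 ∧ ((endOk bt).val w σ ≠ 0 ↔
      I.Misses (σ 3) x t' ∧ ¬ (σ aMark x ≠ 0 ∧ t' = t)) := by
  have hw := hf.one_lt
  have hle : σ 4 (x * I.Δ + t') ≤ I.m := by
    by_cases h0 : σ 4 (x * I.Δ + t') = 0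
    · omega
    · obtain ⟨i, hi, -, -, he⟩ := h.exists_inc hx ht' h0
      omega
  have hval : (endOk bt).val w σ =
      if σ 4 (x * I.Δ + t') + σ aMark x * (if t' = t then 1 else 0) = 0 then 1 else 0 := by
    have hmul : σ aMark x * (if t' = t then 1 else 0) ≤ 1 := by split_ifs <;> omega
    refine val_eq hw (val_add (val_load (val_index hf hb.num_colors (by rw [val_reg, hX])
      (by rw [val_reg, hT]) hx ht')) (val_mul (val_load (by rw [val_reg, hX]))
      (val_eq hw (by rw [val_reg, hT]) (by rw [val_reg, ht])) (by omega)) ?_)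
      (val_const (by omega))
    unfold Fits at hf
    omega
  rw [hval]
  refine ⟨by split_ifs <;> omega, ?_⟩
  rw [← h.inc_eq_zero hx ht']
  by_cases h0 : σ 4 (x * I.Δ + t') = 0 <;> by_cases htt : t' = t <;>
    by_cases hm0 : σ aMark x = 0 <;> simp only [aMark] at hm0 <;> simp [h0, htt, hm0]

/-- The banks changed by the planning of a round. -/
def planBanks : List ℕ :=
  [rCu, rCv, rTu, rTv, rOK, rE, rC, rX, rT, rS, rLim, rK, aEdge, aColor]

theorem ex_planDirect (hf : Fits I w) {e c q : ℕ}
    (he : σ rE0 0 = e) (hc : σ rCu 0 = c) (hem : e < I.m) (hcΔ : c < I.Δ) (hcol : I.Proper (σ 3))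
    (hmiss : ∀ y, I.Inc e y → I.Misses (σ 3) y c) (hmark : ∀ y, I.Inc e y → σ aMark y = 0) :
    Ex w planDirect σ 20 fun σ' => Same planBanks σ σ' ∧ σ' rOK 0 = 1 ∧
      ∃ col', Recorded I q σ σ' col' ∧ PushOK I (σ 3) (σ aMark) e col' := by
  have hw := hf.one_lt
  simp only [rE0, rCu] at he hc
  refine Ex.mono (k := (1 + 1 + 2) + ((1 + 1 + 2) + ((2 + 1) + (2 + 1)))) ?_ (by decide)
    fun _ h => h
  refine Ex.seq (Ex.store (i := 0) (v := e) (val_const (by omega)) (by rw [val_reg, he]) ?_)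
  refine Ex.seq (Ex.store (i := 0) (v := c) (val_const (by omega)) ?_ ?_)
  · rw [val_reg]; simp [set_bank, hc]
  refine Ex.seq (Ex.setReg (val_const hw) (Ex.setReg (val_const hw) ?_))
  refine ⟨?_, by simp [set_bank], Function.update (σ 3) e (c + 1), ⟨?_, ?_, ?_, ?_, ?_, ?_⟩, ?_⟩
  · refine Same.set (Same.set (Same.set (Same.set (Same.refl _ _) ?_ _ _) ?_ _ _)
      ?_ _ _) ?_ _ _ <;> simp [planBanks]
  · simp [set_bank]
  · intro j hj
    obtain rfl : j = 0 := by simpa [set_bank] using hj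
    simpa [set_bank] using hem
  · intro j hj
    obtain rfl : j = 0 := by simpa [set_bank] using hj
    simpa [set_bank] using hcΔ
  · exact Net.proper_update hcol (hmiss _ (Or.inl rfl)) (hmiss _ (Or.inr rfl))
  · intro j hj
    obtain rfl : j = 0 := by simpa [set_bank] using hj
    simp [set_bank]
  · intro i hi
    rw [Function.update_of_ne]
    rintro rfl
    exact hi ⟨0, by simp [set_bank], by simp [set_bank]⟩
  · refine ⟨fun i _ hie => by rw [Function.update_of_ne hie], ?_, fun h0 => by simp at h0,
      fun c' => (Net.card_haves_update _ _ _).trans (by omega)⟩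
    intro z hz hor
    have hinc : ¬ I.Inc e z := fun h => hz (hmark z h)
    exact hor.imp (fun h => Net.misses_update h fun h' => absurd h' hinc)
      fun h => Net.misses_update h fun h' => absurd h' hinc

/-- Acceptance is sound, since every accepted plan yields a legal change of colors. It is also
guaranteed when no walk is long or blocked for either of the two colors, whichever targets were
chosen. -/
theorem ex_planWalks (hf : Fits I w) (hb : Base I σ) (h : DS I σ) {e cu cv q : ℕ}
    (hem : e < I.m) (hU : σ rU 0 = I.fst e) (hV : σ rV 0 = I.snd e)
    (hcu : σ rCu 0 = cu) (hcv : σ rCv 0 = cv) (hne : cu ≠ cv) (hu : cu < I.Δ) (hv : cv < I.Δ)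
    (hmu : I.Misses (σ 3) (I.fst e) cu) (hmv : I.Misses (σ 3) (I.snd e) cv) (hK : σ rK 0 = 0)
    (hL : σ rL 0 = 2 * q) (hq : q ≤ 7680 * I.m + 1) (hmark : ∀ x, σ aMark x ≤ 1) :
    Ex w planWalks σ (1000 * q + 1000) fun σ' => Same planBanks σ σ' ∧
      (σ' rOK 0 ≠ 0 → ∃ col', Recorded I q σ σ' col' ∧ PushOK I (σ 3) (σ aMark) e col') ∧
      ((∀ t, t = I.al ∨ t = I.be →
        ¬ I.LongWalk (σ 3) t cu (I.fst e) (2 * q) ∧ ¬ I.LongWalk (σ 3) t cv (I.snd e) (2 * q) ∧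
        ¬ I.Blocked (σ 3) t cu (I.fst e) (I.marked (σ aMark)) ∧
        ¬ I.Blocked (σ 3) t cv (I.snd e) (I.marked (σ aMark))) → σ' rOK 0 ≠ 0) := by
  have hw := hf.one_lt
  have hqw : 2 * q + 2 * q < 2 ^ w := by unfold Fits at hf; omega
  have hfn := I.fst_lt e hem
  have hsn := I.snd_lt e hem
  refine Ex.mono (k := 60 + ((2 * q + 1) * 200 + ((2 + 21) + ((2 * q + 1) * 200 + (2 + 24)))))
    (Ex.seq ?_) (by omega) fun _ h => h
  refine (ex_chooseTargets hf hb hcu hcv hne hu hv).mono le_rfl ?_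
  rintro σ₁ ⟨tu, tv, htu, htv, hor, htt, htc, hct, s₁⟩
  have htuΔ : tu < I.Δ := by have := I.al_lt; have := I.be_lt; omega
  have htvΔ : tv < I.Δ := by have := I.al_lt; have := I.be_lt; omega
  refine Ex.seq ((ex_walkFrom hf (hb.congr s₁ (by simp)) (h.congr s₁ (by simp)) (by simp)
    (by simp) (y := I.fst e) (t := tu) (s := cu) (k₀ := 0) (l := 2 * q)
    (by rw [s₁ rU (by simp), hU]) htu (by rw [s₁ rCu (by simp), hcu])
    (by rw [s₁ rK (by simp), hK]) (by rw [s₁ rL (by simp), hL]) (by omega) hfn htuΔ hu).mono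
    le_rfl ?_)
  rintro σ₂ ⟨xs₁, es₁, k₁, h0₁, hw₁, hk₁, hend₁, hn₁, hX₁, hT₁, hK₁, hrec₁, -, s₂⟩
  rw [s₁ 3 (by simp)] at hw₁ hend₁
  have s₀₂ := s₁.trans s₂
  obtain ⟨hle₁, hok₁⟩ := val_endOk hf (hb.congr s₀₂ (by simp)) (h.congr s₀₂ (by simp))
    hX₁ hT₁ (show σ₂ rTu 0 = tu by rw [s₂ rTu (by simp), htu]) hn₁ (alt_lt htuΔ hu _)
    (by rw [s₀₂ aMark (by simp)]; exact hmark _)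
  rw [s₀₂ 3 (by simp), s₀₂ aMark (by simp)] at hok₁
  set v₁ := (endOk rTu).val w σ₂
  refine Ex.seq (Ex.setReg (v := v₁) rfl ?_)
  set σ₃ := σ₂.set rOK 0 v₁ with hσ₃
  have s₃ : Same [rOK] σ₂ σ₃ := (Same.refl _ _).set (by simp) _ _
  have s₀₃ := s₀₂.trans s₃
  refine Ex.seq ((ex_walkFrom hf (hb.congr s₀₃ (by simp)) (h.congr s₀₃ (by simp)) (by simp)
    (by simp) (y := I.snd e) (t := tv) (s := cv) (k₀ := k₁) (l := 2 * q)
    (by rw [s₀₃ rV (by simp), hV]) (by rw [s₃ rTv (by simp), s₂ rTv (by simp), htv])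
    (by rw [s₀₃ rCv (by simp), hcv]) (by rw [s₃ rK (by simp), hK₁, zero_add])
    (by rw [s₀₃ rL (by simp), hL]) (by omega) hsn htvΔ hv).mono le_rfl ?_)
  rintro σ₄ ⟨xs₂, es₂, k₂, h0₂, hw₂, hk₂, hend₂, hn₂, hX₂, hT₂, hK₂, hrec₂, hold₂, s₄⟩
  rw [s₀₃ 3 (by simp)] at hw₂ hend₂
  have s₀₄ := s₀₃.trans s₄
  obtain ⟨hle₂, hok₂⟩ := val_endOk hf (hb.congr s₀₄ (by simp)) (h.congr s₀₄ (by simp))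
    hX₂ hT₂ (show σ₄ rTv 0 = tv by
      rw [s₄ rTv (by simp), s₃ rTv (by simp), s₂ rTv (by simp), htv]) hn₂ (alt_lt htvΔ hv _)
    (by rw [s₀₄ aMark (by simp)]; exact hmark _)
  rw [s₀₄ 3 (by simp), s₀₄ aMark (by simp)] at hok₂
  set v₂ := (endOk rTv).val w σ₄
  have hOK₄ : σ₄ rOK 0 = v₁ := by rw [s₄ rOK (by simp)]; simp [hσ₃, set_bank]
  have hv12 : v₁ * v₂ ≤ 1 := by nlinarith
  refine Ex.setReg (v := v₁ * v₂) (val_mul (by rw [val_reg, hOK₄]) rfl (by omega)) ?_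
  have hOK₅ : (σ₄.set rOK 0 (v₁ * v₂)) rOK 0 = v₁ * v₂ := by simp [set_bank]
  have hK₅ : (σ₄.set rOK 0 (v₁ * v₂)) rK 0 = k₁ + k₂ := by
    rw [← hK₂]; simp [set_bank]
  have hE₅ : (σ₄.set rOK 0 (v₁ * v₂)) aEdge = σ₄ aEdge := by simp [set_bank]
  have hC₅ : (σ₄.set rOK 0 (v₁ * v₂)) aColor = σ₄ aColor := by simp [set_bank]
  -- The record is the concatenation of both walks, the second one starting at position `k₁`.
  have hlist : ∀ j < k₁ + k₂, (∃ p < k₁, p = j ∧ σ₄ aEdge j = es₁ p ∧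
      σ₄ aColor j = alt tu cu (p + 1)) ∨ (∃ p < k₂, k₁ + p = j ∧ σ₄ aEdge j = es₂ p ∧
      σ₄ aColor j = alt tv cv (p + 1)) := by
    intro j hj
    by_cases hjk : j < k₁
    · refine Or.inl ⟨j, hjk, rfl, ?_⟩
      rw [(hold₂ j hjk).1, (hold₂ j hjk).2, s₃ aEdge (by simp), s₃ aColor (by simp)]
      have := hrec₁ j hjk
      rwa [zero_add] at this
    · refine Or.inr ⟨j - k₁, by omega, by omega, ?_⟩
      have := hrec₂ (j - k₁) (by omega)
      rwa [show k₁ + (j - k₁) = j by omega] at this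
  refine ⟨?_, fun hok => ?_, fun hgood => ?_⟩
  · refine Same.set (s₀₄.mono ?_) (by simp [planBanks]) _ _
    simp [planBanks]
  · rw [hOK₅] at hok
    obtain ⟨em₁, nb₁⟩ := hok₁.1 (left_ne_zero_of_mul hok)
    obtain ⟨em₂, nb₂⟩ := hok₂.1 (right_ne_zero_of_mul hok)
    obtain ⟨col', hp, hz, hm₁, hm₂, hs₁, hs₂, hh, hc₁, hc₂, hrest⟩ :=
      hw₁.two_flips hw₂ h.proper (by rwa [h0₁]) em₁ (by rwa [h0₂]) em₂ htt htc hct hne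
    refine ⟨col', ⟨?_, ?_, ?_, hp, ?_, ?_⟩, fun i _ _ => hz i, ?_, ?_, hh⟩
    · rw [hK₅]; omega
    · rw [hK₅, hE₅]
      intro j hj
      rcases hlist j hj with ⟨p, hp, -, he, -⟩ | ⟨p, hp, -, he, -⟩ <;> rw [he]
      · exact hw₁.edge_lt p hp
      · exact hw₂.edge_lt p hp
    · rw [hK₅, hC₅]
      intro j hj
      rcases hlist j hj with ⟨p, hp, -, -, hc⟩ | ⟨p, hp, -, -, hc⟩ <;> rw [hc]
      · exact alt_lt htuΔ hu _
      · exact alt_lt htvΔ hv _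
    · rw [hK₅, hE₅, hC₅]
      intro j hj
      rcases hlist j hj with ⟨p, hp, -, he, hc⟩ | ⟨p, hp, -, he, hc⟩ <;> rw [he, hc]
      · exact hc₁ p hp
      · exact hc₂ p hp
    · rw [hK₅, hE₅]
      intro i hi
      refine hrest i (fun j hj hji => hi ⟨j, by omega, ?_⟩) fun j hj hji => hi ⟨k₁ + j, by omega, ?_⟩
      · rcases hlist j (by omega) with ⟨p, hp, rfl, he, -⟩ | ⟨p, hp, hpj, he, -⟩
        · rw [he, hji]
        · omega
      · rw [(hrec₂ j hj).1, hji]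
    -- The end test says that no marked vertex is the one place where the first color of a walk can
    -- stop being missing.
    · have g₁ : ∀ z, σ aMark z ≠ 0 → I.Misses (σ 3) z tu → I.Misses col' z tu := fun z hz =>
        hm₁ z fun hc => nb₁ ⟨by rw [← hc.1]; exact hz, hc.2⟩
      have g₂ : ∀ z, σ aMark z ≠ 0 → I.Misses (σ 3) z tv → I.Misses col' z tv := fun z hz =>
        hm₂ z fun hc => nb₂ ⟨by rw [← hc.1]; exact hz, hc.2⟩
      intro z hz
      rcases hor with ⟨rfl, rfl⟩ | ⟨rfl, rfl⟩
      · exact Or.imp (g₁ z hz) (g₂ z hz)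
      · exact Or.imp (g₂ z hz) (g₁ z hz)
    · rw [h0₁] at hs₁
      rw [h0₂] at hs₂
      rintro - x (rfl | rfl)
      · rcases hor with ⟨rfl, rfl⟩ | ⟨rfl, rfl⟩
        · exact Or.inl hs₁
        · exact Or.inr hs₁
      · rcases hor with ⟨rfl, rfl⟩ | ⟨rfl, rfl⟩
        · exact Or.inr hs₂
        · exact Or.inl hs₂
  · rw [hOK₅]
    have htu' : tu = I.al ∨ tu = I.be := hor.imp And.left And.left
    have htv' : tv = I.al ∨ tv = I.be := (hor.imp And.right And.right).symm
    have hmk : ∀ x, x < I.n → σ aMark x ≠ 0 → x ∈ I.marked (σ aMark) := fun x hx hm =>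
      Finset.mem_filter.2 ⟨Finset.mem_range.2 hx, hm⟩
    -- A walk stopped by the cutoff is a `LongWalk`, and one with a harmful end is `Blocked`; both
    -- are excluded.
    refine mul_ne_zero (hok₁.2 ⟨hend₁.resolve_right ?_, ?_⟩) (hok₂.2 ⟨hend₂.resolve_right ?_, ?_⟩)
    · rintro rfl
      exact (hgood tu htu').1 ⟨xs₁, es₁, h0₁, hw₁⟩
    · rintro ⟨hm, ha⟩
      exact (hgood tu htu').2.2.1 ⟨xs₁, es₁, k₁, h0₁, hw₁, ha, hmk _ hn₁ hm⟩
    · rintro rfl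
      exact (hgood tv htv').2.1 ⟨xs₂, es₂, h0₂, hw₂⟩
    · rintro ⟨hm, ha⟩
      exact (hgood tv htv').2.2.2 ⟨xs₂, es₂, k₂, h0₂, hw₂, ha, hmk _ hn₂ hm⟩

end EdgeColor

namespace EdgeColor

open WordRAM

variable {I : Net} {w : ℕ} {σ : Mem}

theorem Net.Inv.R_le {col₀ col mark phi : ℕ → ℕ} {R D : ℕ} (h : I.Inv col₀ col mark phi R D) :
    R ≤ I.m := by
  have hΔ : 0 < I.Δ := (Nat.zero_le _).trans_lt I.al_lt
  have hlam := I.lam_le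
  rcases h.size with h' | h'
  · omega
  · have : (R - 1) * 1 ≤ (R - 1) * (24 * I.Δ) := Nat.mul_le_mul_left _ (by omega)
    rw [mul_assoc] at h'
    omega

/-- The missing color of a vertex is always the head of its list, which provides the function `c` of
`GoodSample`. -/
theorem ex_planPush (hf : Fits I w) (hb : Base I σ) (h : DS I σ) {e a q : ℕ} (hea : e = I.U a)
    (hem : e < I.m) (hE : σ rE0 0 = e) (hU : σ rU 0 = I.fst e) (hV : σ rV 0 = I.snd e)
    (hec : σ 3 e = 0) (hme : ∀ y, I.Inc e y → σ aMark y = 0) (hK : σ rK 0 = 0)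
    (hL : σ rL 0 = 2 * q) (hq : q ≤ 7680 * I.m + 1) (hmark : ∀ x, σ aMark x ≤ 1) :
    Ex w planPush σ (1000 * q + 1100) fun σ' => Same planBanks σ σ' ∧
      (σ' rOK 0 ≠ 0 → ∃ col', Recorded I q σ σ' col' ∧ PushOK I (σ 3) (σ aMark) e col') ∧
      (I.GoodSample (σ 3) (σ aMark) (fun y => σ 6 (y * I.Δ + 0)) q a → σ' rOK 0 ≠ 0) := by
  have hw := hf.one_lt
  have hΔ : 0 < I.Δ := (Nat.zero_le _).trans_lt I.al_lt
  obtain ⟨hu, hmu⟩ := h.first_missing hem hec (Or.inl rfl)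
  obtain ⟨hv, hmv⟩ := h.first_missing hem hec (Or.inr rfl)
  set cu := σ 6 (I.fst e * I.Δ + 0) with hcu
  set cv := σ 6 (I.snd e * I.Δ + 0) with hcv
  refine Ex.mono (k := (2 + 8) + ((2 + 8) + (1 + 5 + (1000 * q + 1000)))) ?_ (by omega)
    fun _ h => h
  refine Ex.seq (Ex.setReg (v := cu) ?_ ?_)
  · rw [val_load (val_index hf hb.num_colors (by rw [val_reg, hU]) (val_const (by omega))
      (I.fst_lt e hem) hΔ)]
  refine Ex.seq (Ex.setReg (v := cv) ?_ ?_)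
  · rw [val_load (val_index hf ?_ (by rw [val_reg]; simpa [set_bank] using hV)
      (val_const (by omega)) (I.snd_lt e hem) hΔ)]
    · simp [set_bank, hcv]
    · simp [set_bank, hb.num_colors]
  set σ₁ := (σ.set rCu 0 cu).set rCv 0 cv with hσ₁
  have s₁ : Same [rCu, rCv] σ σ₁ := ((Same.refl _ _).set (by simp) _ _).set (by simp) _ _
  have hcu₁ : σ₁ rCu 0 = cu := by simp [hσ₁, set_bank]
  have hcv₁ : σ₁ rCv 0 = cv := by simp [hσ₁, set_bank]
  have hsub : ∀ σ₂, Same planBanks σ₁ σ₂ → Same planBanks σ σ₂ := fun σ₂ s₂ =>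
    (s₁.trans s₂).mono (by simp [planBanks])
  have e3 : σ₁ 3 = σ 3 := s₁ 3 (by simp)
  have e36 : σ₁ aMark = σ aMark := s₁ aMark (by simp)
  have hrec : ∀ σ₂ col', Recorded I q σ₁ σ₂ col' → Recorded I q σ σ₂ col' := by
    rintro σ₂ col' ⟨h1, h2, h3, h4, h5, h6⟩
    exact ⟨h1, h2, h3, h4, h5, by rwa [e3] at h6⟩
  refine Ex.cond (fun ht => ?_) (fun ht => ?_) <;>
    rw [val_eq hw (val_reg _) (val_reg _), hcu₁, hcv₁] at ht
  · have hc : cu = cv := by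
      by_contra hne
      simp [hne] at ht
    refine (ex_planDirect hf (e := e) (c := cu) (q := q) (by rw [s₁ rE0 (by simp), hE]) hcu₁ hem hu
      (by rw [e3]; exact h.proper) ?_ ?_).mono (by omega) ?_
    · rw [e3]
      rintro y (rfl | rfl)
      · exact hmu
      · rw [hc]; exact hmv
    · rw [e36]; exact hme
    · rintro σ₂ ⟨s₂, hok, col', hr, hp⟩
      rw [e3, e36] at hp
      exact ⟨hsub _ s₂, fun _ => ⟨col', hrec _ _ hr, hp⟩, fun _ => by omega⟩
  · have hc : cu ≠ cv := by
      rintro hc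
      simp [hc] at ht
    refine (ex_planWalks hf (hb.congr s₁ (by simp)) (h.congr s₁ (by simp)) hem
      (by rw [s₁ rU (by simp), hU]) (by rw [s₁ rV (by simp), hV]) hcu₁ hcv₁ hc hu hv
      (by rw [e3]; exact hmu) (by rw [e3]; exact hmv) (by rw [s₁ rK (by simp), hK])
      (by rw [s₁ rL (by simp), hL]) hq (by rw [e36]; exact hmark)).mono le_rfl ?_
    rintro σ₂ ⟨s₂, hok, hgood⟩
    rw [e3, e36] at hok hgood
    refine ⟨hsub _ s₂, fun ho => ?_, fun hg => hgood fun t htt => ?_⟩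
    · obtain ⟨col', hr, hp⟩ := hok ho
      exact ⟨col', hrec _ _ hr, hp⟩
    · subst hea
      have g₁ := hg.2.2 _ (Or.inl rfl) t htt
      have g₂ := hg.2.2 _ (Or.inr rfl) t htt
      exact ⟨g₁.1, g₂.1, g₁.2, g₂.2⟩

/-- Planning has not touched the coloring, so the record can be read relative to the current memory;
hence `σ` occurs twice in `Recorded`. -/
theorem ex_commitPush (hf : Fits I w) {col₀ col' : ℕ → ℕ} {a q : ℕ} (h : MemInv I col₀ q σ)
    (ha : a < I.lam) (hE : σ rE0 0 = I.U a) (hU : σ rU 0 = I.fst (I.U a))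
    (hV : σ rV 0 = I.snd (I.U a)) (hec : σ 3 (I.U a) = 0) (hm : σ aMark (I.fst (I.U a)) = 0)
    (hR : σ rR 0 * 24 * I.Δ < I.lam) (hr : Recorded I q σ σ col')
    (hp : PushOK I (σ 3) (σ aMark) (I.U a) col') (hq : q ≤ 7680 * I.m + 1) :
    Ex w commitPush σ ((4 * q + 2) * 600 + 60) fun σ' =>
      MemInv I col₀ q σ' ∧ σ' rR 0 = σ rR 0 + 1 := by
  have hw := hf.one_lt
  have hRm := h.inv.R_le
  have hDR := h.inv.count_le
  have hlen := hr.len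
  have hRw : I.m + 1 < 2 ^ w := by unfold Fits at hf; omega
  have hKw : σ rK 0 < 2 ^ w := by
    generalize σ rK 0 = K at hlen
    unfold Fits at hf; omega
  have hmul : (σ rK 0 + 1) * 600 ≤ (4 * q + 2) * 600 := Nat.mul_le_mul_right _ (by omega)
  refine Ex.mono (k := (σ rK 0 + 1) * 600 + ((1 + 2 + 1) + ((1 + 2 + 1) + ((1 + 2 + 2) +
    ((2 + 4) + (2 + 8)))))) ?_ (Nat.add_le_add hmul (by norm_num)) fun _ h => h
  refine Ex.seq ((ex_applyRec hf h.base h.ds rfl hKw hr.edge_lt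
    hr.color_lt hr.proper hr.color hr.rest).mono le_rfl ?_)
  rintro σ₁ ⟨hd₁, h3, s₁⟩
  have eU : σ₁ rU 0 = I.fst (I.U a) := by rw [s₁ rU (by simp), hU]
  have eV : σ₁ rV 0 = I.snd (I.U a) := by rw [s₁ rV (by simp), hV]
  have eE : σ₁ rE0 0 = I.U a := by rw [s₁ rE0 (by simp), hE]
  have eR : σ₁ rR 0 = σ rR 0 := by rw [s₁ rR (by simp)]
  have eD : σ₁ rD 0 = σ rD 0 := by rw [s₁ rD (by simp)]
  have eM : σ₁ aMark = σ aMark := s₁ aMark (by simp)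
  have eP : σ₁ aPhi = σ aPhi := s₁ aPhi (by simp)
  have eL : σ₁ rL 0 = 2 * q := by rw [s₁ rL (by simp), h.cutoff]
  simp only [rU, rV, rE0, rR, rD, aMark, aPhi, rL] at eU eV eE eR eD eM eP eL
  refine Ex.seq (Ex.store (i := I.fst (I.U a)) (v := 1) (by rw [val_reg, eU]) (val_const hw) ?_)
  refine Ex.seq (Ex.store (i := I.snd (I.U a)) (v := 1) ?_ (val_const hw) ?_)
  · rw [val_reg]; simp [set_bank, eV]
  refine Ex.seq (Ex.store (i := σ 30 0) (v := I.U a) ?_ ?_ ?_)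
  · rw [val_reg]; simp [set_bank, eR]
  · rw [val_reg]; simp [set_bank, eE]
  refine Ex.seq (Ex.setReg (v := σ 30 0 + 1) (val_add ?_ (val_const hw) ?_) ?_)
  · rw [val_reg]; simp [set_bank, eR]
  · simp only [rR] at hRm; omega
  have hif : (if 0 < col' (I.U a) then 1 else 0) = if col' (I.U a) = 0 then 0 else 1 := by
    split_ifs <;> omega
  refine Ex.setReg (v := σ 31 0 + if col' (I.U a) = 0 then 0 else 1)
    (val_add ?_ ((val_lt hw (val_const (by omega)) ?_).trans hif) ?_) ?_
  · rw [val_reg]; simp [set_bank, eD]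
  · rw [val_load (val_reg _)]; simp [set_bank, eE, h3]
  · simp only [rR, rD] at hRm hDR
    split_ifs <;> omega
  refine ⟨⟨?_, ?_, ?_, ?_, ?_⟩, ?_⟩
  · refine h.base.congr (bs := [3, 4, 5, 6, 7, rE, rJ, rC, rY, rP, rQ, rZ, aMark, aPhi, rR, rD])
      ?_ (by simp)
    refine Same.set (Same.set (Same.set (Same.set (Same.set (s₁.mono ?_) ?_ _ _) ?_ _ _) ?_ _ _)
      ?_ _ _) ?_ _ _ <;> simp
  · refine hd₁.congr (bs := [aMark, aPhi, rR, rD]) ?_ (by simp)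
    refine Same.set (Same.set (Same.set (Same.set (Same.set (Same.refl _ _) ?_ _ _) ?_ _ _) ?_ _ _)
      ?_ _ _) ?_ _ _ <;> simp
  · have := h.inv.push ha hm hR hp.zero_iff (fun h0 => absurd hec (h.inv.keeps _ (I.U_lt a ha) h0))
      hp.miss hp.ends (hp.haves _) (hp.haves _)
    simpa [set_bank, h3, eM, eP] using this
  · intro x
    have := h.mark_le x
    simp only [aMark] at this
    simp only [set_bank, aMark, rD, rR, aPhi]
    simp only [Nat.reduceEqDiff, if_false, if_true, Function.update_apply, eM]
    split_ifs <;> omega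
  · simpa [set_bank] using eL
  · simp [set_bank]

theorem ex_pushBody (hf : Fits I w) {col₀ : ℕ → ℕ} {a q : ℕ} (h : MemInv I col₀ q σ)
    (hI : σ rI 0 = a) (ha : a < I.lam) (hR : σ rR 0 * 24 * I.Δ < I.lam)
    (hq : q ≤ 7680 * I.m + 1) :
    Ex w pushBody σ (4000 * (q + 1)) fun σ' => MemInv I col₀ q σ' ∧
      (σ' rR 0 = σ rR 0 ∨ σ' rR 0 = σ rR 0 + 1) ∧
      (I.GoodSample (σ 3) (σ aMark) (fun y => σ 6 (y * I.Δ + 0)) q a → σ' rR 0 = σ rR 0 + 1) := by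
  have hw := hf.one_lt
  have hem := I.U_lt a ha
  refine Ex.mono (k := 30 + ((1 + 13 + (1000 * q + 1100)) + (1 + 2 + ((4 * q + 2) * 600 + 60))))
    ?_ (by omega) fun _ h => h
  refine Ex.seq ((ex_loadEdge h.base (e := I.U a) (by rw [hI]; exact h.base.U a ha)
    hem).mono le_rfl ?_)
  rintro σ₁ ⟨hE, hU, hV, hK, hOK, s₁⟩
  have h₁ : MemInv I col₀ q σ₁ := h.congr s₁ (by simp)
  have e3 : σ₁ 3 = σ 3 := s₁ 3 (by simp)
  have e6 : σ₁ 6 = σ 6 := s₁ 6 (by simp)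
  have eM : σ₁ aMark = σ aMark := s₁ aMark (by simp)
  have eR : σ₁ rR = σ rR := s₁ rR (by simp)
  have hguard : (eqT (.load bCol (reg rE0) + .load aMark (reg rU) + .load aMark (reg rV))
      (.const 0)).val w σ₁ = if σ 3 (I.U a) + σ aMark (I.fst (I.U a)) +
        σ aMark (I.snd (I.U a)) = 0 then 1 else 0 := by
    have b₁ := h.ds.le _ hem
    have b₂ := h.mark_le (I.fst (I.U a))
    have b₃ := h.mark_le (I.snd (I.U a))
    have b₄ := I.Δ_le
    unfold Fits at hf
    rw [← e3, ← eM] at *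
    refine val_eq hw (val_add (val_add (val_load (by rw [val_reg, hE]))
      (val_load (by rw [val_reg, hU])) ?_) (val_load (by rw [val_reg, hV])) ?_)
      (val_const (by omega)) <;> omega
  refine Ex.seq ((Ex.cond (Q := fun σ₂ => Same planBanks σ₁ σ₂ ∧
    (σ₂ rOK 0 ≠ 0 → σ₁ 3 (I.U a) = 0 ∧ σ₁ aMark (I.fst (I.U a)) = 0 ∧
      ∃ col', Recorded I q σ₁ σ₂ col' ∧ PushOK I (σ₁ 3) (σ₁ aMark) (I.U a) col') ∧
    (I.GoodSample (σ₁ 3) (σ₁ aMark) (fun y => σ₁ 6 (y * I.Δ + 0)) q a → σ₂ rOK 0 ≠ 0))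
    (fun ht => ?_) fun ht => ?_).mono le_rfl ?_)
  · rw [hguard, ← e3, ← eM] at ht
    have hz : σ₁ 3 (I.U a) = 0 ∧ σ₁ aMark (I.fst (I.U a)) = 0 ∧ σ₁ aMark (I.snd (I.U a)) = 0 := by
      by_contra hcon
      rw [if_neg (by omega)] at ht
      exact ht rfl
    refine (ex_planPush hf h₁.base h₁.ds rfl hem hE hU hV hz.1 ?_ hK h₁.cutoff hq
      h₁.mark_le).mono le_rfl ?_
    · rintro y (rfl | rfl)
      · exact hz.2.1
      · exact hz.2.2
    · rintro σ₂ ⟨s₂, hok, hgood⟩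
      exact ⟨s₂, fun ho => ⟨hz.1, hz.2.1, hok ho⟩, hgood⟩
  · refine (Ex.skip ⟨Same.refl _ _, fun ho => absurd hOK ho, fun hg => ?_⟩).mono (by omega)
      fun _ h => h
    rw [hguard, ← e3, ← eM, if_pos] at ht
    · omega
    · rw [hg.1, hg.2.1 _ (Or.inl rfl), hg.2.1 _ (Or.inr rfl)]
  rintro σ₂ ⟨s₂, hok, hgood⟩
  have h₂ : MemInv I col₀ q σ₂ := h₁.congr s₂ (by simp [planBanks])
  have f3 : σ₂ 3 = σ₁ 3 := s₂ 3 (by simp [planBanks])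
  have fM : σ₂ aMark = σ₁ aMark := s₂ aMark (by simp [planBanks])
  have fR : σ₂ rR = σ rR := by rw [s₂ rR (by simp [planBanks]), eR]
  rw [← e3, ← e6, ← eM, ← fR]
  refine Ex.cond (fun ht => ?_) fun ht => ?_ <;> rw [val_reg] at ht
  · obtain ⟨hz, hm, col', hr, hp⟩ := hok ht
    refine (ex_commitPush hf h₂ ha (by rw [s₂ rE0 (by simp [planBanks]), hE])
      (by rw [s₂ rU (by simp [planBanks]), hU]) (by rw [s₂ rV (by simp [planBanks]), hV])
      (by rw [f3, hz]) (by rw [fM, hm]) (by rw [fR]; exact hR)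
      ⟨hr.len, hr.edge_lt, hr.color_lt, hr.proper, hr.color, by rw [f3]; exact hr.rest⟩
      (by rw [f3, fM]; exact hp) hq).mono le_rfl ?_
    rintro σ₃ ⟨h₃, hR₃⟩
    exact ⟨h₃, Or.inr hR₃, fun _ => hR₃⟩
  · exact (Ex.skip ⟨h₂, Or.inl rfl, fun hg => absurd ht (hgood hg)⟩).mono (by omega) fun _ h => h

/-! ### The second loop -/

/-- The change of colors colors the edge `e` of the array. -/
structure ColorOK (I : Net) (col : ℕ → ℕ) (e : ℕ) (col' : ℕ → ℕ) : Prop where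
  zero_iff : ∀ i, i ≠ e → (col' i = 0 ↔ col i = 0)
  ne_zero : col' e ≠ 0
  miss : ∀ z, ¬ I.Inc e z → (I.Misses col z I.al ∨ I.Misses col z I.be) →
    (I.Misses col' z I.al ∨ I.Misses col' z I.be)
  haves : ∀ c, (I.haves col' c).card ≤ (I.haves col c).card + 4

/-- Write to register `bc` one of the two least common colors that is missing at the vertex in
register `bx`. -/
def chooseMissing (bx bc : ℕ) : Prog :=
  .cond (.load bInc (reg bx * par 2 + par 4)) (setReg bc (par 5)) (setReg bc (par 4))

/-- Plan to color the sampled edge after an exchange of the two least common colors. -/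
def planColor : Prog :=
  .seq (chooseMissing rU rCu) <|
  .seq (chooseMissing rV rTu) <|
  .seq (walkFrom rU rTu rCu) <|
  .seq (setReg rOK (eqT (.load bInc (reg rX * par 2 + reg rT)) (.const 0))) <|
  .seq (.store aEdge (reg rK) (reg rE0)) <|
  .seq (.store aColor (reg rK) (reg rTu)) <|
  setReg rK (reg rK + .const 1)

/-- A round of the second loop, after the choice of a random index. -/
def colorBody : Prog :=
  .seq (loadEdge aPhi) <|
  .seq (.cond (eqT (.load bCol (reg rE0)) (.const 0)) planColor .skip) <|
  .cond (reg rOK) (.seq applyRec (setReg rD (reg rD + .const 1))) .skip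

theorem ex_chooseMissing (hf : Fits I w) (hb : Base I σ) (h : DS I σ) {bx bc x : ℕ}
    (hx : σ bx 0 = x) (hxn : x < I.n)
    (hm : I.Misses (σ 3) x I.al ∨ I.Misses (σ 3) x I.be) :
    Ex w (chooseMissing bx bc) σ 20 fun σ' => ∃ c, σ' bc 0 = c ∧ (c = I.al ∨ c = I.be) ∧
      I.Misses (σ 3) x c ∧ Same [bc] σ σ' := by
  have h4 : (par 4).val w σ = I.al := by rw [val_par (hf.const (by omega)), hb.first]
  have h5 : (par 5).val w σ = I.be := by rw [val_par (hf.const (by omega)), hb.second]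
  refine Ex.mono (k := 1 + 9 + (2 + 2)) (Ex.cond (fun ht => ?_) fun ht => ?_) (by omega)
    fun _ h => h <;>
    rw [val_load (val_index hf hb.num_colors (by rw [val_reg, hx]) h4 hxn I.al_lt)] at ht <;>
    have hz := h.inc_eq_zero hxn I.al_lt
  · exact Ex.setReg h5 ⟨I.be, by simp [set_bank], Or.inr rfl,
      hm.resolve_left fun hm' => ht (hz.2 hm'), (Same.refl _ _).set (by simp) _ _⟩
  · exact Ex.setReg h4 ⟨I.al, by simp [set_bank], Or.inl rfl, hz.1 ht,
      (Same.refl _ _).set (by simp) _ _⟩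

/-- Both the missing color `cu` at one end and the future color `tu` missing at the other are α or
β. The sampled edge is appended to the record with color `tu`, so that a single recoloring performs
the exchange and colors the edge. -/
theorem ex_planColor (hf : Fits I w) (hb : Base I σ) (h : DS I σ) {e p q : ℕ} {phi : ℕ → ℕ}
    (hep : e = phi p) (hem : e < I.m) (hE : σ rE0 0 = e) (hU : σ rU 0 = I.fst e)
    (hV : σ rV 0 = I.snd e) (hec : σ 3 e = 0)
    (hmiss : ∀ y, I.Inc e y → I.Misses (σ 3) y I.al ∨ I.Misses (σ 3) y I.be) (hK : σ rK 0 = 0)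
    (hL : σ rL 0 = 2 * q) (hq : q ≤ 7680 * I.m + 1) (hq0 : 0 < q) :
    Ex w planColor σ (1000 * q + 1100) fun σ' => Same planBanks σ σ' ∧
      (σ' rOK 0 ≠ 0 → ∃ col', Recorded I q σ σ' col' ∧ ColorOK I (σ 3) e col') ∧
      (I.GoodEdge (σ 3) phi q p → σ' rOK 0 ≠ 0) := by
  have hw := hf.one_lt
  have hfn := I.fst_lt e hem
  have hsn := I.snd_lt e hem
  have hqw : 2 * q + 2 < 2 ^ w := by unfold Fits at hf; omega
  refine Ex.mono (k := 20 + (20 + ((2 * q + 1) * 200 + ((2 + 11) + ((1 + 2 + 2) + ((1 + 2 + 2) +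
    (2 + 4))))))) (Ex.seq ?_) (by omega) fun _ h => h
  refine (ex_chooseMissing hf hb h hU hfn (hmiss _ (Or.inl rfl))).mono le_rfl ?_
  rintro σ₁ ⟨cu, hcu, hcuI, hmu, s₁⟩
  refine Ex.seq ((ex_chooseMissing hf (hb.congr s₁ (by simp)) (h.congr s₁ (by simp))
    (x := I.snd e) (by rw [s₁ rV (by simp), hV]) hsn
    (by rw [s₁ 3 (by simp)]; exact hmiss _ (Or.inr rfl))).mono le_rfl ?_)
  rintro σ₂ ⟨tu, htu, htuI, hmv, s₂⟩
  rw [s₁ 3 (by simp)] at hmv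
  have s₀₂ := s₁.trans s₂
  have hcuΔ : cu < I.Δ := by rcases hcuI with rfl | rfl <;> [exact I.al_lt; exact I.be_lt]
  have htuΔ : tu < I.Δ := by rcases htuI with rfl | rfl <;> [exact I.al_lt; exact I.be_lt]
  refine Ex.seq ((ex_walkFrom hf (hb.congr s₀₂ (by simp)) (h.congr s₀₂ (by simp)) (by simp)
    (by simp) (y := I.fst e) (t := tu) (s := cu) (k₀ := 0) (l := 2 * q)
    (by rw [s₀₂ rU (by simp), hU]) htu (by rw [s₂ rCu (by simp), hcu])
    (by rw [s₀₂ rK (by simp), hK]) (by rw [s₀₂ rL (by simp), hL]) (by omega) hfn htuΔ hcuΔ).mono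
    le_rfl ?_)
  rintro σ₃ ⟨xs, es, k, h0, hwalk, hk, hend, hn, hX, hT, hK₃, hrec, -, s₃⟩
  rw [s₀₂ 3 (by simp)] at hwalk hend
  have s₀₃ := s₀₂.trans s₃
  have hb₃ : Base I σ₃ := hb.congr s₀₃ (by simp)
  have hd₃ : DS I σ₃ := h.congr s₀₃ (by simp)
  have halt := alt_lt htuΔ hcuΔ k
  obtain ⟨v, hv, hvm⟩ : ∃ v, (eqT (.load bInc (reg rX * par 2 + reg rT)) (.const 0)).val w σ₃ = v ∧
      (v ≠ 0 ↔ I.Misses (σ 3) (xs k) (alt tu cu k)) := by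
    refine ⟨_, val_eq hw (val_load (val_index hf hb₃.num_colors (by rw [val_reg, hX])
      (by rw [val_reg, hT]) hn halt)) (val_const (by omega)), ?_⟩
    rw [← s₀₃ 3 (by simp), ← hd₃.inc_eq_zero hn halt]
    split_ifs with h' <;> simpa using h'
  have hE₃ : σ₃ rE0 0 = e := by rw [s₀₃ rE0 (by simp), hE]
  have ht₃ : σ₃ rTu 0 = tu := by rw [s₃ rTu (by simp), htu]
  simp only [zero_add, aEdge, aColor, rK, rE0, rTu] at hrec hK₃ hE₃ ht₃
  refine Ex.seq (Ex.setReg hv ?_)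
  refine Ex.seq (Ex.store (i := k) (v := e) ?_ ?_ ?_)
  · rw [val_reg]; simp [set_bank, hK₃]
  · rw [val_reg]; simp [set_bank, hE₃]
  refine Ex.seq (Ex.store (i := k) (v := tu) ?_ ?_ ?_)
  · rw [val_reg]; simp [set_bank, hK₃]
  · rw [val_reg]; simp [set_bank, ht₃]
  refine Ex.setReg (v := k + 1) (val_add ?_ (val_const hw) (by omega)) ?_
  · rw [val_reg]; simp [set_bank, hK₃]
  set σ₄ := (((σ₃.set rOK 0 v).set aEdge k e).set aColor k tu).set rK 0 (k + 1) with hσ₄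
  have hOK₄ : σ₄ rOK 0 = v := by simp [hσ₄, set_bank]
  have hK₄ : σ₄ rK 0 = k + 1 := by simp [hσ₄, set_bank]
  have hlist : ∀ j < k + 1, (j < k ∧ σ₄ aEdge j = es j ∧ σ₄ aColor j = alt tu cu (j + 1)) ∨
      (j = k ∧ σ₄ aEdge j = e ∧ σ₄ aColor j = tu) := by
    intro j hj
    rcases Nat.lt_succ_iff_lt_or_eq.1 hj with hlt | rfl
    · refine Or.inl ⟨hlt, ?_, ?_⟩
      · rw [← (hrec j hlt).1]
        simp [hσ₄, set_bank, Function.update_of_ne hlt.ne]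
      · rw [← (hrec j hlt).2]
        simp [hσ₄, set_bank, Function.update_of_ne hlt.ne]
    · exact Or.inr ⟨rfl, by simp [hσ₄, set_bank], by simp [hσ₄, set_bank]⟩
  refine ⟨?_, fun hok => ?_, fun hgood => ?_⟩
  · refine Same.set (Same.set (Same.set (Same.set (s₀₃.mono ?_) ?_ _ _) ?_ _ _) ?_ _ _) ?_ _ _ <;>
      simp [planBanks]
  · rw [hOK₄, hvm] at hok
    obtain ⟨col', hp, hz, hce, hm, hh, hc, hrest⟩ :=
      hwalk.flip_color h.proper hem hec h0 hmu hmv hok htuI hcuI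
    refine ⟨col', ⟨?_, ?_, ?_, hp, ?_, ?_⟩, hz, by omega, hm, hh⟩
    · rw [hK₄]; omega
    · rw [hK₄]
      intro j hj
      rcases hlist j hj with ⟨hlt, he, -⟩ | ⟨-, he, -⟩ <;> rw [he]
      · exact hwalk.edge_lt j hlt
      · exact hem
    · rw [hK₄]
      intro j hj
      rcases hlist j hj with ⟨hlt, -, hc'⟩ | ⟨-, -, hc'⟩ <;> rw [hc']
      · exact alt_lt htuΔ hcuΔ _
      · exact htuΔ
    · rw [hK₄]
      intro j hj
      rcases hlist j hj with ⟨hlt, he, hc'⟩ | ⟨-, he, hc'⟩ <;> rw [he, hc']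
      · exact hc j hlt
      · exact hce
    · rw [hK₄]
      intro i hi
      refine hrest i (fun j hj hji => hi ⟨j, by omega, ?_⟩) fun hie => hi ⟨k, by omega, ?_⟩
      · rcases hlist j (by omega) with ⟨-, he, -⟩ | ⟨hjk, -, -⟩
        · rw [he, hji]
        · omega
      · rcases hlist k (by omega) with ⟨hlt, -, -⟩ | ⟨-, he, -⟩
        · omega
        · rw [he, hie]
  · rw [hOK₄, hvm]
    refine hend.resolve_right ?_
    rintro rfl
    -- If both ends miss the same color the walk is empty. As `0 < q`, it has not reached the
    -- cutoff, and `GoodEdge` is needed only for two distinct colors.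
    by_cases htc : tu = cu
    · subst htc
      have := hwalk.length_eq_zero (by rwa [h0])
      omega
    · have hpair : tu = I.al ∧ cu = I.be ∨ tu = I.be ∧ cu = I.al := by
        rcases htuI with rfl | rfl <;> rcases hcuI with rfl | rfl
        · exact absurd rfl htc
        · exact Or.inl ⟨rfl, rfl⟩
        · exact Or.inr ⟨rfl, rfl⟩
        · exact absurd rfl htc
      subst hep
      exact hgood.2 tu cu hpair hmu ⟨xs, es, h0, hwalk⟩

theorem ex_colorBody (hf : Fits I w) {col₀ : ℕ → ℕ} {p q : ℕ} (h : MemInv I col₀ q σ)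
    (hI : σ rI 0 = p) (hp : p < σ rR 0) (hq : q ≤ 7680 * I.m + 1) (hq0 : 0 < q) :
    Ex w colorBody σ (4000 * (q + 1)) fun σ' => MemInv I col₀ q σ' ∧ σ' rR 0 = σ rR 0 ∧
      (σ' rD 0 = σ rD 0 ∨ σ' rD 0 = σ rD 0 + 1) ∧
      (I.GoodEdge (σ 3) (σ aPhi) q p → σ' rD 0 = σ rD 0 + 1) := by
  have hw := hf.one_lt
  have hem := h.inv.phi_lt hp
  refine Ex.mono (k := 30 + ((1 + 5 + (1000 * q + 1100)) + (1 + 2 + ((4 * q + 2) * 600 + 6))))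
    ?_ (by omega) fun _ h => h
  refine Ex.seq ((ex_loadEdge h.base (e := σ aPhi p) (by rw [hI]) hem).mono le_rfl ?_)
  rintro σ₁ ⟨hE, hU, hV, hK, hOK, s₁⟩
  have h₁ : MemInv I col₀ q σ₁ := h.congr s₁ (by simp)
  have e3 : σ₁ 3 = σ 3 := s₁ 3 (by simp)
  have eP : σ₁ aPhi = σ aPhi := s₁ aPhi (by simp)
  have eR : σ₁ rR = σ rR := s₁ rR (by simp)
  have eD : σ₁ rD = σ rD := s₁ rD (by simp)
  rw [← eP] at hE hU hV hem ⊢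
  rw [← eR] at hp ⊢
  rw [← eD, ← e3]
  set e := σ₁ aPhi p with he
  have hguard : (eqT (.load bCol (reg rE0)) (.const 0)).val w σ₁ =
      if σ₁ 3 e = 0 then 1 else 0 :=
    val_eq hw (val_load (by rw [val_reg, hE])) (val_const (by omega))
  refine Ex.seq ((Ex.cond (Q := fun σ₂ => Same planBanks σ₁ σ₂ ∧
    (σ₂ rOK 0 ≠ 0 → σ₁ 3 e = 0 ∧
      ∃ col', Recorded I q σ₁ σ₂ col' ∧ ColorOK I (σ₁ 3) e col') ∧
    (I.GoodEdge (σ₁ 3) (σ₁ aPhi) q p → σ₂ rOK 0 ≠ 0)) (fun ht => ?_) fun ht => ?_).mono le_rfl ?_)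
  · have hz : σ₁ 3 e = 0 := by
      by_contra hcon
      rw [hguard, if_neg hcon] at ht
      exact ht rfl
    refine (ex_planColor hf h₁.base h₁.ds (phi := σ₁ aPhi) (p := p) rfl hem hE hU hV hz
      (h₁.inv.phi_miss p hp hz) hK h₁.cutoff hq hq0).mono le_rfl ?_
    rintro σ₂ ⟨s₂, hok, hgood⟩
    exact ⟨s₂, fun ho => ⟨hz, hok ho⟩, hgood⟩
  · refine (Ex.skip ⟨Same.refl _ _, fun ho => absurd hOK ho, fun hg => ?_⟩).mono (by omega)
      fun _ h => h
    rw [hguard, if_pos hg.1] at ht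
    omega
  rintro σ₂ ⟨s₂, hok, hgood⟩
  have h₂ : MemInv I col₀ q σ₂ := h₁.congr s₂ (by simp [planBanks])
  have f3 : σ₂ 3 = σ₁ 3 := s₂ 3 (by simp [planBanks])
  have fP : σ₂ aPhi = σ₁ aPhi := s₂ aPhi (by simp [planBanks])
  have fR : σ₂ rR = σ₁ rR := s₂ rR (by simp [planBanks])
  have fD : σ₂ rD = σ₁ rD := s₂ rD (by simp [planBanks])
  refine Ex.cond (fun ht => ?_) fun ht => ?_ <;> rw [val_reg] at ht
  · obtain ⟨hz, col', hr, hc⟩ := hok ht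
    have hlen := hr.len
    have hKw : σ₂ rK 0 < 2 ^ w := by
      generalize σ₂ rK 0 = K at hlen
      unfold Fits at hf; omega
    have hmul : (σ₂ rK 0 + 1) * 600 ≤ (4 * q + 2) * 600 := Nat.mul_le_mul_right _ (by omega)
    refine Ex.mono (k := (σ₂ rK 0 + 1) * 600 + (2 + 4)) (Ex.seq ?_) (Nat.add_le_add_right hmul _) fun _ h => h
    refine (ex_applyRec hf h₂.base h₂.ds rfl hKw hr.edge_lt
      hr.color_lt hr.proper hr.color (by rw [f3]; exact hr.rest)).mono le_rfl ?_
    rintro σ₃ ⟨hd₃, h3, s₃⟩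
    have hD₃ : σ₃ rD 0 = σ₁ rD 0 := by rw [s₃ rD (by simp), fD]
    have hDR := h₁.inv.count_le
    have hRm := h₁.inv.R_le
    refine Ex.setReg (v := σ₁ rD 0 + 1) (val_add (by rw [val_reg, hD₃]) (val_const hw) ?_) ?_
    · unfold Fits at hf; omega
    have gR : (σ₃.set rD 0 (σ₁ rD 0 + 1)) rR = σ₁ rR := by
      rw [set_bank, if_neg (by simp), s₃ rR (by simp), fR]
    have gD : (σ₃.set rD 0 (σ₁ rD 0 + 1)) rD 0 = σ₁ rD 0 + 1 := by simp [set_bank]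
    refine ⟨⟨?_, ?_, ?_, ?_, ?_⟩, by rw [gR], Or.inr gD, fun _ => gD⟩
    · refine h₂.base.congr (s₃.trans (cs := [rD]) ?_) (by simp)
      exact (Same.refl _ _).set (by simp) _ _
    · exact hd₃.congr (bs := [rD]) ((Same.refl _ _).set (by simp) _ _) (by simp)
    · rw [gR, gD, set_bank, if_neg (by simp), set_bank, if_neg (by simp), set_bank,
        if_neg (by simp), h3, s₃ aMark (by simp), s₃ aPhi (by simp), s₂ aMark (by simp [planBanks]),
        fP]
      exact h₁.inv.color hp hz (fun i _ => hc.zero_iff i) hc.ne_zero hc.miss (hc.haves _)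
        (hc.haves _)
    · intro x
      rw [set_bank, if_neg (by simp), s₃ aMark (by simp)]
      exact h₂.mark_le x
    · rw [set_bank, if_neg (by simp), s₃ rL (by simp)]
      exact h₂.cutoff
  · rw [← fR, ← fD]
    exact (Ex.skip ⟨h₂, rfl, Or.inl rfl, fun hg => absurd ht (hgood hg)⟩).mono (by omega)
      fun _ h => h

end EdgeColor

namespace EdgeColor

open WordRAM

variable {I : Net} {w : ℕ} {σ : Mem}

/-! ### The whole program -/

/-- Write twice the bound on the length of the walks to its register. -/
def initCutoff : Prog :=
  setReg rL ((.const 7680 * par 1 / (par 3 + (par 2 - par 3)) + .const 1) * .const 2)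

/-- The first loop needs more rounds. -/
def pushGuard : WTerm := ltT (reg rR * .const 24 * par 2) (par 3)

/-- The second loop needs more rounds. -/
def colorGuard : WTerm := ltT (.const 2 * reg rD) (reg rR)

/-- Collect edges of `U` both of whose endpoints miss one of the two least common colors. -/
def pushLoop : Prog := .loop pushGuard (.seq (.rand rI (.const 0) (par 3)) pushBody)

/-- Color half of the collected edges. -/
def colorLoop : Prog := .loop colorGuard (.seq (.rand rI (.const 0) (reg rR)) colorBody)

/-- The algorithm. -/
def extendColoring : Prog := .seq initCutoff (.seq pushLoop colorLoop)

/-- Bound on half of the length of the walks. -/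
def Net.cutoff (I : Net) : ℕ := 7680 * I.m / max I.lam I.Δ + 1

theorem Net.Δ_pos (I : Net) : 0 < I.Δ := (Nat.zero_le _).trans_lt I.al_lt

theorem Net.lt_cutoff_mul (I : Net) : 7680 * I.m < I.cutoff * max I.lam I.Δ := by
  have hM : 0 < max I.lam I.Δ := lt_max_of_lt_right I.Δ_pos
  rw [mul_comm I.cutoff]
  exact Nat.lt_mul_div_succ _ hM

theorem Net.cutoff_le (I : Net) : I.cutoff ≤ 7680 * I.m + 1 :=
  Nat.succ_le_succ (Nat.div_le_self _ _)

/-- The array stops growing once `lam ≤ R * 24 * Δ`, so only its last edge can overshoot. -/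
theorem Net.Inv.mul_le {col₀ col mark phi : ℕ → ℕ} {R D : ℕ} (h : I.Inv col₀ col mark phi R D) :
    R * 24 * I.Δ ≤ I.lam + 24 * I.Δ := by
  rcases h.size with h' | h'
  · simp [h']
  · calc R * 24 * I.Δ ≤ (R - 1 + 1) * 24 * I.Δ := by gcongr; omega
      _ = (R - 1) * 24 * I.Δ + 24 * I.Δ := by ring
      _ ≤ _ := by omega

theorem ex_initCutoff (hf : Fits I w) (hb : Base I σ) :
    Ex w initCutoff σ 19 fun σ' => σ' = σ.set rL 0 (2 * I.cutoff) := by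
  have hΔ := I.Δ_le
  have hlam := I.lam_le
  have hw : 40000 * (I.m + 1) < 2 ^ w := by
    unfold Fits at hf; omega
  have hc := I.cutoff_le
  have hpar : ∀ i < 6, (par i).val w σ = σ 0 i := fun i hi => val_par (by omega)
  -- Truncated subtraction computes the maximum.
  have hM : I.lam + (I.Δ - I.lam) = max I.lam I.Δ := by omega
  refine Ex.setReg (v := 2 * I.cutoff) ?_ rfl
  rw [mul_comm 2, Net.cutoff, ← hM]
  rw [Net.cutoff, ← hM] at hc
  have h1 := (hpar 1 (by omega)).trans hb.num_edges
  have h2 := (hpar 2 (by omega)).trans hb.num_colors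
  have h3 := (hpar 3 (by omega)).trans hb.num_U
  refine val_mul (val_add (val_div (val_mul (val_const ?_) h1 ?_) (val_add h3 (val_sub h2 h3 ?_) ?_)
    ?_) (val_const ?_) ?_) (val_const ?_) ?_ <;> omega

theorem MemInv.val_pushGuard (hf : Fits I w) {col₀ : ℕ → ℕ} {q : ℕ} (h : MemInv I col₀ q σ) :
    pushGuard.val w σ = if σ rR 0 * 24 * I.Δ < I.lam then 1 else 0 := by
  have hΔ := I.Δ_le
  have hlam := I.lam_le
  have hw : 40000 * (I.m + 1) < 2 ^ w := by
    unfold Fits at hf; omega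
  have h₁ := h.inv.mul_le
  have h₂ := h.inv.R_le
  have hpar : ∀ i < 6, (par i).val w σ = σ 0 i := fun i hi => val_par (by omega)
  exact val_lt (by omega) (val_mul (val_mul (val_reg _) (val_const (by omega)) (by omega))
    ((hpar 2 (by omega)).trans h.base.num_colors) (by omega))
    ((hpar 3 (by omega)).trans h.base.num_U)

theorem MemInv.val_colorGuard (hf : Fits I w) {col₀ : ℕ → ℕ} {q : ℕ} (h : MemInv I col₀ q σ) :
    colorGuard.val w σ = if 2 * σ rD 0 < σ rR 0 then 1 else 0 := by
  have hw : 40000 * (I.m + 1) < 2 ^ w := by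
    unfold Fits at hf; omega
  have h₂ := h.inv.R_le
  have h₃ := h.inv.count_le
  exact val_lt (by omega) (val_mul (val_const (by omega)) (val_reg _) (by omega)) (val_reg _)

theorem MemInv.set_rI {col₀ : ℕ → ℕ} {q : ℕ} (h : MemInv I col₀ q σ) (x : ℕ) :
    MemInv I col₀ q (σ.set rI 0 x) :=
  h.congr (bs := [rI]) ((Same.refl _ _).set (by simp) _ _) (by simp)

/-- Here `r` bounds the number of edges that still have to be collected; a good sample lowers it by
one and a bad one leaves the array as it is or also extends it. -/
theorem failProb_pushLoop (hf : Fits I w) {col₀ : ℕ → ℕ} {q r N B b : ℕ} (h : MemInv I col₀ q σ)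
    (hq : 7680 * I.m < q * max I.lam I.Δ) (hq' : q ≤ 7680 * I.m + 1)
    (hr : I.lam ≤ (σ rR 0 + r) * 24 * I.Δ) (hB : N * (4100 * (q + 1)) + 10 + b ≤ B) :
    failProb (run w pushLoop σ B) b
      (fun σ' => MemInv I col₀ q σ' ∧ I.lam ≤ σ' rR 0 * 24 * I.Δ) ≤
      ENNReal.ofReal (2 ^ r * (7 / 8) ^ N) := by
  classical
  refine (failProb_mono ?_).trans (failProb_run_loop
    (Inv := fun r σ => MemInv I col₀ q σ ∧ I.lam ≤ (σ rR 0 + r) * 24 * I.Δ)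
    (kb := 4000 * (q + 1)) ?_ ?_ (N := N) ⟨h, hr⟩ ?_)
  · rintro σ' ⟨⟨r, h', -⟩, hg⟩
    rw [h'.val_pushGuard hf] at hg
    refine ⟨h', ?_⟩
    by_contra hcon
    rw [if_pos (by omega)] at hg
    omega
  · rintro σ' ⟨h', hle⟩
    rw [h'.val_pushGuard hf, if_neg (by simpa using hle)]
  · rintro r σ' ⟨h', hle⟩ hg
    have hlt : σ' rR 0 * 24 * I.Δ < I.lam := by
      by_contra hcon
      rw [h'.val_pushGuard hf, if_neg hcon] at hg
      exact hg rfl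
    have h3 : (par 3).val w σ' = I.lam := by
      rw [val_par (hf.const (by omega)), h'.base.num_U]
    have h0 : (WTerm.const 0).val w σ' = 0 := val_const (by have := hf.one_lt; omega)
    rw [h3, h0]
    refine ⟨by omega, _, Finset.filter_subset _ _, h'.inv.card_goodSample h'.ds.proper
      (c := fun y => σ' 6 (y * I.Δ + 0)) hq hlt ?_, fun x hx => ?_⟩
    · intro a ha ha0 y hy
      exact h'.ds.first_missing (I.U_lt a ha) ha0 hy
    · have e3 : (σ'.set rI 0 x) 3 = σ' 3 := Mem.set_bank_ne _ _ _ (by simp)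
      have e6 : (σ'.set rI 0 x) 6 = σ' 6 := Mem.set_bank_ne _ _ _ (by simp)
      have eM : (σ'.set rI 0 x) aMark = σ' aMark := Mem.set_bank_ne _ _ _ (by simp)
      have eR : (σ'.set rI 0 x) rR = σ' rR := Mem.set_bank_ne _ _ _ (by simp)
      refine (ex_pushBody hf (h'.set_rI x) (a := x) (by simp [set_bank]) hx (by rwa [eR])
        hq').mono le_rfl ?_
      rw [e3, e6, eM, eR]
      rintro σ₁ ⟨h₁, hR, hgood⟩
      refine ⟨fun hxS => ⟨h₁, ?_⟩, h₁, hle.trans ?_⟩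
      · rw [hgood (Finset.mem_filter.1 hxS).2]
        refine hle.trans (le_of_eq ?_)
        ring
      · gcongr
        omega
  · have : pushGuard.size + (1 + (WTerm.const 0).size + (par 3).size) + 4000 * (q + 1) ≤
        4100 * (q + 1) := by
      change 10 + (1 + 1 + 2) + 4000 * (q + 1) ≤ _
      omega
    exact (Nat.add_le_add_right (Nat.add_le_add_right (Nat.mul_le_mul_left N this) 10) b).trans hB

/-- Here `r` bounds `R - 2 * D`. A success lowers this difference even by two. At the end `R ≤ 2 *
D`, which turns the factor `24` into `48`. -/
theorem failProb_colorLoop (hf : Fits I w) {col₀ : ℕ → ℕ} {q r N B b : ℕ} (h : MemInv I col₀ q σ)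
    (hq : 7680 * I.m < q * max I.lam I.Δ) (hq' : q ≤ 7680 * I.m + 1) (hq0 : 0 < q)
    (hlam : I.lam ≤ σ rR 0 * 24 * I.Δ) (hr : σ rR 0 ≤ r) (hB : N * (4100 * (q + 1)) + 7 + b ≤ B) :
    failProb (run w colorLoop σ B) b
      (fun σ' => MemInv I col₀ q σ' ∧ I.lam ≤ σ' rD 0 * 48 * I.Δ) ≤
      ENNReal.ofReal (2 ^ r * (7 / 8) ^ N) := by
  classical
  refine (failProb_mono ?_).trans (failProb_run_loop
    (Inv := fun r σ => MemInv I col₀ q σ ∧ I.lam ≤ σ rR 0 * 24 * I.Δ ∧ σ rR 0 ≤ 2 * σ rD 0 + r)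
    (kb := 4000 * (q + 1)) ?_ ?_ (N := N) ⟨h, hlam, by omega⟩ ?_)
  · rintro σ' ⟨⟨r, h', hl, -⟩, hg⟩
    rw [h'.val_colorGuard hf] at hg
    have hle : σ' rR 0 ≤ 2 * σ' rD 0 := by
      by_contra hcon
      rw [if_pos (by omega)] at hg
      omega
    refine ⟨h', hl.trans ?_⟩
    calc σ' rR 0 * 24 * I.Δ ≤ 2 * σ' rD 0 * 24 * I.Δ := by gcongr
      _ = _ := by ring
  · rintro σ' ⟨h', -, hle⟩
    rw [h'.val_colorGuard hf, if_neg (by omega)]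
  · rintro r σ' ⟨h', hl, hle⟩ hg
    have hlt : 2 * σ' rD 0 < σ' rR 0 := by
      by_contra hcon
      rw [h'.val_colorGuard hf, if_neg hcon] at hg
      exact hg rfl
    have h0 : (WTerm.const 0).val w σ' = 0 := val_const (by have := hf.one_lt; omega)
    rw [val_reg, h0]
    refine ⟨by omega, _, Finset.filter_subset _ _, h'.inv.card_goodEdge h'.ds.proper hq hl hlt,
      fun x hx => ?_⟩
    have e3 : (σ'.set rI 0 x) 3 = σ' 3 := Mem.set_bank_ne _ _ _ (by simp)
    have eP : (σ'.set rI 0 x) aPhi = σ' aPhi := Mem.set_bank_ne _ _ _ (by simp)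
    have eR : (σ'.set rI 0 x) rR = σ' rR := Mem.set_bank_ne _ _ _ (by simp)
    have eD : (σ'.set rI 0 x) rD = σ' rD := Mem.set_bank_ne _ _ _ (by simp)
    refine (ex_colorBody hf (h'.set_rI x) (p := x) (by simp [set_bank]) (by rwa [eR])
      hq' hq0).mono le_rfl ?_
    rw [e3, eP, eR, eD]
    rintro σ₁ ⟨h₁, hR, hD, hgood⟩
    rw [hR]
    refine ⟨fun hxS => ⟨h₁, hl, ?_⟩, h₁, hl, by omega⟩
    have := hgood (Finset.mem_filter.1 hxS).2
    omega
  · have : colorGuard.size + (1 + (WTerm.const 0).size + (reg rR).size) + 4000 * (q + 1) ≤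
        4100 * (q + 1) := by
      change 7 + (1 + 1 + 2) + 4000 * (q + 1) ≤ _
      omega
    exact (Nat.add_le_add_right (Nat.add_le_add_right (Nat.mul_le_mul_left N this) 7) b).trans hB

/-- Both loops get the same number `N` of rounds and the same bound `r` on the successes they need,
which explains the leading factor `2`. The `36` extra steps are `19` for the cutoff and `10` and `7`
for the final tests of the guards. -/
theorem failProb_extendColoring (hf : Fits I w) {N B : ℕ} (hb : Base I σ) (hd : DS I σ)
    (hinv : I.Inv (σ 3) (σ 3) (σ aMark) (σ aPhi) 0 0) (hmark : ∀ x, σ aMark x ≤ 1)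
    (hR : σ rR 0 = 0) (hD : σ rD 0 = 0) (hB : N * (8200 * (I.cutoff + 1)) + 36 ≤ B) :
    failProb (run w extendColoring σ B) 0
      (fun σ' => Base I σ' ∧ DS I σ' ∧ ∃ mark phi R D, I.Inv (σ 3) (σ' 3) mark phi R D ∧
        I.lam ≤ D * 48 * I.Δ) ≤
      ENNReal.ofReal (2 * (2 ^ (I.lam / (24 * I.Δ) + 1) * (7 / 8) ^ N)) := by
  have hΔ := I.Δ_pos
  set r := I.lam / (24 * I.Δ) + 1 with hr
  set σ₁ := σ.set rL 0 (2 * I.cutoff) with hσ₁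
  obtain ⟨X, hX⟩ : ∃ X, N * (4100 * (I.cutoff + 1)) = X := ⟨_, rfl⟩
  rw [show N * (8200 * (I.cutoff + 1)) = 2 * (N * (4100 * (I.cutoff + 1))) by ring, hX] at hB
  have hs : Same [rL] σ σ₁ := (Same.refl _ _).set (by simp) _ _
  have hlamr : I.lam ≤ r * 24 * I.Δ := by
    have := Nat.lt_mul_div_succ I.lam (show 0 < 24 * I.Δ by omega)
    rw [hr, mul_assoc, mul_comm]
    exact this.le
  have h₁ : MemInv I (σ 3) I.cutoff σ₁ := by
    refine ⟨hb.congr hs (by simp), hd.congr hs (by simp), ?_, ?_, by simp [hσ₁, set_bank]⟩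
    · rw [hs 3 (by simp), hs aMark (by simp), hs aPhi (by simp), hs rR (by simp),
        hs rD (by simp), hR, hD]
      exact hinv
    · rw [hs aMark (by simp)]
      exact hmark
  have hR₁ : σ₁ rR 0 = 0 := by rw [hs rR (by simp), hR]
  rw [extendColoring, run, two_mul, ENNReal.ofReal_add (by positivity) (by positivity)]
  refine (failProb_andThen (b₁ := 2 * X + 17)
    (Q₁ := fun σ' => σ' = σ₁) (ε := ENNReal.ofReal (2 ^ r * (7 / 8) ^ N) +
      ENNReal.ofReal (2 ^ r * (7 / 8) ^ N)) ?_).trans ?_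
  · rintro _ B₁ hB₁ rfl
    rw [run]
    refine (failProb_andThen (b₁ := X + 7)
      (Q₁ := fun σ' => MemInv I (σ 3) I.cutoff σ' ∧ I.lam ≤ σ' rR 0 * 24 * I.Δ)
      (ε := ENNReal.ofReal (2 ^ r * (7 / 8) ^ N)) ?_).trans ?_
    · rintro σ₂ B₂ hB₂ ⟨h₂, hl₂⟩
      refine (failProb_mono ?_).trans (failProb_colorLoop hf h₂ I.lt_cutoff_mul I.cutoff_le
        (Nat.succ_pos _) hl₂ (r := r) (N := N) ?_ (by rw [hX]; omega))
      · rintro σ₃ ⟨h₃, hl₃⟩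
        exact ⟨h₃.base, h₃.ds, _, _, _, _, h₃.inv, hl₃⟩
      -- The collected array has at most `lam / (24Δ) + 1` edges, so the second loop needs no more
      -- successes than the first one.
      · have := h₂.inv.mul_le
        rw [mul_assoc] at this
        have h' := (Nat.le_div_iff_mul_le (show 0 < 24 * I.Δ by omega)).2 this
        rwa [Nat.add_div_right _ (by omega)] at h'
    · gcongr
      exact failProb_pushLoop hf h₁ I.lt_cutoff_mul I.cutoff_le (by rwa [hR₁, zero_add])
        (by rw [hX]; omega)
  · rw [failProb_of_ex (ex_initCutoff hf hb) (by omega), zero_add]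

end EdgeColor

namespace EdgeColor

open WordRAM

/-! ### Graphs and nets -/

theorem Represents.mem_iff {n m Δ : ℕ} {G : SimpleGraph (Fin n)} [DecidableRel G.Adj]
    {ν : Fin m ≃ G.edgeSet} {χ : PartialColoring G Δ} {σ : Mem} (h : Represents G ν χ σ)
    (i : Fin m) (u : Fin n) : u ∈ (ν i : Sym2 (Fin n)) ↔ σ 1 i = u ∨ σ 2 i = u := by
  obtain ⟨x, y, he, hx, hy⟩ := h.endpoints i
  simp only [bFst, bSnd] at hx hy
  rw [he, Sym2.mem_iff, hx, hy, ← Fin.ext_iff, ← Fin.ext_iff, eq_comm, @eq_comm _ u y]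

theorem Represents.degree_eq {n m Δ : ℕ} {G : SimpleGraph (Fin n)} [DecidableRel G.Adj]
    {ν : Fin m ≃ G.edgeSet} {χ : PartialColoring G Δ} {σ : Mem} (h : Represents G ν χ σ)
    (u : Fin n) :
    G.degree u = ((Finset.range m).filter fun i => σ 1 i = u ∨ σ 2 i = u).card := by
  classical
  rw [← G.card_incidenceFinset_eq_degree]
  symm
  refine Finset.card_bij (fun i hi => (ν ⟨i, Finset.mem_range.1 (Finset.mem_filter.1 hi).1⟩).1)
    ?_ ?_ ?_
  · intro i hi
    rw [SimpleGraph.mem_incidenceFinset]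
    exact ⟨(ν _).2, (h.mem_iff _ u).2 (Finset.mem_filter.1 hi).2⟩
  · intro i hi j hj hij
    simpa using ν.injective (Subtype.ext hij)
  · intro e he
    rw [SimpleGraph.mem_incidenceFinset] at he
    refine ⟨ν.symm ⟨e, he.1⟩, Finset.mem_filter.2 ⟨Finset.mem_range.2 (ν.symm _).2, ?_⟩, by simp⟩
    rw [← h.mem_iff]
    simpa using he.2

/-- The net is read off the memory itself, so its data agree definitionally with the banks; the
sides come from a proper vertex coloring with two colors. -/
theorem IsInput.exists_net {n m Δ : ℕ} {G : SimpleGraph (Fin n)} [DecidableRel G.Adj]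
    {ν : Fin m ≃ G.edgeSet} {χ : PartialColoring G Δ} {U : Finset G.edgeSet} {α β : Fin Δ}
    {σ : Mem} (h : IsInput G ν χ U α β σ) (hG : G.IsBipartite) (hΔ : G.maxDegree = Δ)
    (hU : IsEdgeMatching U) (hαβ : AreLeastCommon χ α β) :
    ∃ I : Net, I.n = n ∧ I.m = m ∧ I.Δ = Δ ∧ I.lam = U.card ∧ I.fst = σ 1 ∧ I.snd = σ 2 ∧
      I.deg = σ 9 ∧ I.U = σ 8 ∧ I.al = α ∧ I.be = β := by
  obtain ⟨C⟩ := hG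
  obtain ⟨f, hfinj, hfU, hf⟩ := h.list_U
  have hpos : 0 < Δ := (Nat.zero_le _).trans_lt α.2
  have hends := h.rep.endpoints
  have hdeg : ∀ u (hu : u < n), σ 9 u = G.degree ⟨u, hu⟩ := fun u hu => h.rep.degree ⟨u, hu⟩
  have hdm : ∀ u : Fin n, G.degree u ≤ m := fun u => by
    rw [h.rep.degree_eq u]
    exact (Finset.card_filter_le _ _).trans (by simp)
  refine ⟨⟨n, m, Δ, U.card, σ 1, σ 2, σ 9, σ 8, α, β,
    fun x => if hx : x < n then C ⟨x, hx⟩ = 0 else False, ?_, ?_, ?_, ?_, ?_, α.2, β.2, ?_, ?_, ?_,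
    ?_, ?_⟩, rfl, rfl, rfl, rfl, rfl, rfl, rfl, rfl, rfl, rfl⟩
  · intro i hi
    obtain ⟨x, y, -, hx, -⟩ := hends ⟨i, hi⟩
    exact hx.trans_lt x.2
  · intro i hi
    obtain ⟨x, y, -, -, hy⟩ := hends ⟨i, hi⟩
    exact hy.trans_lt y.2
  · intro i hi
    obtain ⟨x, y, he, hx, hy⟩ := hends ⟨i, hi⟩
    have hadj : G.Adj x y := by
      rw [← SimpleGraph.mem_edgeSet, ← he]
      exact (ν _).2
    have hne := C.valid hadj
    simp only [bFst, bSnd] at hx hy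
    simp only [hx, hy, x.2, y.2, dif_pos, Fin.eta, ne_eq, decide_eq_decide]
    have h₁ := (C x).2
    have h₂ := (C y).2
    -- In `Fin 2`, agreeing on being `0` means being equal.
    intro hiff
    refine hne (Fin.ext ?_)
    simp only [Fin.ext_iff, Fin.val_zero] at hiff
    omega
  · intro u hu
    rw [hdeg u hu, h.rep.degree_eq]
  · intro u hu
    rw [hdeg u hu, ← hΔ]
    exact G.degree_le_maxDegree _
  · intro h2 he
    exact hαβ.1 h2 (Fin.ext he)
  · intro a ha
    exact (hf ⟨a, ha⟩).trans_lt (f _).2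
  · intro a ha b hb x hax hbx
    have ha' := hf ⟨a, ha⟩
    have hb' := hf ⟨b, hb⟩
    simp only [bU] at ha' hb'
    rw [ha'] at hax
    rw [hb'] at hbx
    have hxn : x < n := by
      obtain ⟨y, z, -, hy, hz⟩ := hends (f ⟨a, ha⟩)
      simp only [bFst, bSnd] at hy hz
      rcases hax with rfl | rfl <;> omega
    by_contra hab
    refine hU _ (hfU ⟨a, ha⟩) _ (hfU ⟨b, hb⟩) (fun he => hab ?_) ⟨⟨x, hxn⟩,
      (h.rep.mem_iff _ ⟨x, hxn⟩).2 hax, (h.rep.mem_iff _ ⟨x, hxn⟩).2 hbx⟩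
    simpa using hfinj (ν.injective he)
  · simpa using Fintype.card_le_of_injective f hfinj
  -- A vertex of maximum degree has `Δ` incident edges, whence `Δ ≤ m`; there is such a vertex
  -- because `Δ` is positive.
  · rcases isEmpty_or_nonempty (Fin n) with hn | hn
    · rw [← hΔ, SimpleGraph.maxDegree_of_subsingleton] at hpos
      omega
    · obtain ⟨u, hu⟩ := G.exists_maximal_degree_vertex
      rw [← hΔ, hu]
      exact hdm u

/-- The net describes the graph. -/
structure Net.Models (I : Net) (G : SimpleGraph (Fin I.n)) [DecidableRel G.Adj]
    (ν : Fin I.m ≃ G.edgeSet) : Prop where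
  endpoints : ∀ i : Fin I.m, ∃ x y : Fin I.n, (ν i : Sym2 (Fin I.n)) = s(x, y) ∧
    I.fst i = x ∧ I.snd i = y
  degree : ∀ u : Fin I.n, I.deg u = G.degree u

section Models

variable {I : Net} {G : SimpleGraph (Fin I.n)} [DecidableRel G.Adj] {ν : Fin I.m ≃ G.edgeSet}
  {χ : PartialColoring G I.Δ} {σ : Mem} {col : ℕ → ℕ}

theorem Net.Models.mem_iff (h : I.Models G ν) (i : Fin I.m) (u : Fin I.n) :
    u ∈ (ν i : Sym2 (Fin I.n)) ↔ I.Inc i u := by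
  obtain ⟨x, y, he, hx, hy⟩ := h.endpoints i
  rw [he, Sym2.mem_iff, Net.Inc, hx, hy, ← Fin.ext_iff, ← Fin.ext_iff, eq_comm, @eq_comm _ u y]

theorem colorCode_eq_succ {Δ : ℕ} {o : Option (Fin Δ)} {c : Fin Δ} :
    colorCode o = c + 1 ↔ o = some c := by
  cases o <;> simp [colorCode, Fin.ext_iff]

theorem colorCode_eq_zero {Δ : ℕ} {o : Option (Fin Δ)} : colorCode o = 0 ↔ o = none := by
  cases o <;> simp [colorCode]

theorem colorCode_le {Δ : ℕ} (o : Option (Fin Δ)) : colorCode o ≤ Δ := by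
  cases o with
  | none => simp [colorCode]
  | some c => exact c.2

theorem Net.Models.mem_miss (h : I.Models G ν) (hcol : ∀ i : Fin I.m, col i = colorCode (χ (ν i)))
    (u : Fin I.n) (c : Fin I.Δ) : c ∈ miss χ u ↔ I.Misses col u c := by
  constructor
  · intro hc i hi hiu he
    exact hc (ν ⟨i, hi⟩) ((h.mem_iff ⟨i, hi⟩ u).2 hiu)
      (colorCode_eq_succ.1 ((hcol ⟨i, hi⟩).symm.trans he))
  · intro hc e heu he
    obtain ⟨i, rfl⟩ := ν.surjective e
    exact hc i i.2 ((h.mem_iff i u).1 heu) ((hcol i).trans (colorCode_eq_succ.2 he))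

theorem Net.Models.ds (h : I.Models G ν) (hr : Represents G ν χ σ) : DS I σ := by
  have hinc : ∀ u c i, c < I.Δ → i < I.m → I.Inc i u → σ 3 i = c + 1 →
      σ 4 (u * I.Δ + c) = i + 1 := by
    intro u c i hc hi hiu he
    have hu : u < I.n := by
      rcases hiu with rfl | rfl
      exacts [I.fst_lt i hi, I.snd_lt i hi]
    exact hr.inc_some ⟨u, hu⟩ ⟨c, hc⟩ ⟨i, hi⟩ ((h.mem_iff ⟨i, hi⟩ ⟨u, hu⟩).2 hiu)
      (colorCode_eq_succ.1 ((hr.color ⟨i, hi⟩).symm.trans he))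
  refine ⟨fun i hi => (hr.color ⟨i, hi⟩).trans_le (colorCode_le _), hinc, ?_, ?_⟩
  · intro u hu c hc hm
    exact hr.inc_none ⟨u, hu⟩ ⟨c, hc⟩ ((h.mem_miss hr.color ⟨u, hu⟩ ⟨c, hc⟩).2 hm)
  · intro u hu
    refine ⟨fun j hj => ?_, fun c hc h0 hd => ?_⟩
    · obtain ⟨c, hc, hd, hl, hp⟩ := hr.miss_sound ⟨u, hu⟩ j hj
      refine ⟨c, c.2, hr.inc_none ⟨u, hu⟩ c hc, ?_, hl, hp⟩
      exact hd.trans_eq (h.degree ⟨u, hu⟩).symm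
    · refine hr.miss_complete ⟨u, hu⟩ ⟨c, hc⟩ ?_ (hd.trans_eq (h.degree ⟨u, hu⟩))
      rw [h.mem_miss hr.color]
      intro i hi hiu he
      have := hinc u c i hc hi hiu he
      omega

/-- The coloring is decoded from bank `3`. Its entries are at most `Δ`, so the default value `none`
is taken only for entry `0`. -/
theorem Net.Models.exists_represents (h : I.Models G ν) (hb : Base I σ) (hd : DS I σ) :
    ∃ χ : PartialColoring G I.Δ, IsProper χ ∧ Represents G ν χ σ := by
  let χ : PartialColoring G I.Δ := fun e =>
    if hx : 0 < σ 3 (ν.symm e) ∧ σ 3 (ν.symm e) ≤ I.Δ then some ⟨σ 3 (ν.symm e) - 1, by omega⟩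
    else none
  have hcol : ∀ i : Fin I.m, σ 3 i = colorCode (χ (ν i)) := by
    intro i
    have hle := hd.le i i.2
    simp only [χ, Equiv.symm_apply_apply]
    split_ifs with hx
    · simp only [colorCode]; omega
    · simp only [colorCode]; omega
  refine ⟨χ, ?_, ?_⟩
  · rintro e f hne ⟨v, hve, hvf⟩ c ⟨he, hf⟩
    obtain ⟨i, rfl⟩ := ν.surjective e
    obtain ⟨j, rfl⟩ := ν.surjective f
    have hi := (hcol i).trans (colorCode_eq_succ.2 he)
    have hj := (hcol j).trans (colorCode_eq_succ.2 hf)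
    exact hne (congrArg ν (Fin.ext (hd.proper i i.2 j j.2 v ((h.mem_iff i v).1 hve)
      ((h.mem_iff j v).1 hvf) (by omega) (by omega))))
  · refine ⟨hb.num_vertices, hb.num_edges, hb.num_colors, ?_, ?_, hcol, ?_, ?_, ?_, ?_⟩
    · intro i
      obtain ⟨x, y, he, hx, hy⟩ := h.endpoints i
      exact ⟨x, y, he, (hb.fst i i.2).trans hx, (hb.snd i i.2).trans hy⟩
    · exact fun u => (hb.deg u u.2).trans (h.degree u)
    · exact fun u c i hu hc => hd.inc_some u c i c.2 i.2 ((h.mem_iff i u).1 hu)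
        ((hcol i).trans (colorCode_eq_succ.2 hc))
    · exact fun u c hc => hd.inc_none u u.2 c c.2 ((h.mem_miss hcol u c).1 hc)
    · intro u j hj
      obtain ⟨c, hc, h0, hcd, hl, hp⟩ := (hd.row u u.2).1 j hj
      exact ⟨⟨c, hc⟩, (h.mem_miss hcol u ⟨c, hc⟩).2 ((hd.inc_eq_zero u.2 hc).1 h0),
        hcd.trans_eq (h.degree u), hl, hp⟩
    · intro u c hc hcd
      exact (hd.row u u.2).2 c c.2 (hd.inc_none u u.2 c c.2 ((h.mem_miss hcol u c).1 hc))
        (hcd.trans_eq (h.degree u).symm)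

end Models

theorem colorCount_eq_card {n m Δ : ℕ} {G : SimpleGraph (Fin n)} (ν : Fin m ≃ G.edgeSet)
    (χ : PartialColoring G Δ) (c : Fin Δ) :
    colorCount χ c = (Finset.univ.filter fun i => χ (ν i) = some c).card := by
  rw [colorCount, ← Set.ncard_preimage_of_injective_subset_range ν.injective
    (by simp [ν.range_eq_univ]), ← Set.ncard_coe_finset]
  congr 1
  ext i
  simp

/-- All colors except possibly one are at least as frequent as `γ`. Summing over the colors costs
`m`, and the exceptional color at most another `m`. -/
theorem AreLeastCommon.mul_colorCount_le {n m Δ : ℕ} {G : SimpleGraph (Fin n)}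
    (ν : Fin m ≃ G.edgeSet) {χ : PartialColoring G Δ} {α β : Fin Δ} (h : AreLeastCommon χ α β)
    {γ : Fin Δ} (hγ : γ = α ∨ γ = β) : Δ * colorCount χ γ ≤ 2 * m := by
  classical
  have hsum : ∑ c, colorCount χ c ≤ m := by
    simp only [colorCount_eq_card ν, Finset.card_filter]
    rw [Finset.sum_comm]
    refine (Finset.sum_le_card_nsmul _ _ 1 fun i _ => ?_).trans (by simp)
    rw [← Finset.card_filter]
    exact Finset.card_le_one.2 fun a ha b hb => by
      rw [Finset.mem_filter] at ha hb
      exact Option.some_injective _ (ha.2.symm.trans hb.2)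
  have hle : colorCount χ γ ≤ m := (Finset.single_le_sum (f := fun c => colorCount χ c)
    (fun _ _ => Nat.zero_le _) (Finset.mem_univ γ)).trans hsum
  obtain ⟨δ, hδ⟩ : ∃ δ, ∀ c, c ≠ δ → colorCount χ γ ≤ colorCount χ c := by
    rcases hγ with rfl | rfl
    · refine ⟨β, fun c hc => ?_⟩
      by_cases hcγ : c = γ
      · rw [hcγ]
      · exact (h.2 c hcγ hc).1
    · refine ⟨α, fun c hc => ?_⟩
      by_cases hcγ : c = γ
      · rw [hcγ]
      · exact (h.2 c hc hcγ).2
  calc Δ * colorCount χ γ = ∑ _c : Fin Δ, colorCount χ γ := by simp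
    _ ≤ ∑ c, (colorCount χ c + if c = δ then colorCount χ γ else 0) := by
        refine Finset.sum_le_sum fun c _ => ?_
        split_ifs with hc
        · omega
        · exact (hδ c hc).trans le_self_add
    _ = ∑ c, colorCount χ c + colorCount χ γ := by simp [Finset.sum_add_distrib]
    _ ≤ 2 * m := by omega

/-- Each edge of color `c` supplies the color to its two endpoints only. -/
theorem Net.card_haves_le (I : Net) (col : ℕ → ℕ) (c : ℕ) :
    (I.haves col c).card ≤ 2 * ((Finset.range I.m).filter fun i => col i = c + 1).card := by
  classical
  have hsub : I.haves col c ⊆ ((Finset.range I.m).filter fun i => col i = c + 1).biUnion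
      fun i => {I.fst i, I.snd i} := by
    intro x hx
    rw [mem_haves] at hx
    have hx2 := hx.2
    unfold Misses at hx2
    push Not at hx2
    obtain ⟨i, hi, hix, hc⟩ := hx2
    refine Finset.mem_biUnion.2 ⟨i, Finset.mem_filter.2 ⟨Finset.mem_range.2 hi, hc⟩, ?_⟩
    rcases hix with rfl | rfl <;> simp
  refine (Finset.card_le_card hsub).trans (Finset.card_biUnion_le.trans ?_)
  refine (Finset.sum_le_card_nsmul _ _ 2 fun i _ => Finset.card_le_two).trans ?_
  rw [smul_eq_mul, mul_comm]

theorem Net.mul_card_haves_le {I : Net} {G : SimpleGraph (Fin I.n)} (ν : Fin I.m ≃ G.edgeSet)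
    {χ : PartialColoring G I.Δ} {α β γ : Fin I.Δ} (h : AreLeastCommon χ α β)
    (hγ : γ = α ∨ γ = β) {col : ℕ → ℕ} (hcol : ∀ i : Fin I.m, col i = colorCode (χ (ν i))) :
    I.Δ * (I.haves col γ).card ≤ 4 * I.m := by
  have h₁ := h.mul_colorCount_le ν hγ
  have h₂ : ((Finset.range I.m).filter fun i => col i = γ + 1).card = colorCount χ γ := by
    rw [colorCount_eq_card ν, Finset.card_filter, Finset.card_filter,
      ← Fin.sum_univ_eq_sum_range (fun i => if col i = γ + 1 then 1 else 0)]
    refine Finset.sum_congr rfl fun i _ => ?_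
    simp only [hcol i, colorCode_eq_succ]
  calc I.Δ * (I.haves col γ).card ≤ I.Δ * (2 * colorCount χ γ) := by
        rw [← h₂]; exact Nat.mul_le_mul_left _ (I.card_haves_le col γ)
    _ = 2 * (I.Δ * colorCount χ γ) := by ring
    _ ≤ 4 * I.m := by omega

end EdgeColor

/-! ### Word length, running time and success probability. -/

namespace EdgeColor

open WordRAM

/-- There is an edge, so `2 ≤ n`, and a power of `n` dominates the constant: the numbers involved
are `O(n ^ 2)` with a factor below `2 ^ 18 ≤ n ^ 18`, which gives the exponent 20. -/
theorem Net.Models.fits {I : Net} {G : SimpleGraph (Fin I.n)} [DecidableRel G.Adj]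
    (ν : Fin I.m ≃ G.edgeSet) (hΔ : G.maxDegree = I.Δ) {w : ℕ} (hw : I.n ^ 20 ≤ 2 ^ w) :
    2 ≤ I.n ∧ Fits I w := by
  have hpos := I.Δ_pos
  have hm := hpos.trans_le I.Δ_le
  have hn : 2 ≤ I.n := by
    have h₁ := I.fst_lt 0 hm
    have h₂ := I.snd_lt 0 hm
    have h₃ : I.fst 0 ≠ I.snd 0 := fun h => I.side_ne 0 hm (by rw [h])
    omega
  have hΔn : I.Δ ≤ I.n := by
    have : Nonempty (Fin I.n) := ⟨⟨0, by omega⟩⟩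
    simpa [hΔ] using G.maxDegree_lt_card_verts.le
  have hmn : I.m ≤ I.n * I.n := by
    have h₁ := Fintype.card_congr ν
    have h₂ := G.card_edgeFinset_le_card_choose_two
    rw [SimpleGraph.edgeFinset_card, ← h₁, Fintype.card_fin, Fintype.card_fin] at h₂
    rw [Nat.choose_two_right] at h₂
    exact h₂.trans ((Nat.div_le_self _ _).trans (Nat.mul_le_mul_left _ (Nat.sub_le _ _)))
  refine ⟨hn, ?_⟩
  have h₁ : I.n * I.Δ ≤ I.n * I.n := Nat.mul_le_mul_left _ hΔn
  have h₂ : I.n * 1 ≤ I.n * I.n := Nat.mul_le_mul_left _ (by omega)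
  calc 40000 * (I.n * I.Δ + I.n + I.m + 1) < 2 ^ 18 * (I.n * I.n) := by omega
    _ ≤ I.n ^ 18 * (I.n * I.n) := by gcongr
    _ = I.n ^ 20 := by ring
    _ ≤ 2 ^ w := hw

theorem IsInput.base {I : Net} {G : SimpleGraph (Fin I.n)} [DecidableRel G.Adj]
    {ν : Fin I.m ≃ G.edgeSet} {χ : PartialColoring G I.Δ} {U : Finset G.edgeSet} {α β : Fin I.Δ}
    {σ : Mem} (h : IsInput G ν χ U α β σ) (hlam : I.lam = U.card) (hfst : I.fst = σ 1)
    (hsnd : I.snd = σ 2) (hdeg : I.deg = σ 9) (hU : I.U = σ 8) (hal : I.al = α)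
    (hbe : I.be = β) : Base I σ :=
  ⟨h.rep.num_vertices, h.rep.num_edges, h.rep.num_colors, h.card_U.trans hlam.symm,
    h.first_color.trans hal.symm, h.second_color.trans hbe.symm, fun _ _ => by rw [hfst],
    fun _ _ => by rw [hsnd], fun _ _ => by rw [hU], fun _ _ => by rw [hdeg]⟩

theorem Net.inv_zero {I : Net} {col mark phi : ℕ → ℕ} (hmark : ∀ x, mark x = 0)
    (hU : ∀ a < I.lam, col (I.U a) = 0) (hal : I.Δ * (I.haves col I.al).card ≤ 4 * I.m)
    (hbe : I.Δ * (I.haves col I.be).card ≤ 4 * I.m) : I.Inv col col mark phi 0 0 := by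
  refine ⟨fun _ _ h => h, ?_, ?_, ?_, ?_, ?_, by simp, fun a ha h => absurd (hU a ha) h,
    by omega, by omega, Or.inl rfl⟩
  · simp [Net.marked, hmark]
  all_goals intro j hj; exact absurd hj (Nat.not_lt_zero _)

/-- Number of rounds after which a loop with `r` required successes fails with probability at
most `n ^ (-a) / 2`. -/
noncomputable def rounds (a : ℝ) (n r : ℕ) : ℕ := ⌈8 * (r + 1 + a * Real.log n)⌉₊

/-- It rests on `2 ≤ e` and `7 / 8 ≤ exp (-1 / 8)`: the rounds beyond `8 * (r + 1)` beat the `r + 1`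
doublings and leave `exp (-a * log n)`. -/
theorem two_pow_mul_rounds_le {a : ℝ} {n : ℕ} (hn : 0 < n) (r : ℕ) :
    2 * (2 ^ r * (7 / 8 : ℝ) ^ rounds a n r) ≤ (n : ℝ) ^ (-a) := by
  have hN : 8 * (r + 1 + a * Real.log n) ≤ (rounds a n r : ℝ) := Nat.le_ceil _
  have h₁ : (2 : ℝ) ^ (r + 1) ≤ Real.exp (r + 1) := by
    have h := pow_le_pow_left₀ (by norm_num) (show (2 : ℝ) ≤ Real.exp 1 by
      have := Real.add_one_le_exp (1 : ℝ); linarith) (r + 1)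
    rwa [← Real.exp_nat_mul, mul_one, Nat.cast_add_one] at h
  have h₂ : (7 / 8 : ℝ) ^ rounds a n r ≤ Real.exp (rounds a n r * (-1 / 8)) := by
    rw [Real.exp_nat_mul]
    refine pow_le_pow_left₀ (by norm_num) ?_ _
    have := Real.add_one_le_exp (-1 / 8 : ℝ)
    linarith
  calc 2 * (2 ^ r * (7 / 8 : ℝ) ^ rounds a n r) = 2 ^ (r + 1) * (7 / 8 : ℝ) ^ rounds a n r := by
        ring
    _ ≤ Real.exp (r + 1) * Real.exp (rounds a n r * (-1 / 8)) := by gcongr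
    _ = Real.exp (r + 1 + rounds a n r * (-1 / 8)) := (Real.exp_add _ _).symm
    _ ≤ Real.exp (Real.log n * -a) := by
        rw [Real.exp_le_exp]
        linarith
    _ = (n : ℝ) ^ (-a) := (Real.rpow_def_of_pos (by exact_mod_cast hn) _).symm

/-- The number of rounds is `O(y + a * log n)` and a round costs `O(z + 1)`. The cutoff was chosen
so that `y * z ≤ x`; all other products are at most a multiple of `(1 + a * log n) * x`. -/
theorem Net.steps_le (I : Net) {a : ℝ} (ha : 0 < a) {n T : ℕ} (hn : 2 ≤ n)
    (hT : 8200 * 7682 * (38 + 8 * a) * Real.log n ^ 1 * ((I.m : ℝ) / I.Δ) ≤ T) :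
    rounds a n (I.lam / (24 * I.Δ) + 1) * (8200 * (I.cutoff + 1)) + 36 ≤ T := by
  set L := Real.log n with hL
  -- The lower bound on the logarithm lets additive constants be absorbed into multiples of `L`.
  have hL2 : 1 / 2 ≤ L := by
    have h₁ : Real.log 2 ≤ L := Real.log_le_log (by norm_num) (by exact_mod_cast hn)
    have h₂ := Real.log_two_gt_d9
    linarith
  have hΔ : (0 : ℝ) < I.Δ := by exact_mod_cast I.Δ_pos
  have hΔm : (I.Δ : ℝ) ≤ I.m := by exact_mod_cast I.Δ_le
  have hlm : (I.lam : ℝ) ≤ I.m := by exact_mod_cast I.lam_le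
  set M : ℕ := max I.lam I.Δ with hM
  have hΔM : (I.Δ : ℝ) ≤ M := by exact_mod_cast le_max_right _ _
  have hlM : (I.lam : ℝ) ≤ M := by exact_mod_cast le_max_left _ _
  have hM0 : (0 : ℝ) < M := hΔ.trans_le hΔM
  set x : ℝ := I.m / I.Δ with hx
  set y : ℝ := I.lam / I.Δ with hy
  set z : ℝ := I.m / M with hz
  have hx1 : 1 ≤ x := (one_le_div hΔ).2 hΔm
  have hyx : y ≤ x := by rw [hy, hx]; gcongr
  have hzx : z ≤ x := by rw [hz, hx]; gcongr
  have hy0 : 0 ≤ y := by positivity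
  have hz0 : 0 ≤ z := by positivity
  have hyz : y * z ≤ x := by
    rw [hy, hz, hx, div_mul_div_comm, div_le_div_iff₀ (by positivity) hΔ]
    have : (I.lam : ℝ) * (I.m * I.Δ) ≤ M * (I.m * I.Δ) := by gcongr
    linarith
  have hq : ((I.cutoff + 1 : ℕ) : ℝ) ≤ 7680 * z + 2 := by
    have : ((7680 * I.m / M : ℕ) : ℝ) ≤ ((7680 * I.m : ℕ) : ℝ) / M := Nat.cast_div_le
    rw [Net.cutoff, ← hM]
    push_cast at this ⊢
    rw [mul_div_assoc] at this
    linarith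
  have hr : ((I.lam / (24 * I.Δ) + 1 : ℕ) : ℝ) ≤ y / 24 + 1 := by
    have : ((I.lam / (24 * I.Δ) : ℕ) : ℝ) ≤ (I.lam : ℝ) / ((24 * I.Δ : ℕ) : ℝ) := Nat.cast_div_le
    push_cast at this ⊢
    have h' : (I.lam : ℝ) / (24 * I.Δ) = y / 24 := by rw [hy, div_div, mul_comm]
    linarith
  have haL : 0 < a * L := by positivity
  -- The `17` is `8 * 2`, plus `1` for rounding up; the summand `8 * (y / 24)` is at most `y`.
  have hN : (rounds a n (I.lam / (24 * I.Δ) + 1) : ℝ) ≤ y + (17 + 8 * (a * L)) := by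
    have := (Nat.ceil_lt_add_one (show (0 : ℝ) ≤
      8 * ((I.lam / (24 * I.Δ) + 1 : ℕ) + 1 + a * Real.log n) by positivity)).le
    rw [rounds]
    rw [← hL] at this ⊢
    linarith
  have hprod : (rounds a n (I.lam / (24 * I.Δ) + 1) : ℝ) * ((I.cutoff + 1 : ℕ) : ℝ) ≤
      7682 * (18 + 8 * (a * L)) * x := by
    calc _ ≤ (y + (17 + 8 * (a * L))) * (7680 * z + 2) := by gcongr
      _ = 7680 * (y * z) + 2 * y + (17 + 8 * (a * L)) * (7680 * z + 2) := by ring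
      _ ≤ 7680 * x + 2 * x + (17 + 8 * (a * L)) * (7680 * x + 2 * x) := by
          gcongr
          linarith
      _ = _ := by ring
  -- As `38 * L ≥ 19`, the coefficient `38` covers the constant `18` and leaves a multiple of `x`
  -- above `36`.
  have hfin : 8200 * (7682 * (18 + 8 * (a * L)) * x) + 36 ≤
      8200 * 7682 * (38 + 8 * a) * L ^ 1 * x := by
    have h₁ : (0 : ℝ) ≤ (L - 1 / 2) * x := mul_nonneg (by linarith) (by linarith)
    have h₂ : 8200 * 7682 * (38 + 8 * a) * L ^ 1 * x - (8200 * (7682 * (18 + 8 * (a * L)) * x)) =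
      8200 * 7682 * (38 * ((L - 1 / 2) * x) + x) := by ring
    linarith
  have : ((rounds a n (I.lam / (24 * I.Δ) + 1) * (8200 * (I.cutoff + 1)) + 36 : ℕ) : ℝ) ≤ T := by
    refine le_trans (le_of_eq ?_) ((add_le_add_left (mul_le_mul_of_nonneg_left hprod
      (show (0 : ℝ) ≤ 8200 by norm_num)) 36).trans (hfin.trans hT))
    push_cast
    ring
  exact_mod_cast this

/-- The array holds distinct edges of `U`, so `D` counts some of the colored edges of `U` without
repetition. -/
theorem Net.Inv.le_ncard {I : Net} {G : SimpleGraph (Fin I.n)} [DecidableRel G.Adj]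
    {ν : Fin I.m ≃ G.edgeSet} {χ : PartialColoring G I.Δ} {U : Finset G.edgeSet}
    {col₀ col mark phi : ℕ → ℕ} {R D : ℕ} (h : I.Inv col₀ col mark phi R D)
    (hcol : ∀ i : Fin I.m, col i = colorCode (χ (ν i)))
    (hU : ∀ a < I.lam, ∃ i : Fin I.m, I.U a = i ∧ ν i ∈ U) :
    D ≤ {e | e ∈ U ∧ χ e ≠ none}.ncard := by
  classical
  have hinj : Function.Injective fun e : G.edgeSet => (ν.symm e : ℕ) :=
    fun _ _ he => ν.symm.injective (Fin.ext he)
  have hcard : (((Finset.range R).filter fun j => col (phi j) ≠ 0).image phi).card = D := by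
    rw [h.count, Finset.card_image_of_injOn]
    intro i hi j hj
    simp only [Finset.coe_filter, Finset.mem_range, Set.mem_ofPred_eq] at hi hj
    exact h.phi_inj i hi.1 j hj.1
  rw [← Set.ncard_image_of_injective _ hinj, ← hcard, ← Set.ncard_coe_finset]
  refine Set.ncard_le_ncard ?_ (Set.toFinite _)
  intro x hx
  simp only [Finset.coe_image, Finset.coe_filter, Finset.mem_range, Set.mem_image,
    Set.mem_ofPred_eq] at hx
  obtain ⟨j, ⟨hj, hj0⟩, rfl⟩ := hx
  obtain ⟨a, ha, he⟩ := h.phi_mem j hj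
  obtain ⟨i, hi, hiU⟩ := hU a ha
  rw [he, hi] at hj0 ⊢
  refine ⟨ν i, ⟨hiU, fun h0 => hj0 ?_⟩, by simp⟩
  rw [hcol, colorCode_eq_zero.2 h0]

theorem haltProb_extendColoring {I : Net} {G : SimpleGraph (Fin I.n)} [DecidableRel G.Adj]
    {ν : Fin I.m ≃ G.edgeSet} {χ : PartialColoring G I.Δ} {U : Finset G.edgeSet} {α β : Fin I.Δ}
    {σ : Mem} (h : IsInput G ν χ U α β σ) (hU : ∀ e ∈ U, χ e = none)
    (hαβ : AreLeastCommon χ α β) (hΔ : G.maxDegree = I.Δ) (hlam : I.lam = U.card)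
    (hfst : I.fst = σ 1) (hsnd : I.snd = σ 2) (hdeg : I.deg = σ 9) (hIU : I.U = σ 8)
    (hal : I.al = α) (hbe : I.be = β) {w : ℕ} (hw : I.n ^ 20 ≤ 2 ^ w) {a : ℝ} (ha : 0 < a) {T : ℕ}
    (hT : 8200 * 7682 * (38 + 8 * a) * Real.log I.n ^ 1 * ((I.m : ℝ) / I.Δ) ≤ T) :
    ENNReal.ofReal (1 - (I.n : ℝ) ^ (-a)) ≤ haltProb w extendColoring σ T fun σ' =>
      ∃ χ' : PartialColoring G I.Δ, IsProper χ' ∧ KeepsColored χ χ' ∧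
        1 / 48 * ((U.card : ℝ) / I.Δ) ≤ ({e | e ∈ U ∧ χ' e ≠ none}.ncard : ℝ) ∧
        Represents G ν χ' σ' := by
  have hM : I.Models G ν := ⟨fun i => by
    rw [hfst, hsnd]; exact h.rep.endpoints i, fun u => by rw [hdeg]; exact h.rep.degree u⟩
  obtain ⟨hn, hf⟩ := Net.Models.fits ν hΔ hw
  obtain ⟨f, -, hfU, hfeq⟩ := h.list_U
  have hIf : ∀ a < I.lam, ∃ i : Fin I.m, I.U a = i ∧ ν i ∈ U := fun a ha =>
    ⟨f ⟨a, hlam ▸ ha⟩, by rw [hIU]; exact hfeq ⟨a, hlam ▸ ha⟩, hfU _⟩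
  have hscr : ∀ b, 9 < b → ∀ i, σ b i = 0 := h.scratch
  have hinv : I.Inv (σ 3) (σ 3) (σ aMark) (σ aPhi) 0 0 := by
    refine Net.inv_zero (hscr _ (by norm_num)) ?_ ?_ ?_
    · intro a ha
      obtain ⟨i, hi, hiU⟩ := hIf a ha
      rw [hi]
      exact (h.rep.color i).trans (colorCode_eq_zero.2 (hU _ hiU))
    · rw [hal]
      exact Net.mul_card_haves_le ν hαβ (Or.inl rfl) h.rep.color
    · rw [hbe]
      exact Net.mul_card_haves_le ν hαβ (Or.inr rfl) h.rep.color
  have hfail := failProb_extendColoring hf (h.base hlam hfst hsnd hdeg hIU hal hbe) (hM.ds h.rep)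
    hinv (fun x => by rw [hscr _ (by norm_num)]; omega) (hscr _ (by norm_num) 0)
    (hscr _ (by norm_num) 0) (I.steps_le ha hn hT)
  refine le_trans ?_ (one_sub_failProb_le _ _ _ _ _)
  rw [ENNReal.ofReal_sub _ (by positivity), ENNReal.ofReal_one]
  refine tsub_le_tsub_left ((failProb_mono ?_).trans (hfail.trans
    (ENNReal.ofReal_le_ofReal (two_pow_mul_rounds_le (by omega) _)))) _
  rintro σ' ⟨hb', hd', mark, phi, R, D, hinv', hD⟩
  obtain ⟨χ', hproper, hrep⟩ := hM.exists_represents hb' hd'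
  refine ⟨χ', hproper, ?_, ?_, hrep⟩
  · intro e he he'
    obtain ⟨i, rfl⟩ := ν.surjective e
    have h₁ := h.rep.color i
    have h₂ := hrep.color i
    simp only [bCol] at h₁ h₂
    refine hinv'.keeps i i.2 ?_ (h₂.trans (colorCode_eq_zero.2 he'))
    rw [h₁]
    exact fun h0 => he (colorCode_eq_zero.1 h0)
  · have hle := hinv'.le_ncard hrep.color hIf
    have hΔ0 : (0 : ℝ) < I.Δ := by exact_mod_cast I.Δ_pos
    have h₁ : (I.lam : ℝ) ≤ D * 48 * I.Δ := by exact_mod_cast hD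
    have h₂ : (D : ℝ) ≤ ({e | e ∈ U ∧ χ' e ≠ none}.ncard : ℝ) := by exact_mod_cast hle
    rw [← hlam]
    refine le_trans ?_ h₂
    rw [← mul_div_assoc, div_le_iff₀ hΔ0]
    linarith

end EdgeColor

theorem lemma3p2 :
    ∃ (P : WordRAM.Prog) (κ k : ℕ) (c : ℝ), 0 < c ∧
      ∀ a : ℝ, 0 < a → ∃ C : ℝ,
        ∀ (n m Δ w : ℕ) (G : SimpleGraph (Fin n)) [DecidableRel G.Adj] (ν : Fin m ≃ G.edgeSet)
          (χ : EdgeColor.PartialColoring G Δ) (U : Finset G.edgeSet) (α β : Fin Δ)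
          (σ : WordRAM.Mem),
          G.IsBipartite → G.maxDegree = Δ →
          EdgeColor.IsProper χ → EdgeColor.IsEdgeMatching U → (∀ e ∈ U, χ e = none) →
          EdgeColor.AreLeastCommon χ α β →
          EdgeColor.IsInput G ν χ U α β σ → n ^ κ ≤ 2 ^ w →
          ∀ T : ℕ, C * Real.log n ^ k * ((m : ℝ) / Δ) ≤ T →
            ENNReal.ofReal (1 - (n : ℝ) ^ (-a)) ≤
              WordRAM.haltProb w P σ T fun σ' =>
                ∃ χ' : EdgeColor.PartialColoring G Δ,
                  EdgeColor.IsProper χ' ∧ EdgeColor.KeepsColored χ χ' ∧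
                  c * ((U.card : ℝ) / Δ) ≤ ({e | e ∈ U ∧ χ' e ≠ none}.ncard : ℝ) ∧
                  EdgeColor.Represents G ν χ' σ' := by
  -- The fraction `1 / 48` arises because the array has at least `lam / (24Δ)` edges and half of
  -- them get colored. Only one logarithmic factor is needed.
  refine ⟨EdgeColor.extendColoring, 20, 1, 1 / 48, by norm_num, fun a ha =>
    ⟨8200 * 7682 * (38 + 8 * a), ?_⟩⟩
  intro n m Δ w G _ ν χ U α β σ hG hΔ _ hM hU hαβ hin hw T hT
  obtain ⟨I, rfl, rfl, rfl, hlam, hfst, hsnd, hdeg, hIU, hal, hbe⟩ := hin.exists_net hG hΔ hM hαβ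
  exact EdgeColor.haltProb_extendColoring hin hU hαβ hΔ hlam hfst hsnd hdeg hIU hal hbe hw ha hT
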